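/- Let $\mathcal A$ be a finite alphabet with $d\ge 2$ letters. Combinatorial data are pairs $\pi=(\pi_t,\pi_b)$ of bijections $\mathcal A\to\{1,\dots,d\}$; $\pi$ is irreducible if $\pi_t^{-1}(\{1,\dots,k\})\neq\pi_b^{-1}(\{1,\dots,k\})$ for $1\le k<d$. An affine interval exchange map (i.e.m.) $T$ with data $\pi$ is given by lengths $|I^t_\alpha|,|I^b_\alpha|>0$ $(\alpha\in\mathcal A)$ with $\sum_\alpha|I^t_\alpha|=\sum_\alpha|I^b_\alpha|=:L$: the open intervals $I^t_\alpha$ (resp. $I^b_\alpha$) partition $(0,L)$ up to finitely many points, in the order $\pi_t$ (resp. $\pi_b$), and $T$ maps each $I^t_\alpha$ affinely and increasingly onto $I^b_\alpha$. The $d-1$ points $u^t_1<\dots<u^t_{d-1}$ of $(0,L)\setminus\bigcup I^t_\alpha$ are the singularities of $T$, the points $u^b_1<\dots<u^b_{d-1}$ of $(0,L)\setminus\bigcup I^b_\alpha$ those of $T^{-1}$. If $u^t_{d-1}\ne u^b_{d-1}$, a Rauzy–Veech step replaces $T$ by its first return map to $(0,\max(u^t_{d-1},u^b_{d-1}))$,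 again an affine i.e.m. over $\mathcal A$. The step is of top type if $u^t_{d-1}<u^b_{d-1}$ and of bottom type if $u^b_{d-1}<u^t_{d-1}$; its winner is the last letter for $\pi_t$, resp. for $\pi_b$. The new data depend only on $\pi$ and on the type, and define the arrows of a Rauzy diagram. An infinite path $\underline\gamma$ in this diagram is $\infty$-complete if it is a concatenation of infinitely many finite paths in each of which every letter is the winner of at least one arrow. Let $\underline\gamma$ be an $\infty$-complete path starting at irreducible data, and let $w\in\mathbb R^{\mathcal A}$, $w\ne0$. Let $\mathrm{Aff}^{(1)}(\underline\gamma,w)$ be the set of affine i.e.m. on the unit interval ($L=1$) whose successive Rauzy–Veech steps are given by $\underline\gamma$ and with $|I^b_\alpha|=e^{w_\alpha}|I^t_\alpha|$ for all $\alpha$; it is viewed as a subset of $\mathbb R^{\mathcal A}$ through the lengths $(|I^t_\alpha|)_\alpha$. Assume that there is $T^*\in\mathrm{Aff}^{(1)}(\underline\gamma,0)$, with lengths $\lambda^*$, such that $\sum_\alpha\lambda^*_\alpha w_\alpha=0$. **Proposition.** $\mathrm{Aff}^{(1)}(\underline\gamma,w)$ is a (nonempty) simplex; in particular its relative interior is nonempty.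 Let $T_0$ be any point of this relative interior. Let $Z$ be the set formed by $0$, $1$, the points $T_0^{m}(u^b_j)$ and the points $T_0^{-m}(u^t_i)$, $m\ge0$, $1\le i,j\le d-1$, where $u^t_i$, $u^b_j$ are the singularities of $T_0$, $T_0^{-1}$. A wandering interval of $T_0$ is a nonempty open interval $J$ on which all the iterates $T_0^n$, $n\in\mathbb Z$, are defined (that is, no $T_0^n(J)$ contains a singularity of $T_0$ or of $T_0^{-1}$) and whose images $T_0^n(J)$, $n\in\mathbb Z$, are pairwise disjoint. Then there is a canonical bijection between the vertices of $\mathrm{Aff}^{(1)}(\underline\gamma,w)$ and the disjoint union of * the set of orbits $\bigcup_{n\in\mathbb Z}T_0^n(J)$ of the maximal wandering intervals $J$ of $T_0$, and * the set of atoms, modulo Lebesgue-null sets, of the $\sigma$-algebra of measurable subsets $P\subseteq\overline Z$ with $T_0^{-1}(P)=P$ modulo null sets. It is described as follows. If $P$ is such an orbit or (a representative of) such an atom, the corresponding vertex is the i.e.m. $T_P$ with lengths $|I^t_\alpha(T_P)|=|P\cap I^t_\alpha(T_0)|/|P|$. The function $h_P(x)=|P\cap[0,x]|/|P|$ is a semiconjugacy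 from $T_0$ to $T_P$, i.e. a continuous nondecreasing map of $[0,1]$ onto $[0,1]$ which maps $I^t_\alpha(T_0)$ into $\overline{I^t_\alpha(T_P)}$ and satisfies $h_P\circ T_0=T_P\circ h_P$ on $I^t_\alpha(T_0)$ for each $\alpha$ (the affine branch of $T_P$ on $I^t_\alpha(T_P)$ being extended to the closure). Moreover $h_P(P)$ has measure $1$, and $h_P(Q)$ has measure $0$ for every $Q$ that is, or represents, an orbit or atom other than that of $P$. -/

import Mathlib

open Set MeasureTheory

noncomputable section

/-- The two sides of the combinatorial data: `top` for the domain, `bot` for the range. An arrow of a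
Rauzy diagram also has a side as its type. -/
inductive Side where
  | top : Side
  | bot : Side

/-- The opposite side. -/
def Side.other : Side → Side
  | .top => .bot
  | .bot => .top

/-- Combinatorial data `(π_t, π_b)` over the alphabet `A` with `d` letters. Positions are numbered
`0, …, d - 1` instead of `1, …, d`. -/
structure CombData (A : Type*) [Fintype A] where
  pos : Side → A ≃ Fin (Fintype.card A)

namespace CombData

variable {A : Type*} [Fintype A]

/-- For `1 ≤ k < d`, the first `k` letters on top and on the bottom are not the same set. -/
def Irreducible (π : CombData A) : Prop :=
  ∀ k : ℕ, 1 ≤ k → k < Fintype.card A →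
    {α | (π.pos .top α : ℕ) < k} ≠ {α | (π.pos .bot α : ℕ) < k}

variable [Nontrivial A]

/-- The last letter on a side (`α_t`, resp. `α_b`). -/
def last (π : CombData A) (s : Side) : A :=
  (π.pos s).symm ⟨Fintype.card A - 1, Nat.sub_lt Fintype.card_pos one_pos⟩

/-- `π'` is the image of `π` by the Rauzy operation of type `s`: the side `s` does not change, and on
the other side the last letter is moved to the place just after the last letter of side `s`. -/
def IsRauzyArrow (s : Side) (π π' : CombData A) : Prop :=
  π'.pos s = π.pos s ∧
  ∀ α, (π'.pos s.other α : ℕ) =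
    if (π.pos s.other α : ℕ) ≤ π.pos s.other (π.last s) then (π.pos s.other α : ℕ)
    else if (π.pos s.other α : ℕ) + 1 < Fintype.card A then (π.pos s.other α : ℕ) + 1
    else (π.pos s.other (π.last s) : ℕ) + 1

end CombData

/-- An infinite path in a Rauzy diagram, starting at irreducible combinatorial data. -/
structure RauzyPath (A : Type*) [Fintype A] [Nontrivial A] where
  comb : ℕ → CombData A
  type : ℕ → Side
  irreducible : (comb 0).Irreducible
  arrow : ∀ n, CombData.IsRauzyArrow (type n) (comb n) (comb (n + 1))

namespace RauzyPath

variable {A : Type*} [Fintype A] [Nontrivial A]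

/-- The winner of the `n`-th arrow. -/
def winner (γ : RauzyPath A) (n : ℕ) : A := (γ.comb n).last (γ.type n)

/-- The path is the concatenation of infinitely many complete paths, i.e. of finite paths in which
each letter is the winner of at least one arrow. -/
def InfComplete (γ : RauzyPath A) : Prop :=
  ∃ k : ℕ → ℕ, StrictMono k ∧ k 0 = 0 ∧
    ∀ i α, ∃ n, k i ≤ n ∧ n < k (i + 1) ∧ γ.winner n = α

end RauzyPath

/-- An affine interval exchange map, given by its combinatorial data and by the lengths
`|I_α^t| = len .top α` and `|I_α^b| = len .bot α`. -/
@[ext]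
structure AffineIEM (A : Type*) [Fintype A] where
  comb : CombData A
  len : Side → A → ℝ
  len_pos : ∀ s α, 0 < len s α
  sum_len : ∑ α, len .top α = ∑ α, len .bot α

namespace AffineIEM

variable {A : Type*} [Fintype A]

/-- The length of the interval `(0, total)` on which the map acts. -/
def total (T : AffineIEM A) : ℝ := ∑ α, T.len .top α

/-- The left endpoint of `I_α^t` (resp. `I_α^b`). -/
def left (T : AffineIEM A) (s : Side) (α : A) : ℝ :=
  ∑ β with T.comb.pos s β < T.comb.pos s α, T.len s β

/-- The open interval `I_α^t` (resp. `I_α^b`). -/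
def interval (T : AffineIEM A) (s : Side) (α : A) : Set ℝ :=
  Ioo (T.left s α) (T.left s α + T.len s α)

/-- The affine map which sends `I_α^t` onto `I_α^b`. -/
def branch (T : AffineIEM A) (α : A) (x : ℝ) : ℝ :=
  T.left .bot α + T.len .bot α / T.len .top α * (x - T.left .top α)

/-- `T.Maps x y` means that `T` is defined at `x` (`x` lies in some `I_α^t`) and `T x = y`. -/
def Maps (T : AffineIEM A) (x y : ℝ) : Prop :=
  ∃ α, x ∈ T.interval .top α ∧ T.branch α x = y

/-- The singularities of `T` (for `s = top`) and of `T⁻¹` (for `s = bot`). -/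
def singularities (T : AffineIEM A) (s : Side) : Set ℝ :=
  Ioo 0 T.total \ ⋃ α, T.interval s α

/-- The singular orbits `Z`: the endpoints of the domain, the forward orbits of the singularities of
`T⁻¹` and the backward orbits of the singularities of `T`. -/
def singularOrbits (T : AffineIEM A) : Set ℝ :=
  {0, T.total} ∪ {x | ∃ u ∈ T.singularities .bot, Relation.ReflTransGen T.Maps u x} ∪
    {x | ∃ u ∈ T.singularities .top, Relation.ReflTransGen T.Maps x u}

/-- `J n = T^n (J 0)` for all `n ∈ ℤ`, where `J 0` is a nonempty open interval, all the `T^n` are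
defined (hence affine) on `J 0`, and the `J n` are pairwise disjoint. -/
def IsWanderingSeq (T : AffineIEM A) (J : ℤ → Set ℝ) : Prop :=
  (∃ a b, a < b ∧ J 0 = Ioo a b) ∧
  (∀ n, ∃ α, J n ⊆ T.interval .top α ∧ J (n + 1) = T.branch α '' J n) ∧
  Pairwise (fun m n => Disjoint (J m) (J n))

/-- `U` is a wandering interval (wandering intervals are represented by their interiors). -/
def IsWandering (T : AffineIEM A) (U : Set ℝ) : Prop :=
  ∃ J, T.IsWanderingSeq J ∧ J 0 = U

/-- `P` is the orbit `⋃ n, T^n U` of a maximal wandering interval `U`. -/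
def IsWanderingOrbit (T : AffineIEM A) (P : Set ℝ) : Prop :=
  ∃ J, T.IsWanderingSeq J ∧ Maximal T.IsWandering (J 0) ∧ P = ⋃ n, J n

/-- The set `P` is measurable and `T⁻¹ P = P` modulo sets of Lebesgue measure `0`. -/
def IsInvariantModZero (T : AffineIEM A) (P : Set ℝ) : Prop :=
  MeasurableSet P ∧ {x | ∃ y ∈ P, T.Maps x y} =ᵐ[volume] P

/-- `P` is an atom among the mod `0` invariant subsets of the closure of the singular orbits. -/
def IsInvariantAtom (T : AffineIEM A) (P : Set ℝ) : Prop :=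
  P ⊆ closure T.singularOrbits ∧ T.IsInvariantModZero P ∧ volume P ≠ 0 ∧
  ∀ Q ⊆ P, T.IsInvariantModZero Q → volume Q = 0 ∨ volume (P \ Q) = 0

/-- The set of orbits of maximal wandering intervals. -/
def WanderingOrbit (T : AffineIEM A) : Type := {P : Set ℝ // T.IsWanderingOrbit P}

/-- Equality modulo sets of Lebesgue measure `0`, on atoms. -/
def atomSetoid (T : AffineIEM A) : Setoid {P : Set ℝ // T.IsInvariantAtom P} where
  r P Q := P.1 =ᵐ[volume] Q.1
  iseqv := ⟨fun _ => Filter.EventuallyEq.rfl, fun h => h.symm, fun h h' => h.trans h'⟩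

/-- The set of atoms, two atoms being identified when they are equal modulo measure `0`. -/
def AtomClass (T : AffineIEM A) : Type := Quotient T.atomSetoid

/-- The set `P ⊆ ℝ` is the given wandering orbit, or represents the given atom. -/
def Represents (T : AffineIEM A) : T.WanderingOrbit ⊕ T.AtomClass → Set ℝ → Prop
  | .inl O, P => P = O.1
  | .inr c, P => ∃ h : T.IsInvariantAtom P, Quotient.mk T.atomSetoid ⟨P, h⟩ = c

/-- The nondecreasing function `x ↦ |P ∩ [0, x]| / |P|`. -/
def collapse (P : Set ℝ) (x : ℝ) : ℝ := volume.real (P ∩ Icc 0 x) / volume.real P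

/-- `h` is a semiconjugacy from `T` to `S` (with the same combinatorial data): a continuous
nondecreasing map of `[0, T.total]` onto `[0, S.total]` with `h ∘ T = S ∘ h` on each `I_α^t(T)`,
where, as `h` need not be injective, `h x` may be an endpoint of `I_α^t(S)`, at which the branch of
`S` on `I_α^t(S)` is extended by continuity. -/
def IsSemiconj (T S : AffineIEM A) (h : ℝ → ℝ) : Prop :=
  T.comb = S.comb ∧ ContinuousOn h (Icc 0 T.total) ∧ MonotoneOn h (Icc 0 T.total) ∧
  h '' Icc 0 T.total = Icc 0 S.total ∧
  ∀ α, ∀ x ∈ T.interval .top α,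
    h x ∈ closure (S.interval .top α) ∧ h (T.branch α x) = S.branch α (h x)

variable [Nontrivial A]

/-- `T'` is deduced from `T` by an elementary step of type `s` of the Rauzy–Veech algorithm, i.e. `T'`
is the first return map of `T` to `(0, max u_{d-1}^t u_{d-1}^b)`. Let `a` be the winner (the last
letter of side `s`) and `b` the loser (the last letter of the other side). The step is of type `s` if
`I_a^s` is longer than `I_b^{s'}`, where `s'` is the other side. For `s = top`, the interval `I_a^t`
is cut by `|I_b^b|`, and `I_b^b` is replaced by its image by `T`, which is removed from `I_a^b`;
for `s = bot` the same is done with `T⁻¹`. -/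
def IsRauzyVeechStep (s : Side) (T T' : AffineIEM A) : Prop :=
  let a := T.comb.last s
  let b := T.comb.last s.other
  T.len s.other b < T.len s a ∧
  CombData.IsRauzyArrow s T.comb T'.comb ∧
  T'.len s a = T.len s a - T.len s.other b ∧
  T'.len s.other a = T.len s.other a - T.len s.other a / T.len s a * T.len s.other b ∧
  T'.len s b = T.len s b ∧
  T'.len s.other b = T.len s.other a / T.len s a * T.len s.other b ∧
  ∀ α, α ≠ a → α ≠ b → ∀ r, T'.len r α = T.len r α

/-- The orbit of `T` under the Rauzy–Veech algorithm is given by the infinite path `γ`. -/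
def Follows (T : AffineIEM A) (γ : RauzyPath A) : Prop :=
  ∃ S : ℕ → AffineIEM A, S 0 = T ∧
    ∀ n, (S n).comb = γ.comb n ∧ IsRauzyVeechStep (γ.type n) (S n) (S (n + 1))

end AffineIEM

variable {A : Type*} [Fintype A] [Nontrivial A]

/-- `Aff(γ, w)`: the affine i.e.m. with Rauzy–Veech expansion `γ` and slope vector `exp w`. -/
def Aff (γ : RauzyPath A) (w : A → ℝ) : Set (AffineIEM A) :=
  {T | T.Follows γ ∧ ∀ α, T.len .bot α = Real.exp (w α) * T.len .top α}

/-- `Aff⁽¹⁾(γ, w)`: the elements of `Aff(γ, w)` with domain of length `1`. -/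
def AffOne (γ : RauzyPath A) (w : A → ℝ) : Set (AffineIEM A) :=
  {T | T ∈ Aff γ w ∧ T.total = 1}

/-- `Aff⁽¹⁾(γ, w)` as a subset of `ℝ^A`, parametrized by the lengths `|I_α^t|` (which determine the
map, as the combinatorial data and the slopes are fixed). -/
def AffOneLengths (γ : RauzyPath A) (w : A → ℝ) : Set (A → ℝ) :=
  (fun T => T.len .top) '' AffOne γ w

/-- The vertices of `Aff⁽¹⁾(γ, w)`. -/
def AffOneVertices (γ : RauzyPath A) (w : A → ℝ) : Set (AffineIEM A) :=
  {T | T ∈ AffOne γ w ∧ T.len .top ∈ (AffOneLengths γ w).extremePoints ℝ}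

end

noncomputable section

/-! Along a fixed path the slopes at every level are determined by `w`, so the top lengths after `n`
steps are a linear image `chain γ w n` of the initial ones. Hence `AffOneLengths γ w` is given by
linear conditions: positivity of all the vectors `chain γ w n x`, equality of the top and bottom
totals, and total length one (`mem_AffOneLengths_iff`). Nonemptiness comes from a duality: the
logarithms of the slopes pair invariantly with the lengths of `Tstar` (`pairing_chain`), so at each
level some positive vector is orthogonal to them. It can be rescaled to a balanced vector
(`exists_balanced`) and pulled back through steps whose inverses are nonnegative. A limit is
nonnegative at all levels, and completeness of the path makes it positive (`chain_pos_of_nonneg`).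

Let `T` be in the relative interior. The distribution function of an invariant set `P` of positive
measure has increments that are multiplied by the slopes of `T`. Its increments over the intervals
at successive levels therefore obey the same recursion as the lengths (`IsLevels.mass_eq_chain`),
and `P` defines a point of the set (`lengthsOf_mem`). The maximal wandering intervals are the gaps
of the closure of the singular orbits (`IsLevels.isWanderingOrbit_iff`). Essentially disjoint pieces
give linearly independent vectors (`linearIndependent_lengthsOf`), because a function of the above
kind with zero increments over the top intervals vanishes on that closure. So there are finitely
many orbits and atoms, and together they cover almost everything (`IsLevels.ae_exists_mem_rep`).

Conversely, let `U` be any point of the set. The segment from `U` to `T` can be prolonged beyond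
`T`, so at all levels the lengths of `U` are at most a fixed multiple `C` of those of `T`.
Semiconjugacies constructed from level `n` up to level `0` keep the Lipschitz constant `C`. Their
limit is a semiconjugacy on the closure of the singular orbits, and affine interpolation in the gaps
makes it one everywhere (`IsLevels.exists_linearConj`). Its derivative is invariant, hence constant
on orbits of gaps and almost everywhere constant on atoms. Integrating it writes the lengths of `U`
as a nonnegative combination of the vectors of the pieces (`PartialConj.exists_len_eq_sum`). The set
is thus the convex hull of linearly independent vectors, which are its vertices. -/

@[simp] theorem Side.other_top : Side.top.other = .bot := rfl

@[simp] theorem Side.other_bot : Side.bot.other = .top := rfl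

@[simp] theorem Side.other_other (s : Side) : s.other.other = s := by cases s <;> rfl

theorem Side.eq_or_eq_other (r s : Side) : r = s ∨ r = s.other := by
  cases r <;> cases s <;> simp

namespace AffineIEM

/-! ### The two partitions and the affine branches. -/

section Geometry

variable {A : Type*} [Fintype A] (T : AffineIEM A)

theorem sum_len_eq_total (s : Side) : ∑ α, T.len s α = T.total := by
  cases s
  · rfl
  · exact T.sum_len.symm

/-- The sum of the lengths of the first `k` intervals of a side. -/
def cut (s : Side) (k : ℕ) : ℝ := ∑ β with (T.comb.pos s β : ℕ) < k, T.len s β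

theorem left_eq_cut (s : Side) (α : A) : T.left s α = T.cut s (T.comb.pos s α) := by
  simp only [left, cut, Fin.val_fin_lt]

theorem cut_zero (s : Side) : T.cut s 0 = 0 := by simp [cut]

theorem cut_card (s : Side) : T.cut s (Fintype.card A) = T.total := by
  rw [← T.sum_len_eq_total s, cut, Finset.filter_true_of_mem]
  intro β _
  exact (T.comb.pos s β).2

theorem cut_succ (s : Side) (α : A) :
    T.cut s (T.comb.pos s α + 1) = T.cut s (T.comb.pos s α) + T.len s α := by
  classical
  have : (Finset.univ.filter fun β => (T.comb.pos s β : ℕ) < T.comb.pos s α + 1) =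
      insert α (Finset.univ.filter fun β => (T.comb.pos s β : ℕ) < T.comb.pos s α) := by
    ext β
    simp only [Finset.mem_filter, Finset.mem_univ, true_and, Finset.mem_insert, Nat.lt_succ_iff,
      le_iff_lt_or_eq]
    rw [or_comm, ← Fin.ext_iff, (T.comb.pos s).apply_eq_iff_eq]
  rw [cut, this, Finset.sum_insert (by simp), add_comm]
  rfl

theorem right_eq_cut (s : Side) (α : A) :
    T.left s α + T.len s α = T.cut s (T.comb.pos s α + 1) := by
  rw [cut_succ, left_eq_cut]

theorem sum_filter_pos_lt (s : Side) (f : ℕ → ℝ) {k : ℕ} (hk : k ≤ Fintype.card A) :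
    ∑ β with (T.comb.pos s β : ℕ) < k, f (T.comb.pos s β) = ∑ i ∈ Finset.range k, f i := by
  refine Finset.sum_bij (fun β _ => (T.comb.pos s β : ℕ)) ?_ ?_ ?_ ?_
  · intro β hβ
    simpa using hβ
  · intro β _ β' _ h
    exact (T.comb.pos s).injective (Fin.ext h)
  · intro i hi
    have hi' : i < Fintype.card A := (Finset.mem_range.1 hi).trans_le hk
    exact ⟨(T.comb.pos s).symm ⟨i, hi'⟩, by simpa using hi, by simp⟩
  · intro β _
    rfl

/-- Consecutive intervals share an endpoint, so the sum telescopes. `F` is arbitrary because the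
identity and its consequences serve for step functions, truncations and distribution functions
alike. -/
theorem sum_increments_cut (s : Side) (F : ℝ → ℝ) {k : ℕ} (hk : k ≤ Fintype.card A) :
    ∑ β with (T.comb.pos s β : ℕ) < k, (F (T.left s β + T.len s β) - F (T.left s β)) =
      F (T.cut s k) - F 0 := by
  simp_rw [right_eq_cut]
  simp_rw [left_eq_cut]
  rw [T.sum_filter_pos_lt s (fun i => F (T.cut s (i + 1)) - F (T.cut s i)) hk,
    Finset.sum_range_sub (fun i => F (T.cut s i)), cut_zero]

theorem sum_increments_left (s : Side) (F : ℝ → ℝ) (α : A) :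
    ∑ β with T.comb.pos s β < T.comb.pos s α, (F (T.left s β + T.len s β) - F (T.left s β)) =
      F (T.left s α) - F 0 := by
  rw [left_eq_cut, ← T.sum_increments_cut s F (T.comb.pos s α).2.le]
  simp only [Fin.val_fin_lt]

theorem sum_increments (s : Side) (F : ℝ → ℝ) :
    ∑ β, (F (T.left s β + T.len s β) - F (T.left s β)) = F T.total - F 0 := by
  rw [← T.cut_card s, ← T.sum_increments_cut s F le_rfl, Finset.filter_true_of_mem]
  intro β _
  exact (T.comb.pos s β).2

theorem cut_mono (s : Side) : Monotone (T.cut s) := by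
  intro i j hij
  refine Finset.sum_le_sum_of_subset_of_nonneg ?_ fun β _ _ => (T.len_pos s β).le
  intro β
  simp only [Finset.mem_filter, Finset.mem_univ, true_and]
  omega

theorem left_nonneg (s : Side) (α : A) : 0 ≤ T.left s α :=
  Finset.sum_nonneg fun β _ => (T.len_pos s β).le

theorem right_le_total (s : Side) (α : A) : T.left s α + T.len s α ≤ T.total := by
  rw [right_eq_cut, ← T.cut_card s]
  exact T.cut_mono s (T.comb.pos s α).2

theorem right_le_left {s : Side} {α β : A} (h : T.comb.pos s α < T.comb.pos s β) :
    T.left s α + T.len s α ≤ T.left s β := by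
  rw [right_eq_cut, left_eq_cut]
  exact T.cut_mono s h

theorem left_lt_left_iff {s : Side} {α β : A} :
    T.left s α < T.left s β ↔ T.comb.pos s α < T.comb.pos s β := by
  constructor
  · intro h
    by_contra hc
    rcases (not_lt.1 hc).lt_or_eq with h' | h'
    · linarith [T.right_le_left h', T.len_pos s β]
    · rw [(T.comb.pos s).injective h'] at h
      exact lt_irrefl _ h
  · intro h
    linarith [T.right_le_left h, T.len_pos s α]

theorem left_injective (s : Side) : Function.Injective (T.left s) := by
  intro α β h
  apply (T.comb.pos s).injective
  rcases lt_trichotomy (T.comb.pos s α) (T.comb.pos s β) with h' | h' | h'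
  · linarith [T.left_lt_left_iff.2 h']
  · exact h'
  · linarith [T.left_lt_left_iff.2 h']

theorem right_le_left_of_left_lt {s : Side} {α β : A} (h : T.left s α < T.left s β) :
    T.left s α + T.len s α ≤ T.left s β :=
  T.right_le_left (T.left_lt_left_iff.1 h)

theorem exists_mem_Ico (s : Side) {x : ℝ} (h0 : 0 ≤ x) (h1 : x < T.total) :
    ∃ α, x ∈ Ico (T.left s α) (T.left s α + T.len s α) := by
  by_contra! hc
  -- This step function jumps by one in total, but its increment is zero over every interval that
  -- misses `x`.
  have := T.sum_increments s fun y => if x < y then 1 else 0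
  rw [if_pos h1, if_neg h0.not_gt, Finset.sum_eq_zero] at this
  · norm_num at this
  · intro β _
    have h := hc β
    rw [mem_Ico, not_and, not_lt] at h
    by_cases h2 : T.left s β ≤ x
    · rw [if_neg (h h2).not_gt, if_neg h2.not_gt, sub_self]
    · rw [not_le] at h2
      rw [if_pos (h2.trans (by linarith [T.len_pos s β])), if_pos h2, sub_self]

theorem total_pos [Nonempty A] : 0 < T.total :=
  Finset.sum_pos (fun α _ => T.len_pos _ α) Finset.univ_nonempty

theorem interval_subset (s : Side) (α : A) : T.interval s α ⊆ Ioo 0 T.total := fun _ hx =>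
  ⟨(T.left_nonneg s α).trans_lt hx.1, hx.2.trans_le (T.right_le_total s α)⟩

theorem eq_of_mem_interval {s : Side} {α β : A} {x : ℝ} (h : x ∈ T.interval s α)
    (h' : x ∈ T.interval s β) : α = β := by
  apply T.left_injective s
  rcases lt_trichotomy (T.left s α) (T.left s β) with hlt | heq | hlt
  · linarith [T.right_le_left_of_left_lt hlt, h.2, h'.1]
  · exact heq
  · linarith [T.right_le_left_of_left_lt hlt, h'.2, h.1]

theorem exists_mem_interval (s : Side) {x : ℝ} (hx : x ∈ Ioo 0 T.total)
    (h : ∀ α, x ≠ T.left s α) : ∃ α, x ∈ T.interval s α := by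
  obtain ⟨α, hα⟩ := T.exists_mem_Ico s hx.1.le hx.2
  exact ⟨α, lt_of_le_of_ne hα.1 (h α).symm, hα.2⟩

theorem left_notMem_interval (s : Side) (α β : A) : T.left s α ∉ T.interval s β := by
  intro h
  linarith [T.right_le_left_of_left_lt h.1, h.2]

theorem mem_singularities_iff {s : Side} {x : ℝ} :
    x ∈ T.singularities s ↔ 0 < x ∧ ∃ α, x = T.left s α := by
  constructor
  · rintro ⟨hx, h⟩
    refine ⟨hx.1, ?_⟩
    by_contra! hc
    exact h (mem_iUnion.2 (T.exists_mem_interval s hx hc))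
  · rintro ⟨h0, α, rfl⟩
    refine ⟨⟨h0, by linarith [T.right_le_total s α, T.len_pos s α]⟩, ?_⟩
    simp only [mem_iUnion, not_exists]
    exact fun β => T.left_notMem_interval s α β

theorem exists_left_eq_zero [Nonempty A] (s : Side) : ∃ α, T.left s α = 0 := by
  obtain ⟨α, hα⟩ := T.exists_mem_Ico s le_rfl T.total_pos
  exact ⟨α, le_antisymm hα.1 (T.left_nonneg s α)⟩

theorem right_eq_total_or_exists_left (s : Side) (α : A) :
    T.left s α + T.len s α = T.total ∨ ∃ β, T.left s α + T.len s α = T.left s β := by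
  rcases (T.right_le_total s α).lt_or_eq with h | h
  · right
    obtain ⟨β, hβ⟩ := T.exists_mem_Ico s
      (by linarith [T.left_nonneg s α, T.len_pos s α] : 0 ≤ T.left s α + T.len s α) h
    refine ⟨β, le_antisymm ?_ hβ.1⟩
    by_contra hc
    rw [not_le] at hc
    rcases lt_trichotomy (T.left s α) (T.left s β) with hlt | heq | hlt
    · linarith [T.right_le_left_of_left_lt hlt]
    · rw [T.left_injective s heq] at hβ
      exact lt_irrefl _ hβ.2
    · linarith [T.right_le_left_of_left_lt hlt, T.len_pos s α, hβ.2]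
  · exact Or.inl h

/-- The affine map which sends the closed interval of the letter `α` on the side `s` onto the one on
the other side. -/
def br (s : Side) (α : A) (x : ℝ) : ℝ :=
  T.left s.other α + T.len s.other α / T.len s α * (x - T.left s α)

theorem branch_eq_br (α : A) : T.branch α = T.br .top α := rfl

/-- The slope of the affine map `br`. -/
def slope (s : Side) (α : A) : ℝ := T.len s.other α / T.len s α

theorem slope_pos (s : Side) (α : A) : 0 < T.slope s α := div_pos (T.len_pos _ _) (T.len_pos _ _)

theorem slope_mul_len (s : Side) (α : A) : T.slope s α * T.len s α = T.len s.other α :=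
  div_mul_cancel₀ _ (T.len_pos _ _).ne'

theorem slope_other_mul_slope (s : Side) (α : A) : T.slope s.other α * T.slope s α = 1 := by
  have := (T.len_pos s α).ne'
  have := (T.len_pos s.other α).ne'
  simp only [slope, Side.other_other]
  field_simp

theorem br_def (s : Side) (α : A) (x : ℝ) :
    T.br s α x = T.left s.other α + T.slope s α * (x - T.left s α) := rfl

theorem br_sub_br (s : Side) (α : A) (x y : ℝ) :
    T.br s α y - T.br s α x = T.slope s α * (y - x) := by
  simp only [br_def]; ring

theorem br_left (s : Side) (α : A) : T.br s α (T.left s α) = T.left s.other α := by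
  simp [br_def]

theorem br_right (s : Side) (α : A) :
    T.br s α (T.left s α + T.len s α) = T.left s.other α + T.len s.other α := by
  rw [br_def, add_sub_cancel_left, slope_mul_len]

theorem br_strictMono (s : Side) (α : A) : StrictMono (T.br s α) := by
  intro x y h
  nlinarith [T.br_sub_br s α x y, T.slope_pos s α, mul_pos (T.slope_pos s α) (sub_pos.2 h)]

theorem continuous_br (s : Side) (α : A) : Continuous (T.br s α) := by
  unfold br
  fun_prop

theorem br_other_br (s : Side) (α : A) (x : ℝ) : T.br s.other α (T.br s α x) = x := by
  rw [br_def, Side.other_other, br_def, add_sub_cancel_left, ← mul_assoc, slope_other_mul_slope]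
  ring

theorem br_br_other (s : Side) (α : A) (x : ℝ) : T.br s α (T.br s.other α x) = x := by
  simpa using T.br_other_br s.other α x

theorem br_mem_interval_iff {s : Side} {α : A} {x : ℝ} :
    T.br s α x ∈ T.interval s.other α ↔ x ∈ T.interval s α := by
  simp only [interval, mem_Ioo]
  rw [← T.br_right s α, ← T.br_left s α, (T.br_strictMono s α).lt_iff_lt,
    (T.br_strictMono s α).lt_iff_lt]

theorem br_top_mem {α : A} {x : ℝ} (h : x ∈ T.interval .top α) :
    T.br .top α x ∈ T.interval .bot α := (T.br_mem_interval_iff (s := .top)).2 h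

theorem br_bot_mem {α : A} {x : ℝ} (h : x ∈ T.interval .bot α) :
    T.br .bot α x ∈ T.interval .top α := (T.br_mem_interval_iff (s := .bot)).2 h

/-- The closed interval of the letter `α` on the side `s`. -/
def cl (s : Side) (α : A) : Set ℝ := Icc (T.left s α) (T.left s α + T.len s α)

theorem interval_subset_cl (s : Side) (α : A) : T.interval s α ⊆ T.cl s α := Ioo_subset_Icc_self

theorem cl_subset (s : Side) (α : A) : T.cl s α ⊆ Icc 0 T.total := fun _ hx =>
  ⟨(T.left_nonneg s α).trans hx.1, hx.2.trans (T.right_le_total s α)⟩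

theorem left_mem_cl (s : Side) (α : A) : T.left s α ∈ T.cl s α :=
  ⟨le_rfl, by linarith [T.len_pos s α]⟩

theorem right_mem_cl (s : Side) (α : A) : T.left s α + T.len s α ∈ T.cl s α :=
  ⟨by linarith [T.len_pos s α], le_rfl⟩

theorem br_mem_cl {s : Side} {α : A} {x : ℝ} (h : x ∈ T.cl s α) :
    T.br s α x ∈ T.cl s.other α := by
  constructor
  · rw [← T.br_left s α]
    exact (T.br_strictMono s α).monotone h.1
  · rw [← T.br_right s α]
    exact (T.br_strictMono s α).monotone h.2

theorem eq_left_or_eq_right_or_mem {s : Side} {α : A} {x : ℝ} (h : x ∈ T.cl s α) :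
    x = T.left s α ∨ x = T.left s α + T.len s α ∨ x ∈ T.interval s α := by
  rcases h.1.eq_or_lt with h1 | h1
  · exact Or.inl h1.symm
  · rcases h.2.eq_or_lt with h2 | h2
    · exact Or.inr (Or.inl h2)
    · exact Or.inr (Or.inr ⟨h1, h2⟩)

end Geometry

/-! ### Induction on a shorter interval, seen from either side. -/

section Induces

variable {A : Type*} [Fintype A] {T T' : AffineIEM A}

theorem slope_other_eq (T : AffineIEM A) (s : Side) (α : A) :
    T.slope s.other α = (T.slope s α)⁻¹ :=
  eq_inv_of_mul_eq_one_left (T.slope_other_mul_slope s α)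

/-- For a Rauzy–Veech step from `T` to `T'` with loser `b`, and a given side: `T'` is induced by `T`
on `(0, T'.total)`, and the points of the new interval of `b` return after going through the
interval of `β`, and then through the part `(T'.total, T.total)` of the interval of `β'`. -/
structure Induces (T T' : AffineIEM A) (r : Side) (b β β' : A) : Prop where
  total_lt : T'.total < T.total
  br_ne : ∀ α, α ≠ b → T'.br r α = T.br r α
  slope_ne : ∀ α, α ≠ b → T'.slope r α = T.slope r α
  cl_ne : ∀ α, α ≠ b → T'.cl r α ⊆ T.cl r α
  interval_ne : ∀ α, α ≠ b → T'.interval r α ⊆ T.interval r α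
  cl_loser : T'.cl r b ⊆ T.cl r β
  interval_loser : T'.interval r b ⊆ T.interval r β
  br_left_loser : T.br r β (T'.left r b) = T'.total
  br_right_loser : T.br r β (T'.left r b + T'.len r b) = T.total
  left_lt : T.left r β' ≤ T'.total
  right_eq : T.left r β' + T.len r β' = T.total
  br_loser : ∀ x, T'.br r b x = T.br r β' (T.br r β x)
  slope_loser : T'.slope r b = T.slope r β' * T.slope r β
  cover : ∀ α, ∀ x ∈ T.cl r α, (α ≠ b ∧ x ∈ T'.cl r α) ∨ (α = β ∧ x ∈ T'.cl r b) ∨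
    (α = β' ∧ x ∈ Icc T'.total T.total)

namespace Induces

variable {r : Side} {b β β' : A}

theorem br_mem_Icc (h : Induces T T' r b β β') {x : ℝ} (hx : x ∈ T'.cl r b) :
    T.br r β x ∈ Icc T'.total T.total :=
  ⟨h.br_left_loser ▸ (T.br_strictMono r β).monotone hx.1,
    h.br_right_loser ▸ (T.br_strictMono r β).monotone hx.2⟩

theorem br_mem_Ioo (h : Induces T T' r b β β') {x : ℝ} (hx : x ∈ T'.interval r b) :
    T.br r β x ∈ Ioo T'.total T.total :=
  ⟨h.br_left_loser ▸ T.br_strictMono r β hx.1, h.br_right_loser ▸ T.br_strictMono r β hx.2⟩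

theorem Icc_subset (h : Induces T T' r b β β') : Icc T'.total T.total ⊆ T.cl r β' :=
  Icc_subset_Icc h.left_lt h.right_eq.ge

theorem Ioo_subset (h : Induces T T' r b β β') : Ioo T'.total T.total ⊆ T.interval r β' :=
  Ioo_subset_Ioo h.left_lt h.right_eq.ge

theorem br_other_mem_cl (h : Induces T T' r b β β') {x : ℝ} (hx : x ∈ Icc T'.total T.total) :
    T.br r.other β x ∈ T'.cl r b := by
  constructor
  · rw [← T.br_other_br r β (T'.left r b), h.br_left_loser]
    exact (T.br_strictMono r.other β).monotone hx.1
  · rw [← T.br_other_br r β (_ + _), h.br_right_loser]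
    exact (T.br_strictMono r.other β).monotone hx.2

end Induces

end Induces

/-! ### A Rauzy–Veech step is an induction for the map and for its inverse. -/

section Step

variable {A : Type*} [Fintype A] [Nontrivial A]

theorem pos_last (π : CombData A) (s : Side) :
    (π.pos s (π.last s) : ℕ) = Fintype.card A - 1 := by
  simp [CombData.last]

theorem right_last (T : AffineIEM A) (s : Side) :
    T.left s (T.comb.last s) + T.len s (T.comb.last s) = T.total := by
  rw [right_eq_cut, ← T.cut_card s, pos_last]
  congr 1
  have : 0 < Fintype.card A := Fintype.card_pos
  omega

theorem pos_lt_last {π : CombData A} {s : Side} {α : A} (h : α ≠ π.last s) :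
    π.pos s α < π.pos s (π.last s) := by
  rw [Fin.lt_def, pos_last]
  have h1 : (π.pos s α : ℕ) ≠ Fintype.card A - 1 := by
    rw [← pos_last π s]
    exact fun hc => h ((π.pos s).injective (Fin.ext hc))
  have := (π.pos s α).2
  omega

variable {T T' : AffineIEM A} {s : Side}

namespace IsRauzyVeechStep

theorem last_ne (h : IsRauzyVeechStep s T T') : T.comb.last s ≠ T.comb.last s.other := by
  obtain ⟨h0, -, h1, -, h2, -⟩ := h
  intro hab
  rw [← hab] at h1 h2
  linarith [T.len_pos s.other (T.comb.last s)]

theorem last_succ (h : IsRauzyVeechStep s T T') : T'.comb.last s = T.comb.last s := by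
  unfold CombData.last
  rw [h.2.1.1]

theorem len_same (h : IsRauzyVeechStep s T T') {α : A} (hα : α ≠ T.comb.last s) :
    T'.len s α = T.len s α := by
  by_cases hb : α = T.comb.last s.other
  · rw [hb]
    exact h.2.2.2.2.1
  · exact h.2.2.2.2.2.2 α hα hb s

/-- On its own side only the winner changes length, and being last there it precedes no letter. -/
theorem left_same (h : IsRauzyVeechStep s T T') (α : A) : T'.left s α = T.left s α := by
  unfold left
  rw [h.2.1.1]
  refine Finset.sum_congr rfl fun β hβ => h.len_same ?_
  rintro rfl
  rw [Finset.mem_filter, Fin.lt_def, pos_last] at hβ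
  have := (T.comb.pos s α).2
  omega

theorem total_eq (h : IsRauzyVeechStep s T T') :
    T'.total = T.total - T.len s.other (T.comb.last s.other) := by
  rw [← right_last T' s, h.last_succ, h.left_same, h.2.2.1, ← right_last T s]
  ring

theorem len_other_add (h : IsRauzyVeechStep s T T') :
    T'.len s.other (T.comb.last s) + T'.len s.other (T.comb.last s.other) =
      T.len s.other (T.comb.last s) := by
  rw [h.2.2.2.1, h.2.2.2.2.2.1]
  ring

/-- The loser is reinserted right after the winner, and their new lengths add up to the old length
of the winner (`len_other_add`). A letter beyond the winner sees the same sum; the winner and the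
letters before it see neither change. -/
theorem left_other (h : IsRauzyVeechStep s T T') {α : A} (hα : α ≠ T.comb.last s.other) :
    T'.left s.other α = T.left s.other α := by
  classical
  have hpos := h.2.1.2
  have hab := h.last_ne
  have hlt := pos_lt_last hα
  have hla : (T.comb.pos s.other (T.comb.last s) : ℕ) <
      T.comb.pos s.other (T.comb.last s.other) := pos_lt_last hab
  have hpb := pos_last T.comb s.other
  rw [Fin.lt_def] at hlt
  have hother : ∀ β, β ≠ T.comb.last s → β ≠ T.comb.last s.other →
      T'.len s.other β = T.len s.other β := fun β h1 h2 => h.2.2.2.2.2.2 β h1 h2 s.other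
  have hposne : ∀ β, β ≠ T.comb.last s.other → (T.comb.pos s.other β : ℕ) + 1 < Fintype.card A := by
    intro β hβ
    have := pos_lt_last hβ
    rw [Fin.lt_def] at this
    omega
  -- The loser is in last place, so the third case of `IsRauzyArrow` gives its new position.
  have hbpos := hpos (T.comb.last s.other)
  rw [if_neg (by omega), if_neg (by omega)] at hbpos
  have hmem : ∀ β, β ≠ T.comb.last s.other →
      (T'.comb.pos s.other β < T'.comb.pos s.other α ↔
        T.comb.pos s.other β < T.comb.pos s.other α) := by
    intro β hβ
    have h1 := hpos α
    have h2 := hpos β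
    have h3 := hposne α hα
    have h4 := hposne β hβ
    rw [Fin.lt_def, Fin.lt_def, h1, h2]
    split_ifs <;> omega
  unfold left
  by_cases hc : (T.comb.pos s.other α : ℕ) ≤ T.comb.pos s.other (T.comb.last s)
  · have hset : (Finset.univ.filter fun β => T'.comb.pos s.other β < T'.comb.pos s.other α) =
        Finset.univ.filter fun β => T.comb.pos s.other β < T.comb.pos s.other α := by
      ext β
      simp only [Finset.mem_filter, Finset.mem_univ, true_and]
      by_cases hβ : β = T.comb.last s.other
      · have h1 := hpos α
        rw [if_pos hc] at h1
        rw [hβ, Fin.lt_def, Fin.lt_def, hbpos, h1]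
        omega
      · exact hmem β hβ
    rw [hset]
    refine Finset.sum_congr rfl fun β hβ => hother β ?_ ?_
    · rintro rfl
      rw [Finset.mem_filter, Fin.lt_def] at hβ
      omega
    · rintro rfl
      rw [Finset.mem_filter, Fin.lt_def] at hβ
      omega
  · have h1 := hpos α
    rw [if_neg hc, if_pos (hposne α hα)] at h1
    have hset : (Finset.univ.filter fun β => T'.comb.pos s.other β < T'.comb.pos s.other α) =
        insert (T.comb.last s.other)
          (Finset.univ.filter fun β => T.comb.pos s.other β < T.comb.pos s.other α) := by
      ext β
      simp only [Finset.mem_filter, Finset.mem_univ, true_and, Finset.mem_insert]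
      by_cases hβ : β = T.comb.last s.other
      · rw [hβ, Fin.lt_def, hbpos, h1]
        simp only [true_or, iff_true]
        omega
      · rw [hmem β hβ]
        simp [hβ]
    have ha : T.comb.last s ∈
        Finset.univ.filter fun β => T.comb.pos s.other β < T.comb.pos s.other α := by
      rw [Finset.mem_filter, Fin.lt_def]
      exact ⟨Finset.mem_univ _, by omega⟩
    rw [hset, Finset.sum_insert, ← Finset.add_sum_erase _ _ ha, ← Finset.add_sum_erase _ _ ha,
      ← h.len_other_add]
    · rw [Finset.sum_congr rfl (g := fun β => T.len s.other β)]
      · ring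
      · intro β hβ
        rw [Finset.mem_erase, Finset.mem_filter, Fin.lt_def] at hβ
        refine hother β hβ.1 ?_
        rintro rfl
        omega
    · rw [Finset.mem_filter, Fin.lt_def]
      omega

theorem left_other_loser (h : IsRauzyVeechStep s T T') :
    T'.left s.other (T.comb.last s.other) =
      T.left s.other (T.comb.last s) + T'.len s.other (T.comb.last s) := by
  have hpos := h.2.1.2
  have hab := h.last_ne
  have hla : (T.comb.pos s.other (T.comb.last s) : ℕ) <
      T.comb.pos s.other (T.comb.last s.other) := pos_lt_last hab
  have hpb := pos_last T.comb s.other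
  have hbpos := hpos (T.comb.last s.other)
  rw [if_neg (by omega), if_neg (by omega)] at hbpos
  have hapos := hpos (T.comb.last s)
  rw [if_pos le_rfl] at hapos
  rw [← h.left_other hab, right_eq_cut, left_eq_cut, hbpos, hapos]

theorem slope_winner (h : IsRauzyVeechStep s T T') :
    T'.slope s (T.comb.last s) = T.slope s (T.comb.last s) := by
  have h0 := (T.len_pos s (T.comb.last s)).ne'
  have h1 := (T'.len_pos s (T.comb.last s)).ne'
  unfold slope
  rw [div_eq_div_iff h1 h0, h.2.2.2.1, h.2.2.1]
  field_simp

theorem slope_ne (h : IsRauzyVeechStep s T T') {α : A} (hα : α ≠ T.comb.last s.other) :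
    T'.slope s α = T.slope s α := by
  by_cases ha : α = T.comb.last s
  · rw [ha, h.slope_winner]
  · unfold slope
    rw [h.2.2.2.2.2.2 α ha hα, h.2.2.2.2.2.2 α ha hα]

theorem slope_loser (h : IsRauzyVeechStep s T T') :
    T'.slope s (T.comb.last s.other) =
      T.slope s (T.comb.last s) * T.slope s (T.comb.last s.other) := by
  unfold slope
  rw [h.2.2.2.2.2.1, h.2.2.2.2.1, mul_div_assoc]

theorem br_loser_total (h : IsRauzyVeechStep s T T') :
    T.br s (T.comb.last s.other) (T.left s (T.comb.last s.other)) = T'.total := by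
  rw [br_left, h.total_eq, ← right_last T s.other]
  ring

/-- On the winner's side the interval of the loser is unchanged. Its image is exactly the removed
end of the domain, which lies in the interval of the winner, so the return uses the loser's branch
and then the winner's. -/
theorem induces_same (h : IsRauzyVeechStep s T T') :
    Induces T T' s (T.comb.last s.other) (T.comb.last s.other) (T.comb.last s) where
  total_lt := by rw [h.total_eq]; linarith [T.len_pos s.other (T.comb.last s.other)]
  br_ne α hα := by
    funext x
    rw [br_def, br_def, h.slope_ne hα, h.left_other hα, h.left_same]
  slope_ne α hα := h.slope_ne hα
  cl_ne α _ := by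
    unfold cl
    rw [h.left_same]
    by_cases ha : α = T.comb.last s
    · apply Icc_subset_Icc_right
      rw [ha, h.2.2.1]
      linarith [T.len_pos s.other (T.comb.last s.other)]
    · rw [h.len_same ha]
  interval_ne α _ := by
    unfold interval
    rw [h.left_same]
    by_cases ha : α = T.comb.last s
    · apply Ioo_subset_Ioo_right
      rw [ha, h.2.2.1]
      linarith [T.len_pos s.other (T.comb.last s.other)]
    · rw [h.len_same ha]
  cl_loser := by
    unfold cl
    rw [h.left_same, h.len_same h.last_ne.symm]
  interval_loser := by
    unfold interval
    rw [h.left_same, h.len_same h.last_ne.symm]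
  br_left_loser := by rw [h.left_same, h.br_loser_total]
  br_right_loser := by
    rw [h.left_same, h.len_same h.last_ne.symm, br_right, right_last]
  left_lt := by
    rw [← right_last T' s, h.last_succ, h.left_same]
    linarith [T'.len_pos s (T.comb.last s)]
  right_eq := right_last T s
  br_loser x := by
    have h1 : T.left s (T.comb.last s) + T.len s (T.comb.last s) =
        T.left s.other (T.comb.last s.other) + T.len s.other (T.comb.last s.other) := by
      rw [right_last, right_last]
    have h2 : T.left s.other (T.comb.last s.other) - T.left s (T.comb.last s) =
        T'.len s (T.comb.last s) := by
      rw [h.2.2.1]; linarith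
    rw [br_def, br_def, br_def, h.slope_loser, h.left_other_loser, h.left_same,
      add_sub_right_comm, h2, mul_add, ← h.slope_winner, slope_mul_len]
    ring
  slope_loser := h.slope_loser
  cover α x hx := by
    by_cases ha : α = T.comb.last s
    · subst ha
      rcases le_total x T'.total with hx' | hx'
      · left
        refine ⟨h.last_ne, ?_⟩
        unfold cl
        rw [← h.last_succ, right_last T' s, h.last_succ, h.left_same]
        exact ⟨hx.1, hx'⟩
      · right; right
        exact ⟨rfl, hx', hx.2.trans_eq (right_last T s)⟩
    · have : T'.cl s α = T.cl s α := by
        unfold cl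
        rw [h.left_same, h.len_same ha]
      by_cases hb : α = T.comb.last s.other
      · right; left
        rw [← hb, this]
        exact ⟨rfl, hx⟩
      · left
        rw [this]
        exact ⟨hb, hx⟩

/-- In the opposite direction the new interval of the loser is the right end of the old interval of
the winner, and the same two branches are inverted in the reverse order. -/
theorem induces_other (h : IsRauzyVeechStep s T T') :
    Induces T T' s.other (T.comb.last s.other) (T.comb.last s) (T.comb.last s.other) where
  total_lt := h.induces_same.total_lt
  br_ne α hα := by
    funext x
    rw [br_def, br_def, slope_other_eq, slope_other_eq, h.slope_ne hα, h.left_other hα,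
      Side.other_other, h.left_same]
  slope_ne α hα := by rw [slope_other_eq, slope_other_eq, h.slope_ne hα]
  cl_ne α hα := by
    unfold cl
    rw [h.left_other hα]
    by_cases ha : α = T.comb.last s
    · apply Icc_subset_Icc_right
      rw [ha, ← h.len_other_add]
      linarith [T'.len_pos s.other (T.comb.last s.other)]
    · rw [h.2.2.2.2.2.2 α ha hα]
  interval_ne α hα := by
    unfold interval
    rw [h.left_other hα]
    by_cases ha : α = T.comb.last s
    · apply Ioo_subset_Ioo_right
      rw [ha, ← h.len_other_add]
      linarith [T'.len_pos s.other (T.comb.last s.other)]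
    · rw [h.2.2.2.2.2.2 α ha hα]
  cl_loser := by
    unfold cl
    rw [h.left_other_loser, add_assoc, h.len_other_add]
    exact Icc_subset_Icc_left (by linarith [T'.len_pos s.other (T.comb.last s)])
  interval_loser := by
    unfold interval
    rw [h.left_other_loser, add_assoc, h.len_other_add]
    exact Ioo_subset_Ioo_left (by linarith [T'.len_pos s.other (T.comb.last s)])
  br_left_loser := by
    rw [h.left_other_loser, br_def, Side.other_other, add_sub_cancel_left, ← right_last T' s,
      h.last_succ, h.left_same, slope_other_eq, ← h.slope_winner, ← slope_mul_len, ← mul_assoc,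
      inv_mul_cancel₀ (T'.slope_pos _ _).ne', one_mul]
  br_right_loser := by
    rw [h.left_other_loser, add_assoc, h.len_other_add, br_right, Side.other_other, right_last]
  left_lt := by rw [h.total_eq, ← right_last T s.other]; linarith
  right_eq := right_last T s.other
  -- This is the inverse of the identity on the side `s`, so `induces_same` suffices.
  br_loser x := by
    have key : ∀ y, T'.br s (T.comb.last s.other) y =
        T.br s (T.comb.last s) (T.br s (T.comb.last s.other) y) := h.induces_same.br_loser
    apply (T'.br_strictMono s (T.comb.last s.other)).injective
    rw [br_br_other, key, br_br_other, br_br_other]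
  slope_loser := by
    rw [slope_other_eq, slope_other_eq, slope_other_eq, h.slope_loser, mul_inv, mul_comm]
  cover α x hx := by
    by_cases hb : α = T.comb.last s.other
    · subst hb
      right; right
      refine ⟨rfl, ?_, hx.2.trans_eq (right_last T s.other)⟩
      refine le_trans ?_ hx.1
      rw [h.total_eq, ← right_last T s.other]
      linarith
    · by_cases ha : α = T.comb.last s
      · subst ha
        rcases le_total x (T'.left s.other (T.comb.last s.other)) with hx' | hx'
        · left
          refine ⟨hb, ?_⟩
          unfold cl
          rw [h.left_other hb, ← h.left_other_loser]
          exact ⟨hx.1, hx'⟩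
        · right; left
          refine ⟨rfl, hx', hx.2.trans_eq ?_⟩
          rw [h.left_other_loser, add_assoc, h.len_other_add]
      · left
        unfold cl
        rw [h.left_other hb, h.2.2.2.2.2.2 α ha hb]
        exact ⟨hb, hx⟩

theorem exists_induces (h : IsRauzyVeechStep s T T') (r : Side) :
    ∃ β β', Induces T T' r (T.comb.last s.other) β β' := by
  rcases r.eq_or_eq_other s with rfl | rfl
  · exact ⟨_, _, h.induces_same⟩
  · exact ⟨_, _, h.induces_other⟩

end IsRauzyVeechStep

end Step

end AffineIEM

/-! ### Linear algebra of the algorithm along a path. -/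

theorem sum_eq_sum_of_pair {A : Type*} [Fintype A] {f g : A → ℝ} {a b : A} (hab : a ≠ b)
    (h : f a + f b = g a + g b) (h' : ∀ α, α ≠ a → α ≠ b → f α = g α) : ∑ α, f α = ∑ α, g α := by
  classical
  have key : ∀ f : A → ℝ, ∑ α, f α = (f a + f b) + ∑ α ∈ (Finset.univ.erase a).erase b, f α := by
    intro f
    rw [← Finset.add_sum_erase _ _ (Finset.mem_univ a),
      ← Finset.add_sum_erase _ _ (Finset.mem_erase.2 ⟨hab.symm, Finset.mem_univ b⟩)]
    ring
  rw [key f, key g, h]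
  congr 1
  refine Finset.sum_congr rfl fun α hα => ?_
  rw [Finset.mem_erase, Finset.mem_erase] at hα
  exact h' α hα.2.1 hα.1

/-- The multiple of the top length of the loser which is subtracted from that of the winner. -/
def winnerCoeff {A : Type*} (s : Side) (a b : A) (v : A → ℝ) : ℝ :=
  match s with
  | .top => Real.exp (v b)
  | .bot => Real.exp (-v a)

/-- The factor by which the top length of the loser is multiplied. -/
def loserCoeff {A : Type*} (s : Side) (a : A) (v : A → ℝ) : ℝ :=
  match s with
  | .top => 1
  | .bot => Real.exp (-v a)

theorem winnerCoeff_pos {A : Type*} (s : Side) (a b : A) (v : A → ℝ) : 0 < winnerCoeff s a b v := by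
  cases s <;> exact Real.exp_pos _

theorem loserCoeff_pos {A : Type*} (s : Side) (a : A) (v : A → ℝ) : 0 < loserCoeff s a v := by
  cases s
  · exact one_pos
  · exact Real.exp_pos _

namespace RauzyPath

section Chain

variable {A : Type*} [Fintype A] [Nontrivial A]

/-- The loser of the `n`-th arrow. -/
def loser (γ : RauzyPath A) (n : ℕ) : A := (γ.comb n).last (γ.type n).other

open Classical in
/-- The logarithms of the slopes after `n` steps. -/
def logSlope (γ : RauzyPath A) (w : A → ℝ) : ℕ → A → ℝ
  | 0 => w
  | n + 1 => Function.update (γ.logSlope w n) (γ.loser n)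
      (γ.logSlope w n (γ.winner n) + γ.logSlope w n (γ.loser n))

open Classical in
/-- The effect of the `n`-th step on the top lengths. -/
def stepMap (γ : RauzyPath A) (w : A → ℝ) (n : ℕ) : (A → ℝ) →ₗ[ℝ] (A → ℝ) :=
  LinearMap.pi fun α =>
    if α = γ.loser n then
      loserCoeff (γ.type n) (γ.winner n) (γ.logSlope w n) • LinearMap.proj (γ.loser n)
    else if α = γ.winner n then
      LinearMap.proj (γ.winner n) -
        winnerCoeff (γ.type n) (γ.winner n) (γ.loser n) (γ.logSlope w n) •
          LinearMap.proj (γ.loser n)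
    else LinearMap.proj α

/-- The top lengths after `n` steps, as a function of the initial ones. -/
def chain (γ : RauzyPath A) (w : A → ℝ) : ℕ → (A → ℝ) →ₗ[ℝ] (A → ℝ)
  | 0 => LinearMap.id
  | n + 1 => γ.stepMap w n ∘ₗ γ.chain w n

variable {γ : RauzyPath A} {w : A → ℝ} {n : ℕ}

theorem logSlope_succ_loser : γ.logSlope w (n + 1) (γ.loser n) =
    γ.logSlope w n (γ.winner n) + γ.logSlope w n (γ.loser n) := by
  simp [logSlope]

theorem logSlope_succ_of_ne {α : A} (h : α ≠ γ.loser n) :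
    γ.logSlope w (n + 1) α = γ.logSlope w n α := by
  simp [logSlope, h]

theorem stepMap_loser (x : A → ℝ) : γ.stepMap w n x (γ.loser n) =
    loserCoeff (γ.type n) (γ.winner n) (γ.logSlope w n) * x (γ.loser n) := by
  simp [stepMap]

theorem stepMap_winner (hne : γ.winner n ≠ γ.loser n) (x : A → ℝ) :
    γ.stepMap w n x (γ.winner n) = x (γ.winner n) -
      winnerCoeff (γ.type n) (γ.winner n) (γ.loser n) (γ.logSlope w n) * x (γ.loser n) := by
  simp [stepMap, hne]

theorem stepMap_of_ne {α : A} (h : α ≠ γ.winner n) (h' : α ≠ γ.loser n) (x : A → ℝ) :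
    γ.stepMap w n x α = x α := by
  simp [stepMap, h, h']

theorem chain_succ (x : A → ℝ) : γ.chain w (n + 1) x = γ.stepMap w n (γ.chain w n x) := rfl

/-- When `x` is read as a vector of top lengths, the sum is the bottom total minus the top total,
and a step removes the same amount from both. -/
theorem balance_stepMap (hne : γ.winner n ≠ γ.loser n) (x : A → ℝ) :
    ∑ α, γ.stepMap w n x α * (Real.exp (γ.logSlope w (n + 1) α) - 1) =
      ∑ α, x α * (Real.exp (γ.logSlope w n α) - 1) := by
  refine sum_eq_sum_of_pair hne ?_ ?_
  · rw [stepMap_winner hne, stepMap_loser, logSlope_succ_of_ne hne, logSlope_succ_loser,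
      Real.exp_add]
    unfold winnerCoeff loserCoeff
    cases γ.type n
    · simp only
      ring
    · simp only
      rw [Real.exp_neg]
      have := (Real.exp_pos (γ.logSlope w n (γ.winner n))).ne'
      field_simp
      ring
  · intro α h h'
    rw [stepMap_of_ne h h', logSlope_succ_of_ne h']

theorem balance_chain (hne : ∀ n, γ.winner n ≠ γ.loser n) (x : A → ℝ) (n : ℕ) :
    ∑ α, γ.chain w n x α * (Real.exp (γ.logSlope w n α) - 1) =
      ∑ α, x α * (Real.exp (w α) - 1) := by
  induction n with
  | zero => rfl
  | succ n ih => rw [chain_succ, balance_stepMap (hne n), ih]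

theorem logSlope_zero (n : ℕ) : γ.logSlope 0 n = 0 := by
  induction n with
  | zero => rfl
  | succ n ih =>
    funext α
    by_cases h : α = γ.loser n
    · rw [h, logSlope_succ_loser, ih]
      simp
    · rw [logSlope_succ_of_ne h, ih]

/-- When all slopes are one, a step subtracts the loser's length from the winner's; on logarithms of
slopes it adds the winner's value to the loser's. The two actions are dual to each other. -/
theorem pairing_chain (hne : ∀ n, γ.winner n ≠ γ.loser n) (x : A → ℝ) (n : ℕ) :
    ∑ α, γ.chain 0 n x α * γ.logSlope w n α = ∑ α, x α * w α := by
  induction n with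
  | zero => rfl
  | succ n ih =>
    rw [← ih, chain_succ]
    refine sum_eq_sum_of_pair (hne n) ?_ ?_
    · rw [stepMap_winner (hne n), stepMap_loser, logSlope_succ_of_ne (hne n), logSlope_succ_loser,
        logSlope_zero]
      unfold winnerCoeff loserCoeff
      cases γ.type n
      · simp only [Pi.zero_apply, Real.exp_zero]
        ring
      · simp only [Pi.zero_apply, Real.exp_zero, neg_zero]
        ring
    · intro α h h'
      rw [stepMap_of_ne h h', logSlope_succ_of_ne h']

/-- The inverse of a step has nonnegative entries: divide the loser by its factor, then give back to
the winner what was subtracted. -/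
theorem exists_stepMap_eq (hne : γ.winner n ≠ γ.loser n) {y : A → ℝ} (hy : ∀ α, 0 ≤ y α) :
    ∃ x, (∀ α, 0 ≤ x α) ∧ γ.stepMap w n x = y := by
  classical
  have he := loserCoeff_pos (γ.type n) (γ.winner n) (γ.logSlope w n)
  have hc := winnerCoeff_pos (γ.type n) (γ.winner n) (γ.loser n) (γ.logSlope w n)
  set e := loserCoeff (γ.type n) (γ.winner n) (γ.logSlope w n)
  set c := winnerCoeff (γ.type n) (γ.winner n) (γ.loser n) (γ.logSlope w n)
  refine ⟨Function.update (Function.update y (γ.winner n)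
    (y (γ.winner n) + c * (y (γ.loser n) / e))) (γ.loser n) (y (γ.loser n) / e), ?_, ?_⟩
  · intro α
    have h1 : 0 ≤ y (γ.loser n) / e := div_nonneg (hy _) he.le
    by_cases hb : α = γ.loser n
    · rw [hb]
      simpa using h1
    · by_cases ha : α = γ.winner n
      · rw [ha]
        simp only [ne_eq, hne, not_false_eq_true, Function.update_of_ne, Function.update_self]
        have := hy (γ.winner n)
        positivity
      · simpa [ha, hb] using hy α
  · funext α
    by_cases hb : α = γ.loser n
    · rw [hb, stepMap_loser]
      simp only [Function.update_self]
      exact mul_div_cancel₀ _ he.ne'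
    · by_cases ha : α = γ.winner n
      · rw [ha, stepMap_winner hne]
        simp only [ne_eq, hne, not_false_eq_true, Function.update_of_ne, Function.update_self]
        ring
      · rw [stepMap_of_ne ha hb]
        simp [ha, hb]

theorem exists_chain_eq (hne : ∀ n, γ.winner n ≠ γ.loser n) (n : ℕ) {y : A → ℝ}
    (hy : ∀ α, 0 ≤ y α) :
    ∃ x, γ.chain w n x = y ∧ ∀ m ≤ n, ∀ α, 0 ≤ γ.chain w m x α := by
  induction n generalizing y with
  | zero =>
    refine ⟨y, rfl, fun m hm => ?_⟩
    rw [Nat.le_zero.1 hm]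
    exact hy
  | succ n ih =>
    obtain ⟨z, hz, rfl⟩ := exists_stepMap_eq (w := w) (hne n) hy
    obtain ⟨x, rfl, hx⟩ := ih hz
    refine ⟨x, rfl, fun m hm => ?_⟩
    rcases Nat.le_succ_iff.1 hm with h | h
    · exact hx m h
    · rw [h]
      exact hy

theorem InfComplete.exists_winner_eq (hγ : γ.InfComplete) (α : A) (N : ℕ) :
    ∃ n, N ≤ n ∧ γ.winner n = α := by
  obtain ⟨k, hk, -, h⟩ := hγ
  obtain ⟨n, hn, -, hα⟩ := h N α
  exact ⟨n, (hk.le_apply).trans hn, hα⟩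

/-- The order on the winner's side does not change, so the winner is still last there, and the next
type decides whether it wins or loses. -/
theorem winner_succ_or (γ : RauzyPath A) (n : ℕ) :
    γ.winner (n + 1) = γ.winner n ∨ γ.loser (n + 1) = γ.winner n := by
  have hlast : (γ.comb (n + 1)).last (γ.type n) = (γ.comb n).last (γ.type n) := by
    unfold CombData.last
    rw [(γ.arrow n).1]
  rcases Side.eq_or_eq_other (γ.type (n + 1)) (γ.type n) with h | h
  · left
    rw [winner, h, hlast, winner]
  · right
    rw [loser, h, Side.other_other, hlast, winner]

/-- A letter that has won keeps winning until it loses, and it cannot win forever because another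
letter wins later. -/
theorem InfComplete.exists_loser_eq (hγ : γ.InfComplete) (α : A) (N : ℕ) :
    ∃ n, N ≤ n ∧ γ.loser n = α := by
  by_contra! hc
  obtain ⟨n, hn, hα⟩ := hγ.exists_winner_eq α N
  have key : ∀ k, γ.winner (n + k) = α := by
    intro k
    induction k with
    | zero => exact hα
    | succ k ih =>
      rcases γ.winner_succ_or (n + k) with h | h
      · rw [← add_assoc, h, ih]
      · exact absurd (h.trans ih) (hc _ (by omega))
  obtain ⟨β, hβ⟩ := exists_ne α
  obtain ⟨m, hm, hm'⟩ := hγ.exists_winner_eq β n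
  obtain ⟨k, rfl⟩ := Nat.exists_eq_add_of_le hm
  exact hβ (hm'.symm.trans (key k))

theorem chain_winner (hne : γ.winner n ≠ γ.loser n) (x : A → ℝ) :
    γ.chain w n x (γ.winner n) = γ.chain w (n + 1) x (γ.winner n) +
      winnerCoeff (γ.type n) (γ.winner n) (γ.loser n) (γ.logSlope w n) *
        γ.chain w n x (γ.loser n) := by
  rw [chain_succ, stepMap_winner hne]
  ring

/-- The set of letters with a positive coordinate can only shrink, so it is eventually constant.
From then on a positive loser forces a positive winner. Starting from a win of a positive letter,
`winner_succ_or` makes all later winners positive, and every letter is among them. -/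
theorem chain_pos_of_nonneg (hγ : γ.InfComplete) (hne : ∀ n, γ.winner n ≠ γ.loser n)
    {x : A → ℝ} (hx : ∀ n α, 0 ≤ γ.chain w n x α) (h0 : x ≠ 0) :
    ∀ n α, 0 < γ.chain w n x α := by
  have hanti : ∀ n α, 0 < γ.chain w (n + 1) x α → 0 < γ.chain w n x α := by
    intro n α h
    by_cases hb : α = γ.loser n
    · rw [hb, chain_succ, stepMap_loser] at h
      rw [hb]
      exact pos_of_mul_pos_right h (loserCoeff_pos _ _ _).le
    · by_cases ha : α = γ.winner n
      · rw [ha] at h ⊢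
        rw [chain_winner (hne n)]
        have := mul_nonneg (winnerCoeff_pos (γ.type n) (γ.winner n) (γ.loser n)
          (γ.logSlope w n)).le (hx n (γ.loser n))
        linarith
      · rwa [chain_succ, stepMap_of_ne ha hb] at h
  have hmono : Monotone fun n => OrderDual.toDual {α | 0 < γ.chain w n x α} :=
    monotone_nat_of_le_succ fun n α hα => hanti n α hα
  obtain ⟨N, hN⟩ := WellFoundedGT.monotone_chain_condition ⟨_, hmono⟩
  replace hN : ∀ m, N ≤ m → ∀ α, 0 < γ.chain w m x α ↔ 0 < γ.chain w N x α := by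
    intro m hm α
    have h : {α | 0 < γ.chain w N x α} = {α | 0 < γ.chain w m x α} := hN m hm
    exact (Set.ext_iff.1 h α).symm
  -- A step has trivial kernel.
  have hne0 : ∀ n, γ.chain w n x ≠ 0 := by
    intro n
    induction n with
    | zero => exact h0
    | succ n ih =>
      intro hc
      apply ih
      have hb : γ.chain w n x (γ.loser n) = 0 := by
        have := congrFun hc (γ.loser n)
        rw [chain_succ, stepMap_loser] at this
        exact (mul_eq_zero.1 this).resolve_left (loserCoeff_pos _ _ _).ne'
      funext α
      by_cases hb' : α = γ.loser n
      · rw [hb', hb]; rfl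
      · by_cases ha : α = γ.winner n
        · rw [ha, chain_winner (hne n), hc, hb]
          simp
        · have := congrFun hc α
          rwa [chain_succ, stepMap_of_ne ha hb'] at this
  have hwin : ∀ n, N ≤ n → 0 < γ.chain w N x (γ.loser n) → 0 < γ.chain w N x (γ.winner n) := by
    intro n hn h
    rw [← hN n hn] at h ⊢
    rw [chain_winner (hne n)]
    have := hx (n + 1) (γ.winner n)
    have := mul_pos (winnerCoeff_pos (γ.type n) (γ.winner n) (γ.loser n) (γ.logSlope w n)) h
    linarith
  obtain ⟨α₀, hα₀⟩ : ∃ α, 0 < γ.chain w N x α := by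
    by_contra! hc
    exact hne0 N (funext fun α => le_antisymm (hc α) (hx N α))
  obtain ⟨n₀, hn₀, hw⟩ := hγ.exists_winner_eq α₀ N
  have hall : ∀ k, 0 < γ.chain w N x (γ.winner (n₀ + k)) := by
    intro k
    induction k with
    | zero => rwa [add_zero, hw]
    | succ k ih =>
      rcases γ.winner_succ_or (n₀ + k) with h | h
      · rwa [← add_assoc, h]
      · rw [← add_assoc]
        apply hwin _ (by omega)
        rwa [h]
  have hposN : ∀ α, 0 < γ.chain w N x α := by
    intro α
    obtain ⟨m, hm, hm'⟩ := hγ.exists_winner_eq α n₀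
    obtain ⟨k, rfl⟩ := Nat.exists_eq_add_of_le hm
    rw [← hm']
    exact hall k
  intro n α
  rcases le_total n N with h | h
  · exact hmono h (hposN α)
  · exact (hN n h α).2 (hposN α)

end Chain

end RauzyPath

/-! ### Linear description of the set of lengths, and its nonemptiness. -/

section Levels

variable {A : Type*} [Fintype A]

open AffineIEM RauzyPath

theorem slope_top_eq_exp_iff {T : AffineIEM A} {α : A} {c : ℝ} :
    T.slope .top α = Real.exp c ↔ T.len .bot α = Real.exp c * T.len .top α :=
  div_eq_iff (T.len_pos _ _).ne'

/-- Since `v α` and `exp (v α) - 1` have the same sign, their quotient is a positive factor by which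
`x α` can be rescaled; if `v α = 0`, any positive value will do. -/
theorem exists_balanced {v x : A → ℝ} (hx : ∀ α, 0 < x α) (h : ∑ α, x α * v α = 0) :
    ∃ y : A → ℝ, (∀ α, 0 < y α) ∧ ∑ α, y α * (Real.exp (v α) - 1) = 0 := by
  have key : ∀ α, ∃ y, 0 < y ∧ y * (Real.exp (v α) - 1) = x α * v α := by
    intro α
    rcases lt_trichotomy (v α) 0 with hv | hv | hv
    · have h1 : Real.exp (v α) - 1 < 0 := by
        linarith [Real.exp_lt_one_iff.2 hv]
      exact ⟨x α * v α / (Real.exp (v α) - 1),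
        div_pos_of_neg_of_neg (mul_neg_of_pos_of_neg (hx α) hv) h1, div_mul_cancel₀ _ h1.ne⟩
    · exact ⟨1, one_pos, by simp [hv]⟩
    · have h1 : 0 < Real.exp (v α) - 1 := by
        linarith [Real.one_lt_exp_iff.2 hv]
      exact ⟨x α * v α / (Real.exp (v α) - 1),
        div_pos (mul_pos (hx α) hv) h1, div_mul_cancel₀ _ h1.ne'⟩
  choose y hy hy' using key
  exact ⟨y, hy, by rw [← h]; exact Finset.sum_congr rfl fun α _ => hy' α⟩

variable [Nontrivial A] {γ : RauzyPath A} {w : A → ℝ}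

/-- `S n` is obtained from `T ∈ Aff(γ, w)` by the first `n` steps of the Rauzy–Veech algorithm. -/
structure IsLevels (γ : RauzyPath A) (w : A → ℝ) (T : AffineIEM A) (S : ℕ → AffineIEM A) :
    Prop where
  zero : S 0 = T
  comb : ∀ n, (S n).comb = γ.comb n
  step : ∀ n, IsRauzyVeechStep (γ.type n) (S n) (S (n + 1))
  len_top : ∀ n, (S n).len .top = γ.chain w n (T.len .top)
  slope : ∀ n α, (S n).slope .top α = Real.exp (γ.logSlope w n α)

/-- Knowing the slopes eliminates the bottom lengths from a step, which then becomes the linear map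
`stepMap` on the top lengths. -/
theorem IsRauzyVeechStep.slope_len_top {T T' : AffineIEM A} {n : ℕ} (hT : T.comb = γ.comb n)
    (h : IsRauzyVeechStep (γ.type n) T T')
    (hs : ∀ α, T.slope .top α = Real.exp (γ.logSlope w n α)) :
    (∀ α, T'.slope .top α = Real.exp (γ.logSlope w (n + 1) α)) ∧
      T'.len .top = γ.stepMap w n (T.len .top) := by
  have hw : T.comb.last (γ.type n) = γ.winner n := by rw [hT]; rfl
  have hl : T.comb.last (γ.type n).other = γ.loser n := by rw [hT]; rfl
  have hne := h.last_ne
  rw [hw, hl] at hne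
  have h1 := h.slope_loser
  have h2 := fun α => h.slope_ne (α := α)
  obtain ⟨-, -, h3, h4, h5, h6, h7⟩ := h
  rw [hw, hl] at *
  have hbot : ∀ α, T.len .bot α = Real.exp (γ.logSlope w n α) * T.len .top α := fun α =>
    slope_top_eq_exp_iff.1 (hs α)
  constructor
  · intro α
    by_cases hα : α = γ.loser n
    · rw [hα, logSlope_succ_loser, Real.exp_add, ← hs, ← hs]
      cases ht : γ.type n
      · rw [ht] at h1
        exact h1
      · rw [ht] at h1
        rw [← Side.other_bot, slope_other_eq, slope_other_eq,
          slope_other_eq, h1, mul_inv]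
    · rw [logSlope_succ_of_ne hα, ← hs]
      cases ht : γ.type n
      · rw [ht] at h2
        exact h2 α hα
      · rw [ht] at h2
        rw [← Side.other_bot, slope_other_eq, slope_other_eq,
          h2 α hα]
  · funext α
    have ha := (T.len_pos .top (γ.winner n)).ne'
    have hexp := (Real.exp_pos (γ.logSlope w n (γ.winner n))).ne'
    by_cases hα : α = γ.loser n
    · rw [hα, stepMap_loser]
      cases ht : γ.type n
      · rw [ht] at h5
        simp [loserCoeff, h5]
      · rw [ht] at h6
        simp only [Side.other_bot] at h6
        rw [h6, hbot, loserCoeff, Real.exp_neg]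
        field_simp
    · by_cases hα' : α = γ.winner n
      · rw [hα', stepMap_winner hne]
        cases ht : γ.type n
        · rw [ht] at h3
          simp only [Side.other_top] at h3
          rw [h3, winnerCoeff, hbot]
        · rw [ht] at h4
          simp only [Side.other_bot] at h4
          rw [h4, hbot, winnerCoeff, Real.exp_neg]
          field_simp
      · rw [stepMap_of_ne hα' hα, h7 α hα' hα]

theorem exists_isLevels {T : AffineIEM A} (hT : T ∈ Aff γ w) : ∃ S, IsLevels γ w T S := by
  obtain ⟨⟨S, h0, hS⟩, hw⟩ := hT
  have key : ∀ n, (S n).len .top = γ.chain w n (T.len .top) ∧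
      ∀ α, (S n).slope .top α = Real.exp (γ.logSlope w n α) := by
    intro n
    induction n with
    | zero =>
      rw [h0]
      exact ⟨rfl, fun α => slope_top_eq_exp_iff.2 (hw α)⟩
    | succ n ih =>
      have := IsRauzyVeechStep.slope_len_top (hS n).1 (hS n).2 ih.2
      rw [chain_succ, ← ih.1]
      exact ⟨this.2, this.1⟩
  exact ⟨S, h0, fun n => (hS n).1, fun n => (hS n).2, fun n => (key n).1, fun n => (key n).2⟩

theorem IsLevels.last_winner {T : AffineIEM A} {S : ℕ → AffineIEM A} (h : IsLevels γ w T S)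
    (n : ℕ) : (S n).comb.last (γ.type n) = γ.winner n := by
  rw [h.comb]; rfl

theorem IsLevels.last_loser {T : AffineIEM A} {S : ℕ → AffineIEM A} (h : IsLevels γ w T S)
    (n : ℕ) : (S n).comb.last (γ.type n).other = γ.loser n := by
  rw [h.comb]; rfl

theorem IsLevels.winner_ne {T : AffineIEM A} {S : ℕ → AffineIEM A} (h : IsLevels γ w T S)
    (n : ℕ) : γ.winner n ≠ γ.loser n := by
  rw [← h.last_winner, ← h.last_loser]
  exact (h.step n).last_ne

theorem IsLevels.exists_induces {T : AffineIEM A} {S : ℕ → AffineIEM A} (h : IsLevels γ w T S)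
    (n : ℕ) (r : Side) : ∃ β β', Induces (S n) (S (n + 1)) r (γ.loser n) β β' := by
  rw [← h.last_loser]
  exact (h.step n).exists_induces r

theorem IsLevels.chain_pos {T : AffineIEM A} {S : ℕ → AffineIEM A} (h : IsLevels γ w T S)
    (n : ℕ) (α : A) : 0 < γ.chain w n (T.len .top) α := by
  rw [← h.len_top]
  exact (S n).len_pos _ _

/-- The affine i.e.m. with given combinatorial data, top lengths, and logarithms of slopes. -/
def ofLengths (π : CombData A) (v x : A → ℝ) (hx : ∀ α, 0 < x α)
    (hb : ∑ α, x α * (Real.exp (v α) - 1) = 0) : AffineIEM A where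
  comb := π
  len s α := match s with
    | .top => x α
    | .bot => Real.exp (v α) * x α
  len_pos s α := by
    cases s
    · exact hx α
    · exact mul_pos (Real.exp_pos _) (hx α)
  sum_len := by
    rw [← sub_eq_zero, ← Finset.sum_sub_distrib, ← neg_eq_zero, ← hb, ← Finset.sum_neg_distrib]
    exact Finset.sum_congr rfl fun α _ => by ring

theorem isRauzyVeechStep_ofLengths (hne : ∀ n, γ.winner n ≠ γ.loser n) {n : ℕ} {x : A → ℝ}
    (hx : ∀ α, 0 < x α) (hb : ∑ α, x α * (Real.exp (γ.logSlope w n α) - 1) = 0)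
    (hx' : ∀ α, 0 < γ.stepMap w n x α)
    (hb' : ∑ α, γ.stepMap w n x α * (Real.exp (γ.logSlope w (n + 1) α) - 1) = 0) :
    IsRauzyVeechStep (γ.type n) (ofLengths (γ.comb n) (γ.logSlope w n) x hx hb)
      (ofLengths (γ.comb (n + 1)) (γ.logSlope w (n + 1)) _ hx' hb') := by
  have hwin := stepMap_winner (w := w) (hne n) x
  have hlos := stepMap_loser (γ := γ) (w := w) (n := n) x
  have hpos := hx' (γ.winner n)
  rw [hwin] at hpos
  have hexp := (Real.exp_pos (γ.logSlope w n (γ.winner n))).ne'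
  have hxa := (hx (γ.winner n)).ne'
  have hsl := logSlope_succ_loser (γ := γ) (w := w) (n := n)
  have hsw := logSlope_succ_of_ne (γ := γ) (w := w) (n := n) (hne n)
  have ho : ∀ α, α ≠ γ.winner n → α ≠ γ.loser n → ∀ r,
      (ofLengths (γ.comb (n + 1)) (γ.logSlope w (n + 1)) _ hx' hb').len r α =
        (ofLengths (γ.comb n) (γ.logSlope w n) x hx hb).len r α := by
    intro α h h' r
    cases r
    · exact stepMap_of_ne h h' x
    · simp only [ofLengths, stepMap_of_ne h h' x, logSlope_succ_of_ne h']
  have hc : γ.comb n = (ofLengths (γ.comb n) (γ.logSlope w n) x hx hb).comb := rfl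
  unfold RauzyPath.winner RauzyPath.loser at *
  unfold IsRauzyVeechStep
  cases ht : γ.type n
  · rw [ht] at hwin hlos hpos hexp hxa hsl hsw ho
    simp only [winnerCoeff, loserCoeff, Side.other_top] at *
    refine ⟨?_, ht ▸ γ.arrow n, ?_, ?_, ?_, ?_, ho⟩
    · simp only [ofLengths]
      linarith
    · exact hwin
    · simp only [ofLengths]
      rw [hwin, hsw]
      field_simp
    · simp only [ofLengths]
      rw [hlos, one_mul]
    · simp only [ofLengths]
      rw [hlos, hsl, Real.exp_add]
      field_simp
  · rw [ht] at hwin hlos hpos hexp hxa hsl hsw ho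
    simp only [winnerCoeff, loserCoeff, Side.other_bot, Real.exp_neg] at *
    refine ⟨?_, ht ▸ γ.arrow n, ?_, ?_, ?_, ?_, ho⟩
    · simp only [ofLengths]
      rw [sub_pos, inv_mul_lt_iff₀ (Real.exp_pos _)] at hpos
      exact hpos
    · simp only [ofLengths]
      rw [hwin, hsw]
      field_simp
    · simp only [ofLengths]
      rw [hwin]
      field_simp
    · simp only [ofLengths]
      rw [hlos, hsl, Real.exp_add]
      field_simp
    · simp only [ofLengths]
      rw [hlos]
      field_simp

theorem ofLengths_mem_Aff (hne : ∀ n, γ.winner n ≠ γ.loser n) {x : A → ℝ}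
    (hx : ∀ n α, 0 < γ.chain w n x α) (hb : ∑ α, x α * (Real.exp (w α) - 1) = 0) :
    ofLengths (γ.comb 0) w x (hx 0) hb ∈ Aff γ w := by
  refine ⟨⟨fun n => ofLengths (γ.comb n) (γ.logSlope w n) (γ.chain w n x) (hx n)
    ((balance_chain hne x n).trans hb), rfl, fun n => ⟨rfl, ?_⟩⟩, fun α => rfl⟩
  exact isRauzyVeechStep_ofLengths hne _ _ _ _

theorem balance_of_mem_Aff {T : AffineIEM A} (hT : T ∈ Aff γ w) :
    ∑ α, T.len .top α * (Real.exp (w α) - 1) = 0 := by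
  have h : ∑ α, T.len .top α * (Real.exp (w α) - 1) = ∑ α, (T.len .bot α - T.len .top α) :=
    Finset.sum_congr rfl fun α _ => by rw [hT.2 α]; ring
  rw [h, Finset.sum_sub_distrib, T.sum_len, sub_self]

theorem comb_of_mem_Aff {T : AffineIEM A} (hT : T ∈ Aff γ w) : T.comb = γ.comb 0 := by
  obtain ⟨S, hS⟩ := exists_isLevels hT
  rw [← hS.comb 0, hS.zero]

theorem eq_of_len_top_eq {T T' : AffineIEM A} (hT : T ∈ Aff γ w) (hT' : T' ∈ Aff γ w)
    (h : T.len .top = T'.len .top) : T = T' := by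
  ext1
  · rw [comb_of_mem_Aff hT, comb_of_mem_Aff hT']
  · funext s α
    cases s
    · rw [h]
    · rw [hT.2, hT'.2, h]

/-- Positivity at all levels is all that is needed to follow the path: `balance_chain` keeps the two
totals equal, so each vector of the chain is again the length vector of a map. -/
theorem mem_AffOneLengths_iff (hne : ∀ n, γ.winner n ≠ γ.loser n) {x : A → ℝ} :
    x ∈ AffOneLengths γ w ↔ (∀ n α, 0 < γ.chain w n x α) ∧
      ∑ α, x α * (Real.exp (w α) - 1) = 0 ∧ ∑ α, x α = 1 := by
  constructor
  · rintro ⟨T, ⟨hT, h1⟩, rfl⟩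
    obtain ⟨S, hS⟩ := exists_isLevels hT
    exact ⟨hS.chain_pos, balance_of_mem_Aff hT, h1⟩
  · rintro ⟨h1, h2, h3⟩
    exact ⟨ofLengths (γ.comb 0) w x (h1 0) h2, ⟨ofLengths_mem_Aff hne h1 h2, h3⟩, rfl⟩

theorem convex_AffOneLengths (hne : ∀ n, γ.winner n ≠ γ.loser n) :
    Convex ℝ (AffOneLengths γ w) := by
  intro x hx y hy s t hs ht hst
  rw [mem_AffOneLengths_iff hne] at hx hy ⊢
  refine ⟨fun n α => ?_, ?_, ?_⟩
  · rw [map_add, map_smul, map_smul]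
    simp only [Pi.add_apply, Pi.smul_apply, smul_eq_mul]
    rcases hs.eq_or_lt with h | h
    · rw [← h] at hst ⊢
      rw [show t = 1 by linarith]
      simpa using hy.1 n α
    · have := mul_pos h (hx.1 n α)
      have := mul_nonneg ht (hy.1 n α).le
      linarith
  · have : ∀ α, (s • x + t • y) α * (Real.exp (w α) - 1) =
        s * (x α * (Real.exp (w α) - 1)) + t * (y α * (Real.exp (w α) - 1)) := fun α => by
      simp only [Pi.add_apply, Pi.smul_apply, smul_eq_mul]; ring
    simp_rw [this]
    rw [Finset.sum_add_distrib, ← Finset.mul_sum, ← Finset.mul_sum, hx.2.1, hy.2.1]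
    simp
  · simp only [Pi.add_apply, Pi.smul_apply, smul_eq_mul]
    rw [Finset.sum_add_distrib, ← Finset.mul_sum, ← Finset.mul_sum, hx.2.2, hy.2.2]
    simpa using hst

theorem AffOneLengths_nonempty (hγ : γ.InfComplete)
    (hstar : ∃ Tstar ∈ AffOne γ 0, ∑ α, Tstar.len .top α * w α = 0) :
    (AffOneLengths γ w).Nonempty := by
  obtain ⟨Ts, ⟨hTs, -⟩, h0⟩ := hstar
  obtain ⟨Ss, hSs⟩ := exists_isLevels hTs
  -- A step is possible only if the two last letters differ, so the existence of `Tstar` gives this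
  -- for every arrow.
  have hne := hSs.winner_ne
  have step : ∀ n, ∃ x : A → ℝ, x ∈ stdSimplex ℝ A ∧ (∀ m ≤ n, ∀ α, 0 ≤ γ.chain w m x α) ∧
      ∑ α, x α * (Real.exp (w α) - 1) = 0 := by
    intro n
    obtain ⟨y, hy, hyb⟩ := exists_balanced (hSs.chain_pos n) ((pairing_chain hne _ n).trans h0)
    obtain ⟨x, hxy, hx⟩ := exists_chain_eq (w := w) hne n fun α => (hy α).le
    have hxb : ∑ α, x α * (Real.exp (w α) - 1) = 0 := by
      rw [← balance_chain hne x n, hxy, hyb]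
    have hx0 : ∀ α, 0 ≤ x α := hx 0 (Nat.zero_le n)
    have hs : 0 < ∑ α, x α := by
      refine (Finset.sum_nonneg fun α _ => hx0 α).lt_of_ne ?_
      intro hc
      have hz : x = 0 := funext fun α =>
        (Finset.sum_eq_zero_iff_of_nonneg fun α _ => hx0 α).1 hc.symm α (Finset.mem_univ α)
      obtain ⟨α⟩ : Nonempty A := inferInstance
      have := hy α
      rw [← hxy, hz, map_zero] at this
      exact lt_irrefl _ this
    refine ⟨(∑ α, x α)⁻¹ • x, ⟨fun α => ?_, ?_⟩, fun m hm α => ?_, ?_⟩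
    · exact mul_nonneg (inv_nonneg.2 hs.le) (hx0 α)
    · simp only [Pi.smul_apply, smul_eq_mul, ← Finset.mul_sum]
      exact inv_mul_cancel₀ hs.ne'
    · rw [map_smul]
      exact mul_nonneg (inv_nonneg.2 hs.le) (hx m hm α)
    · simp only [Pi.smul_apply, smul_eq_mul, mul_assoc, ← Finset.mul_sum, hxb, mul_zero]
  choose x hx1 hx2 hx3 using step
  -- The condition at level `n` holds for all approximants of index at least `n`, so it survives in
  -- the limit as a weak inequality. Strictness is recovered at the end from `chain_pos_of_nonneg`,
  -- as a point of the simplex is not zero.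
  obtain ⟨y, hy, hlim⟩ := (isCompact_stdSimplex ℝ A).ultrafilter_le_nhds'
    ((Filter.hyperfilter ℕ).map x) (Filter.mem_map.2 (Filter.Eventually.of_forall hx1))
  have ht : Filter.Tendsto x (Filter.hyperfilter ℕ : Filter ℕ) (nhds y) := hlim
  have hchain : ∀ n α, 0 ≤ γ.chain w n y α := by
    intro n α
    have hc : Continuous fun z => γ.chain w n z α :=
      (continuous_apply α).comp (LinearMap.continuous_of_finiteDimensional _)
    refine ge_of_tendsto ((hc.tendsto y).comp ht) ?_
    have hev : ∀ᶠ m in (Filter.hyperfilter ℕ : Filter ℕ), n ≤ m :=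
      Nat.hyperfilter_le_atTop (Filter.eventually_ge_atTop n)
    filter_upwards [hev] with m hm using hx2 m n hm α
  have hbal : ∑ α, y α * (Real.exp (w α) - 1) = 0 := by
    have hc : Continuous fun z : A → ℝ => ∑ α, z α * (Real.exp (w α) - 1) := by fun_prop
    refine tendsto_nhds_unique ((hc.tendsto y).comp ht) ?_
    refine Filter.Tendsto.congr (f₁ := fun _ => (0 : ℝ)) (fun n => ?_) tendsto_const_nhds
    exact (hx3 n).symm
  refine ⟨y, (mem_AffOneLengths_iff hne).2 ⟨chain_pos_of_nonneg hγ hne hchain ?_, hbal, hy.2⟩⟩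
  rintro rfl
  simpa using hy.2

end Levels

namespace AffineIEM

/-! ### Functions whose increments are multiplied by the slopes. -/

section SlopeFun

variable {A : Type*} [Fintype A]

/-- The increments of `g` are multiplied by the slopes of `T` under the branches of `T`. -/
def IsSlopeFun (T : AffineIEM A) (g : ℝ → ℝ) : Prop :=
  ∀ α, ∀ x ∈ T.cl .top α, ∀ y ∈ T.cl .top α,
    g (T.br .top α y) - g (T.br .top α x) = T.slope .top α * (g y - g x)

/-- The increment of `g` on an interval of `T`. -/
def mass (T : AffineIEM A) (g : ℝ → ℝ) (s : Side) (α : A) : ℝ :=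
  g (T.left s α + T.len s α) - g (T.left s α)

theorem IsSlopeFun.mass_bot {T : AffineIEM A} {g : ℝ → ℝ} (h : T.IsSlopeFun g) (α : A) :
    T.mass g .bot α = T.slope .top α * T.mass g .top α := by
  have := h α _ (T.left_mem_cl _ _) _ (T.right_mem_cl _ _)
  rwa [br_left, br_right] at this

/-- Each branch of the induced map is an old branch or a composition of two, and slopes multiply
under composition. -/
theorem IsSlopeFun.of_induces {T T' : AffineIEM A} {b β β' : A} {g : ℝ → ℝ}
    (h : Induces T T' .top b β β') (hg : T.IsSlopeFun g) : T'.IsSlopeFun g := by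
  intro α x hx y hy
  by_cases hα : α = b
  · subst hα
    rw [h.br_loser, h.br_loser, h.slope_loser,
      hg β' _ (h.Icc_subset (h.br_mem_Icc hx)) _ (h.Icc_subset (h.br_mem_Icc hy)),
      hg β _ (h.cl_loser hx) _ (h.cl_loser hy), mul_assoc]
  · rw [h.br_ne α hα, h.slope_ne α hα]
    exact hg α _ (h.cl_ne α hα hx) _ (h.cl_ne α hα hy)

theorem sum_mass (T : AffineIEM A) (g : ℝ → ℝ) (s : Side) :
    ∑ α, T.mass g s α = g T.total - g 0 := T.sum_increments s g

end SlopeFun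

/-! ### Counting the iterates defined at a point. -/

section Iterable

variable {A : Type*} [Fintype A]

/-- The point `y` can be iterated `k` times by `T` (for `r = top`) or by `T⁻¹` (for `r = bot`). -/
def Iterable (T : AffineIEM A) (r : Side) : ℕ → ℝ → Prop
  | 0, _ => True
  | k + 1, y => ∃ α, y ∈ T.interval r α ∧ T.Iterable r k (T.br r α y)

theorem Iterable.of_succ {T : AffineIEM A} {r : Side} {k : ℕ} {y : ℝ}
    (h : T.Iterable r (k + 1) y) : T.Iterable r k y := by
  induction k generalizing y with
  | zero => trivial
  | succ k ih =>
    obtain ⟨α, hα, h⟩ := h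
    exact ⟨α, hα, ih h⟩

theorem Induces.iterable {T T' : AffineIEM A} {r : Side} {b β β' : A}
    (h : Induces T T' r b β β') {k : ℕ} {y : ℝ} (hy : T'.Iterable r k y) : T.Iterable r k y := by
  induction k generalizing y with
  | zero => trivial
  | succ k ih =>
    obtain ⟨α, hα, hy⟩ := hy
    by_cases hb : α = b
    · subst hb
      rw [h.br_loser] at hy
      exact ⟨β, h.interval_loser hα, Iterable.of_succ
        ⟨β', h.Ioo_subset (h.br_mem_Ioo hα), ih hy⟩⟩
    · rw [h.br_ne α hb] at hy
      exact ⟨α, h.interval_ne α hb hα, ih hy⟩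

/-- On the interval of the loser, one iterate of the induced map is two iterates of the original
one; this gains an iterate. -/
theorem Induces.iterable_succ {T T' : AffineIEM A} {r : Side} {b β β' : A}
    (h : Induces T T' r b β β') {k : ℕ} {y : ℝ} (hyb : y ∈ T'.interval r b)
    (hy : T'.Iterable r (k + 1) y) : T.Iterable r (k + 2) y := by
  obtain ⟨α, hα, hy⟩ := hy
  obtain rfl := T'.eq_of_mem_interval hα hyb
  rw [h.br_loser] at hy
  exact ⟨β, h.interval_loser hα, β', h.Ioo_subset (h.br_mem_Ioo hα), h.iterable hy⟩

theorem Iterable.of_maps {T : AffineIEM A} {k : ℕ} {y z : ℝ} (h : T.Iterable .top (k + 1) z)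
    (hzy : T.Maps z y) : T.Iterable .top k y := by
  obtain ⟨α, hα, rfl⟩ := hzy
  obtain ⟨β, hβ, h⟩ := h
  obtain rfl := T.eq_of_mem_interval hα hβ
  exact h

theorem Iterable.of_maps_bot {T : AffineIEM A} {k : ℕ} {y z : ℝ} (h : T.Iterable .bot (k + 1) y)
    (hzy : T.Maps z y) : T.Iterable .bot k z := by
  obtain ⟨α, hα, rfl⟩ := hzy
  obtain ⟨β, hβ, h⟩ := h
  rw [branch_eq_br] at hβ h
  obtain rfl := T.eq_of_mem_interval (T.br_top_mem hα) hβ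
  have := T.br_other_br .top α z
  rw [Side.other_top] at this
  rwa [this] at h

end Iterable

end AffineIEM

/-! ### Slope functions and endpoints along the algorithm. -/

section Levels

variable {A : Type*} [Fintype A] [Nontrivial A] {γ : RauzyPath A} {w : A → ℝ}
  {T : AffineIEM A} {S : ℕ → AffineIEM A}

open AffineIEM RauzyPath

namespace IsLevels

theorem isSlopeFun (h : IsLevels γ w T S) {g : ℝ → ℝ} (hg : T.IsSlopeFun g) (n : ℕ) :
    (S n).IsSlopeFun g := by
  induction n with
  | zero => rwa [h.zero]
  | succ n ih =>
    obtain ⟨β, β', hi⟩ := h.exists_induces n .top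
    exact ih.of_induces hi

/-- The cuts made by a step are related by branches, under which `g` behaves as length does. The
rule for lengths is the case where `g` is the identity. -/
theorem mass_succ (h : IsLevels γ w T S) {g : ℝ → ℝ} (hg : T.IsSlopeFun g) (n : ℕ) :
    (S (n + 1)).mass g .top = γ.stepMap w n ((S n).mass g .top) := by
  have hst := h.step n
  have hw := h.last_winner n
  have hl := h.last_loser n
  have hne := h.winner_ne n
  have hgn := h.isSlopeFun hg n
  have hslope := h.slope n
  have hs := hst.induces_same
  have ho := hst.induces_other
  have hlen := hst.len_other_add
  have hleft := fun α => hst.left_other (α := α)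
  have hlb := hst.left_other_loser
  have hls := hst.left_same
  have hlens := fun α => hst.len_same (α := α)
  have hother := hst.2.2.2.2.2.2
  have htot := hst.total_eq
  have hlast' := hst.last_succ
  rw [hw, hl] at hs ho hother hlen hlb
  rw [hw] at hlens hlast'
  rw [hl] at hleft htot
  have hcutmass : (S n).mass g .bot (γ.loser n) = (S n).slope .top (γ.loser n) *
    (S n).mass g .top (γ.loser n) := hgn.mass_bot _
  funext α
  cases ht : γ.type n
  · rw [ht] at hw hl hlens hls hs hlast' htot
    simp only [Side.other_top] at hl htot
    have hrl := right_last (S n) .bot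
    have hrw := right_last (S n) .top
    have hrw' := right_last (S (n + 1)) .top
    rw [hl] at hrl
    rw [hw] at hrw
    rw [hlast'] at hrw'
    by_cases hα : α = γ.loser n
    · rw [hα, stepMap_loser, ht, loserCoeff, one_mul]
      unfold mass
      rw [hls, hlens _ hne.symm]
    · by_cases hα' : α = γ.winner n
      · rw [hα', stepMap_winner hne, ht, winnerCoeff, ← hslope, ← hcutmass]
        unfold mass
        rw [hrw', hrw, hrl, hls]
        have : (S (n + 1)).total = (S n).left .bot (γ.loser n) := by rw [htot, ← hrl]; ring
        rw [this]
        ring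
      · rw [stepMap_of_ne hα' hα]
        unfold mass
        rw [hls, hlens _ hα']
  · rw [ht] at hw hl hlen hlb ho hlast' htot
    rw [ht] at hleft
    simp only [Side.other_bot] at hl hlen hlb hleft ho htot
    have hrl := right_last (S n) .top
    rw [hl] at hrl
    have htot' : (S (n + 1)).total = (S n).left .top (γ.loser n) := by rw [htot, ← hrl]; ring
    -- For the bottom type the winner's branch carries the new top interval of the loser onto the
    -- old one.
    have hloser : (S n).slope .top (γ.winner n) * (S (n + 1)).mass g .top (γ.loser n) =
        (S n).mass g .top (γ.loser n) := by
      have := hgn (γ.winner n) _ (ho.cl_loser (left_mem_cl _ _ _)) _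
        (ho.cl_loser (right_mem_cl _ _ _))
      rw [ho.br_left_loser, ho.br_right_loser] at this
      unfold mass
      rw [← this, hrl, htot']
    have hexp : Real.exp (-γ.logSlope w n (γ.winner n)) * (S n).slope .top (γ.winner n) = 1 := by
      rw [hslope, ← Real.exp_add, neg_add_cancel, Real.exp_zero]
    by_cases hα : α = γ.loser n
    · rw [hα, stepMap_loser, ht, loserCoeff, ← hloser, ← mul_assoc, hexp, one_mul]
    · by_cases hα' : α = γ.winner n
      · rw [hα', stepMap_winner hne, ht, winnerCoeff, ← hloser, ← mul_assoc, hexp, one_mul]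
        unfold mass
        rw [hlb, add_assoc, hlen, hleft _ hne]
        ring
      · rw [stepMap_of_ne hα' hα]
        unfold mass
        rw [hleft _ hα, hother α hα' hα .top]

theorem mass_eq_chain (h : IsLevels γ w T S) {g : ℝ → ℝ} (hg : T.IsSlopeFun g) (n : ℕ) :
    (S n).mass g .top = γ.chain w n (T.mass g .top) := by
  induction n with
  | zero => rw [h.zero]; rfl
  | succ n ih => rw [h.mass_succ hg, ih]; rfl

theorem total_strictAnti (h : IsLevels γ w T S) : StrictAnti fun n => (S n).total :=
  strictAnti_nat_of_succ_lt fun n => (h.step n).induces_same.total_lt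

theorem mass_pos (h : IsLevels γ w T S) (hγ : γ.InfComplete) {g : ℝ → ℝ} (hg : T.IsSlopeFun g)
    (hmono : MonotoneOn g (Icc 0 T.total)) (h01 : g 0 < g T.total) (n : ℕ) (α : A) :
    0 < (S n).mass g .top α := by
  rw [h.mass_eq_chain hg]
  refine chain_pos_of_nonneg hγ h.winner_ne (fun n α => ?_) ?_ n α
  · rw [← h.mass_eq_chain hg]
    have hsub : (S n).cl .top α ⊆ Icc 0 T.total := by
      refine ((S n).cl_subset _ _).trans (Icc_subset_Icc_right ?_)
      rw [← h.zero]
      exact h.total_strictAnti.antitone (Nat.zero_le n)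
    exact sub_nonneg.2 (hmono (hsub (left_mem_cl _ _ _)) (hsub (right_mem_cl _ _ _))
      (left_mem_cl _ _ _).2)
  · intro hc
    have := T.sum_mass g .top
    rw [hc] at this
    simp only [Pi.zero_apply, Finset.sum_const_zero] at this
    linarith

/-- The only left endpoint that a step can displace is the point at which the domain is cut. -/
theorem left_succ (h : IsLevels γ w T S) (n : ℕ) (r : Side) (α : A) :
    (S (n + 1)).left r α = (S n).left r α ∨
      (r = (γ.type n).other ∧ α = γ.loser n ∧ (S n).left r α = (S (n + 1)).total) := by
  have hst := h.step n
  rcases r.eq_or_eq_other (γ.type n) with hr | hr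
  · left
    rw [hr]
    exact hst.left_same α
  · by_cases hα : α = γ.loser n
    · right
      refine ⟨hr, hα, ?_⟩
      rw [hst.total_eq, ← right_last (S n) r, hr, hα, h.last_loser]
      ring
    · left
      rw [hr]
      exact hst.left_other (by rwa [h.last_loser])

/-- A left endpoint in `(0, u]` would persist forever, since the domain is never cut there. The
letters on its left stay there, and whenever one of them wins, the loser is inserted after it and
joins them. The first letter always wins again, so there would be too many letters. -/
theorem lt_left (h : IsLevels γ w T S) (hγ : γ.InfComplete) {u : ℝ} (hu : ∀ n, u < (S n).total)
    (n : ℕ) (r : Side) (α : A) (hα : 0 < (S n).left r α) : u < (S n).left r α := by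
  classical
  by_contra! hc
  set z := (S n).left r α with hz
  replace hu : ∀ n, z < (S n).total := fun n => hc.trans_lt (hu n)
  have hpersist : ∀ m, n ≤ m → ∃ α, (S m).left r α = z := by
    intro m hm
    induction m, hm using Nat.le_induction with
    | base => exact ⟨α, rfl⟩
    | succ m hm ih =>
      obtain ⟨β, hβ⟩ := ih
      rcases h.left_succ m r β with h1 | ⟨-, -, h1⟩
      · exact ⟨β, h1.trans hβ⟩
      · exact absurd (hu (m + 1)) (by rw [← hβ, h1]; exact lt_irrefl _)
  let B : ℕ → Finset A := fun m => Finset.univ.filter fun β => (S m).left r β < z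
  have hB : ∀ m β, β ∈ B m ↔ (S m).left r β < z := fun m β => by simp [B]
  have hBsucc : ∀ m, B m ⊆ B (m + 1) := by
    intro m β hβ
    rw [hB] at hβ ⊢
    rcases h.left_succ m r β with h1 | ⟨-, -, h1⟩
    · rwa [h1]
    · linarith [hu (m + 1)]
  have hBmono : Monotone B := monotone_nat_of_le_succ hBsucc
  have hBwin : ∀ m, n ≤ m → γ.winner m ∈ B m → (B m).card < (B (m + 1)).card := by
    intro m hm hw
    rw [hB] at hw
    obtain ⟨δ, hδ⟩ := hpersist m hm
    have hright := (S m).right_le_left_of_left_lt (hw.trans_eq hδ.symm)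
    rw [hδ] at hright
    have hst := h.step m
    -- On its own side the winner ends at the total length, beyond `z`, so only the other side can
    -- occur.
    rcases r.eq_or_eq_other (γ.type m) with hr | hr
    · have := right_last (S m) r
      rw [hr, h.last_winner, ← hr] at this
      linarith [hu m]
    · refine Finset.card_lt_card ⟨hBsucc m, fun hsub => ?_⟩
      have h1 := hst.left_other_loser
      have h2 := hst.len_other_add
      rw [h.last_winner, h.last_loser, ← hr] at h1 h2
      have h3 : γ.loser m ∈ B (m + 1) := by
        rw [hB, h1]
        linarith [(S (m + 1)).len_pos r (γ.loser m)]
      have h4 := hsub h3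
      rw [hB] at h4
      have h5 := hst.total_eq
      rw [← right_last (S m) r, hr, h.last_loser, ← hr] at h5
      linarith [hu (m + 1)]
  have hbig : ∀ k, ∃ m, n ≤ m ∧ k ≤ (B m).card := by
    intro k
    induction k with
    | zero => exact ⟨n, le_rfl, Nat.zero_le _⟩
    | succ k ih =>
      obtain ⟨m, hm, hk⟩ := ih
      obtain ⟨β, hβ⟩ := (S m).exists_left_eq_zero r
      have hβ' : β ∈ B m := by rw [hB, hβ]; exact hα
      obtain ⟨l, hl, hwin⟩ := hγ.exists_winner_eq β m
      refine ⟨l + 1, by omega, ?_⟩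
      have h1 := hBwin l (hm.trans hl) (by rw [hwin]; exact hBmono hl hβ')
      have h2 := Finset.card_le_card (hBmono hl)
      omega
  obtain ⟨m, -, hm⟩ := hbig (Fintype.card A + 1)
  have := (B m).card_le_univ
  omega

theorem iterable_of_le (h : IsLevels γ w T S) {r : Side} {k : ℕ} {y : ℝ} {n m : ℕ} (hnm : n ≤ m)
    (hy : (S m).Iterable r k y) : (S n).Iterable r k y := by
  induction m, hnm using Nat.le_induction with
  | base => exact hy
  | succ m _ ih =>
    obtain ⟨β, β', hi⟩ := h.exists_induces m r
    exact ih (hi.iterable hy)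

theorem exists_first (h : IsLevels γ w T S) (r : Side) : ∃ f, ∀ n, (S n).left r f = 0 := by
  obtain ⟨f, hf⟩ := (S 0).exists_left_eq_zero r
  refine ⟨f, fun n => ?_⟩
  induction n with
  | zero => exact hf
  | succ n ih =>
    rcases h.left_succ n r f with h1 | ⟨-, -, h1⟩
    · rw [h1, ih]
    · linarith [(S (n + 1)).total_pos]

/-- By `lt_left` the point lies in the first interval at every level. The first letter loses
infinitely often, and each loss adds an iterate through `iterable_succ`. -/
theorem iterable (h : IsLevels γ w T S) (hγ : γ.InfComplete) {y : ℝ} (hy0 : 0 < y)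
    (hy : ∀ n, y < (S n).total) (r : Side) (k n : ℕ) : (S n).Iterable r k y := by
  obtain ⟨f, hf⟩ := h.exists_first r
  have hfirst : ∀ n, y ∈ (S n).interval r f := by
    intro n
    obtain ⟨α, hα⟩ := (S n).exists_mem_interval r ⟨hy0, hy n⟩ fun α hc =>
      (h.lt_left hγ hy n r α (hc ▸ hy0)).ne hc
    have : (S n).left r α = 0 := by
      by_contra hne
      have := h.lt_left hγ hy n r α (((S n).left_nonneg r α).lt_of_ne (Ne.symm hne))
      linarith [hα.1]
    rwa [← (S n).left_injective r (this.trans (hf n).symm)]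
  induction k generalizing n with
  | zero => trivial
  | succ k ih =>
    cases k with
    | zero => exact ⟨f, hfirst n, trivial⟩
    | succ k =>
      obtain ⟨m, hm, hl⟩ := hγ.exists_loser_eq f n
      obtain ⟨β, β', hi⟩ := h.exists_induces m r
      rw [hl] at hi
      exact h.iterable_of_le hm (hi.iterable_succ (hfirst _) (ih (m + 1)))

/-- This makes it unnecessary to know that the total lengths tend to zero. A positive point below
all of them can be iterated forever in both directions, whereas a singular orbit stops in one
direction. -/
theorem notMem_singularOrbits (h : IsLevels γ w T S) (hγ : γ.InfComplete) {y : ℝ} (hy0 : 0 < y)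
    (hy : ∀ n, y < (S n).total) : y ∉ T.singularOrbits := by
  have hit : ∀ r k, T.Iterable r k y := by
    intro r k
    rw [← h.zero]
    exact h.iterable hγ hy0 hy r k 0
  have hsing : ∀ r u, u ∈ T.singularities r → ¬ T.Iterable r 1 u := by
    rintro r u ⟨-, hu⟩ ⟨α, hα, -⟩
    exact hu (mem_iUnion.2 ⟨α, hα⟩)
  rintro ((hmem | ⟨u, hu, hchain⟩) | ⟨u, hu, hchain⟩)
  · rcases hmem with rfl | hmem
    · exact lt_irrefl _ hy0
    · have := hy 0
      rw [h.zero, ← mem_singleton_iff.1 hmem] at this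
      exact lt_irrefl _ this
  · refine hsing _ u hu ?_
    have : ∀ k, T.Iterable .bot k u := by
      clear hu
      induction hchain using Relation.ReflTransGen.head_induction_on with
      | refl => exact hit .bot
      | head hzy _ ih => exact fun k => (ih (k + 1)).of_maps_bot hzy
    exact this 1
  · refine hsing _ u hu ?_
    have : ∀ k, T.Iterable .top k u := by
      clear hu
      induction hchain with
      | refl => exact hit .top
      | tail _ hzy ih => exact fun k => (ih (k + 1)).of_maps hzy
    exact this 1

end IsLevels

end Levels

namespace AffineIEM

/-! ### Sets containing the endpoints and invariant under the branches. -/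

section Stable

variable {A : Type*} [Fintype A]

/-- `Z` contains the endpoints of the intervals of `T`, and is invariant by `T` and `T⁻¹`. -/
structure Stable (T : AffineIEM A) (Z : Set ℝ) : Prop where
  left_mem : ∀ r α, T.left r α ∈ Z
  total_mem : T.total ∈ Z
  br_mem : ∀ r α, ∀ x ∈ T.interval r α, x ∈ Z → T.br r α x ∈ Z

theorem stable_singularOrbits (T : AffineIEM A) : T.Stable T.singularOrbits where
  left_mem r α := by
    rcases (T.left_nonneg r α).eq_or_lt with h | h
    · rw [← h]
      exact Or.inl (Or.inl (Or.inl rfl))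
    · have hs := T.mem_singularities_iff.2 ⟨h, α, rfl⟩
      cases r
      · exact Or.inr ⟨_, hs, .refl⟩
      · exact Or.inl (Or.inr ⟨_, hs, .refl⟩)
  total_mem := Or.inl (Or.inl (Or.inr rfl))
  br_mem r α x hx hxZ := by
    have h0 := T.interval_subset r α hx
    have hns : x ∉ T.singularities r := fun hc => hc.2 (mem_iUnion.2 ⟨α, hx⟩)
    rcases hxZ with (hxZ | ⟨u, hu, hc⟩) | ⟨u, hu, hc⟩
    · rcases hxZ with rfl | hxZ
      · exact absurd h0.1 (lt_irrefl _)
      · rw [mem_singleton_iff.1 hxZ] at h0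
        exact absurd h0.2 (lt_irrefl _)
    · cases r
      · exact Or.inl (Or.inr ⟨u, hu, hc.tail ⟨α, hx, rfl⟩⟩)
      · rcases hc.cases_tail with rfl | ⟨z, hz, β, hβ, hzx⟩
        · exact absurd hu hns
        · rw [branch_eq_br] at hzx
          have hβx : x ∈ T.interval .bot β := by
            rw [← hzx]
            exact T.br_top_mem hβ
          obtain rfl := T.eq_of_mem_interval hx hβx
          rw [← hzx, ← Side.other_top, br_other_br]
          exact Or.inl (Or.inr ⟨u, hu, hz⟩)
    · cases r
      · rcases hc.cases_head with rfl | ⟨z, ⟨β, hβ, rfl⟩, hz⟩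
        · exact absurd hu hns
        · obtain rfl := T.eq_of_mem_interval hx hβ
          exact Or.inr ⟨u, hu, hz⟩
      · refine Or.inr ⟨u, hu, hc.head ⟨α, ?_, ?_⟩⟩
        · exact T.br_bot_mem hx
        · exact T.br_br_other .top α x

theorem singularOrbits_subset (T : AffineIEM A) : T.singularOrbits ⊆ Icc 0 T.total := by
  have htot : 0 ≤ T.total := Finset.sum_nonneg fun α _ => (T.len_pos _ α).le
  rintro x ((hx | ⟨u, hu, hc⟩) | ⟨u, hu, hc⟩)
  · rcases hx with rfl | rfl
    · exact ⟨le_rfl, htot⟩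
    · exact ⟨htot, le_rfl⟩
  · rcases hc.cases_tail with rfl | ⟨z, -, β, hβ, rfl⟩
    · exact Ioo_subset_Icc_self hu.1
    · exact Ioo_subset_Icc_self (T.interval_subset .bot β (T.br_top_mem hβ))
  · rcases hc.cases_head with rfl | ⟨z, ⟨β, hβ, -⟩, -⟩
    · exact Ioo_subset_Icc_self hu.1
    · exact Ioo_subset_Icc_self (T.interval_subset .top β hβ)

namespace Stable

variable {T : AffineIEM A} {Z : Set ℝ}

theorem right_mem (h : T.Stable Z) (r : Side) (α : A) : T.left r α + T.len r α ∈ Z := by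
  rcases T.right_eq_total_or_exists_left r α with h1 | ⟨β, h1⟩
  · rw [h1]; exact h.total_mem
  · rw [h1]; exact h.left_mem r β

theorem br_mem_of_mem_cl (h : T.Stable Z) {r : Side} {α : A} {x : ℝ} (hx : x ∈ T.cl r α)
    (hxZ : x ∈ Z) : T.br r α x ∈ Z := by
  rcases T.eq_left_or_eq_right_or_mem hx with rfl | rfl | hx
  · rw [br_left]; exact h.left_mem _ _
  · rw [br_right]; exact h.right_mem _ _
  · exact h.br_mem r α x hx hxZ

theorem mem_closure_inter_cl (h : T.Stable Z) {r : Side} {α : A} {x : ℝ} (hx : x ∈ T.cl r α)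
    (hxZ : x ∈ closure Z) : x ∈ closure (T.cl r α ∩ Z) := by
  rcases T.eq_left_or_eq_right_or_mem hx with rfl | rfl | hx
  · exact subset_closure ⟨T.left_mem_cl _ _, h.left_mem _ _⟩
  · exact subset_closure ⟨T.right_mem_cl _ _, h.right_mem _ _⟩
  · exact closure_mono (inter_subset_inter_left _ (T.interval_subset_cl r α))
      (isOpen_Ioo.inter_closure ⟨hx, hxZ⟩)

theorem closure (h : T.Stable Z) : T.Stable (closure Z) where
  left_mem r α := subset_closure (h.left_mem r α)
  total_mem := subset_closure h.total_mem
  br_mem r α x hx hxZ := by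
    refine map_mem_closure (T.continuous_br r α)
      (h.mem_closure_inter_cl (T.interval_subset_cl r α hx) hxZ) ?_
    rintro y ⟨hy, hyZ⟩
    exact h.br_mem_of_mem_cl hy hyZ

/-- The endpoints created by a step are the cut point, which is an old endpoint of the other side,
and its image by the winner's branch. The new branches are composed of old ones. -/
theorem of_step [Nontrivial A] {T' : AffineIEM A} {s : Side} (h : T.Stable Z)
    (hst : IsRauzyVeechStep s T T') : T'.Stable Z := by
  have htot : T'.total ∈ Z := by
    rw [← hst.br_loser_total, br_left]
    exact h.left_mem _ _
  have hmem : T'.total ∈ T.interval s (T.comb.last s) := by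
    constructor
    · rw [← right_last T' s, hst.last_succ, hst.left_same]
      linarith [T'.len_pos s (T.comb.last s)]
    · rw [right_last]
      exact hst.induces_same.total_lt
  refine ⟨fun r α => ?_, htot, fun r α x hx hxZ => ?_⟩
  · rcases r.eq_or_eq_other s with rfl | rfl
    · rw [hst.left_same]
      exact h.left_mem _ _
    · by_cases hα : α = T.comb.last s.other
      · have h1 := hst.induces_other.br_left_loser
        rw [hα, ← T.br_br_other s (T.comb.last s) (T'.left _ _), h1]
        exact h.br_mem _ _ _ hmem htot
      · rw [hst.left_other hα]
        exact h.left_mem _ _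
  · obtain ⟨β, β', hi⟩ := hst.exists_induces r
    by_cases hα : α = T.comb.last s.other
    · subst hα
      rw [hi.br_loser]
      exact h.br_mem _ _ _ (hi.Ioo_subset (hi.br_mem_Ioo hx))
        (h.br_mem _ _ _ (hi.interval_loser hx) hxZ)
    · rw [hi.br_ne α hα]
      exact h.br_mem _ _ _ (hi.interval_ne α hα hx) hxZ

end Stable

theorem br_image_Ioo (T : AffineIEM A) (r : Side) (α : A) (p q : ℝ) :
    T.br r α '' Ioo p q = Ioo (T.br r α p) (T.br r α q) := by
  ext y
  constructor
  · rintro ⟨x, hx, rfl⟩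
    exact ⟨T.br_strictMono r α hx.1, T.br_strictMono r α hx.2⟩
  · intro hy
    rw [← T.br_br_other r α y] at hy ⊢
    exact ⟨_, ⟨(T.br_strictMono r α).lt_iff_lt.1 hy.1, (T.br_strictMono r α).lt_iff_lt.1 hy.2⟩, rfl⟩

end Stable

end AffineIEM

/-! ### Gaps of the closure of the singular orbits, and how the map permutes them. -/

section Gap

/-- `(p, q)` is a bounded component of the complement of `K`. -/
structure IsGap (K : Set ℝ) (p q : ℝ) : Prop where
  left_mem : p ∈ K
  right_mem : q ∈ K
  lt : p < q
  notMem : ∀ x ∈ Ioo p q, x ∉ K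

theorem IsGap.eq_of_mem {K : Set ℝ} {p q p' q' x : ℝ} (h : IsGap K p q) (h' : IsGap K p' q')
    (hx : x ∈ Ioo p q) (hx' : x ∈ Ioo p' q') : p = p' ∧ q = q' := by
  refine ⟨le_antisymm ?_ ?_, le_antisymm ?_ ?_⟩ <;> by_contra! hc
  · exact h'.notMem p ⟨hc, hx.1.trans hx'.2⟩ h.left_mem
  · exact h.notMem p' ⟨hc, hx'.1.trans hx.2⟩ h'.left_mem
  · exact h.notMem q' ⟨hx.1.trans hx'.2, hc⟩ h'.right_mem
  · exact h'.notMem q ⟨hx'.1.trans hx.2, hc⟩ h.right_mem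

theorem exists_isGap {K : Set ℝ} (hK : IsClosed K) {a b x : ℝ} (ha : a ∈ K) (hb : b ∈ K)
    (hx : x ∈ Icc a b) (hxK : x ∉ K) : ∃ p q, IsGap K p q ∧ x ∈ Ioo p q := by
  have h1 : IsClosed (K ∩ Iic x) := hK.inter isClosed_Iic
  have h2 : IsClosed (K ∩ Ici x) := hK.inter isClosed_Ici
  have hb1 : BddAbove (K ∩ Iic x) := ⟨x, fun y hy => hy.2⟩
  have hb2 : BddBelow (K ∩ Ici x) := ⟨x, fun y hy => hy.2⟩
  have m1 := h1.csSup_mem ⟨a, ha, hx.1⟩ hb1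
  have m2 := h2.csInf_mem ⟨b, hb, hx.2⟩ hb2
  have l1 : sSup (K ∩ Iic x) < x := lt_of_le_of_ne m1.2 fun hc => hxK (hc ▸ m1.1)
  have l2 : x < sInf (K ∩ Ici x) := lt_of_le_of_ne m2.2 fun hc => hxK (hc ▸ m2.1)
  refine ⟨_, _, ⟨m1.1, m2.1, l1.trans l2, ?_⟩, l1, l2⟩
  intro y hy hyK
  rcases le_total y x with h | h
  · exact absurd (le_csSup hb1 ⟨hyK, h⟩) (not_le.2 hy.1)
  · exact absurd (csInf_le hb2 ⟨hyK, h⟩) (not_le.2 hy.2)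

namespace AffineIEM

variable {A : Type*} [Fintype A] {T : AffineIEM A} {K : Set ℝ}

/-- All endpoints of the intervals belong to `K`, so none of them lies inside a gap. -/
theorem Stable.exists_gap_subset (h : T.Stable K) (hK : K ⊆ Icc 0 T.total) {p q : ℝ}
    (hg : IsGap K p q) (r : Side) : ∃ α, Ioo p q ⊆ T.interval r α := by
  have hm : (p + q) / 2 ∈ Ioo p q := ⟨by linarith [hg.lt], by linarith [hg.lt]⟩
  have h01 : (p + q) / 2 ∈ Ioo 0 T.total :=
    ⟨(hK hg.left_mem).1.trans_lt hm.1, hm.2.trans_le (hK hg.right_mem).2⟩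
  obtain ⟨α, hα⟩ := T.exists_mem_interval r h01
    fun α hc => hg.notMem _ hm (hc ▸ h.left_mem r α)
  refine ⟨α, Ioo_subset_Ioo ?_ ?_⟩ <;> by_contra! hc
  · exact hg.notMem _ ⟨hc, hα.1.trans hm.2⟩ (h.left_mem r α)
  · exact hg.notMem _ ⟨hm.1.trans hα.2, hc⟩ (h.right_mem r α)

theorem Icc_subset_cl {p q : ℝ} (hpq : p < q) {r : Side} {α : A} (h : Ioo p q ⊆ T.interval r α) :
    Icc p q ⊆ T.cl r α := by
  rw [← closure_Ioo hpq.ne, cl, ← closure_Ioo (by linarith [T.len_pos r α])]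
  exact closure_mono h

theorem Stable.isGap_br (h : T.Stable K) {p q : ℝ} (hg : IsGap K p q) {r : Side} {α : A}
    (hα : Ioo p q ⊆ T.interval r α) : IsGap K (T.br r α p) (T.br r α q) := by
  have hcl := Icc_subset_cl hg.lt hα
  refine ⟨h.br_mem_of_mem_cl (hcl ⟨le_rfl, hg.lt.le⟩) hg.left_mem,
    h.br_mem_of_mem_cl (hcl ⟨hg.lt.le, le_rfl⟩) hg.right_mem, T.br_strictMono r α hg.lt, ?_⟩
  rw [← br_image_Ioo]
  rintro _ ⟨x, hx, rfl⟩ hxK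
  have := h.br_mem r.other α _ (T.br_mem_interval_iff.2 (hα hx)) hxK
  rw [br_other_br] at this
  exact hg.notMem x hx this

variable (T) in
/-- The gaps of the closure of the singular orbits. -/
def Gap : Type := {g : ℝ × ℝ // IsGap (closure T.singularOrbits) g.1 g.2}

/-- The open interval of a gap. -/
def Gap.set (g : T.Gap) : Set ℝ := Ioo g.1.1 g.1.2

theorem closure_singularOrbits_subset (T : AffineIEM A) :
    closure T.singularOrbits ⊆ Icc 0 T.total :=
  closure_minimal T.singularOrbits_subset isClosed_Icc

theorem stable_closure (T : AffineIEM A) : T.Stable (closure T.singularOrbits) :=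
  T.stable_singularOrbits.closure

theorem Gap.exists_letter (g : T.Gap) (r : Side) : ∃ α, g.set ⊆ T.interval r α :=
  T.stable_closure.exists_gap_subset T.closure_singularOrbits_subset g.2 r

/-- The letter whose interval on the side `r` contains the gap. -/
def Gap.letter (g : T.Gap) (r : Side) : A := (g.exists_letter r).choose

theorem Gap.subset_letter (g : T.Gap) (r : Side) : g.set ⊆ T.interval r (g.letter r) :=
  (g.exists_letter r).choose_spec

theorem Gap.nonempty (g : T.Gap) : g.set.Nonempty := nonempty_Ioo.2 g.2.lt

theorem Gap.letter_eq {g : T.Gap} {r : Side} {α : A} (h : g.set ⊆ T.interval r α) :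
    g.letter r = α := by
  obtain ⟨x, hx⟩ := g.nonempty
  exact T.eq_of_mem_interval (g.subset_letter r hx) (h hx)

/-- The image of a gap by `T` (for `r = top`) or `T⁻¹` (for `r = bot`). -/
def Gap.move (r : Side) (g : T.Gap) : T.Gap :=
  ⟨(T.br r (g.letter r) g.1.1, T.br r (g.letter r) g.1.2),
    T.stable_closure.isGap_br g.2 (g.subset_letter r)⟩

theorem Gap.move_set (r : Side) (g : T.Gap) : (g.move r).set = T.br r (g.letter r) '' g.set :=
  (T.br_image_Ioo _ _ _ _).symm

theorem Gap.letter_move (r : Side) (g : T.Gap) : (g.move r).letter r.other = g.letter r := by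
  apply Gap.letter_eq
  rw [g.move_set]
  rintro _ ⟨x, hx, rfl⟩
  exact T.br_mem_interval_iff.2 (g.subset_letter r hx)

theorem Gap.move_other_move (r : Side) (g : T.Gap) : (g.move r).move r.other = g := by
  apply Subtype.ext
  apply Prod.ext
  · change T.br r.other ((g.move r).letter r.other) (T.br r (g.letter r) g.1.1) = _
    rw [letter_move, br_other_br]
  · change T.br r.other ((g.move r).letter r.other) (T.br r (g.letter r) g.1.2) = _
    rw [letter_move, br_other_br]

variable (T) in
/-- The permutation of the gaps induced by `T`. -/
def gapPerm : Equiv.Perm T.Gap where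
  toFun := Gap.move .top
  invFun := Gap.move .bot
  left_inv := Gap.move_other_move .top
  right_inv := Gap.move_other_move .bot

theorem Gap.eq_of_mem {g g' : T.Gap} {x : ℝ} (h : x ∈ g.set) (h' : x ∈ g'.set) : g = g' := by
  have := g.2.eq_of_mem g'.2 h h'
  exact Subtype.ext (Prod.ext this.1 this.2)

/-- The images of a gap by the iterates of `T`. -/
def Gap.seq (g : T.Gap) (n : ℤ) : Set ℝ := ((T.gapPerm ^ n) g).set

theorem gapPerm_zpow_succ (g : T.Gap) (n : ℤ) :
    (T.gapPerm ^ (n + 1)) g = ((T.gapPerm ^ n) g).move .top := by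
  rw [add_comm, zpow_add, zpow_one]
  rfl

theorem Gap.seq_succ (g : T.Gap) (n : ℤ) :
    g.seq (n + 1) = T.br .top (((T.gapPerm ^ n) g).letter .top) '' g.seq n := by
  rw [seq, gapPerm_zpow_succ, move_set]
  rfl

/-- The orbit of a gap. -/
def Gap.orbit (g : T.Gap) : Set ℝ := ⋃ n, g.seq n

theorem Gap.isOpen_orbit (g : T.Gap) : IsOpen g.orbit := isOpen_iUnion fun _ => isOpen_Ioo

theorem Gap.set_subset_orbit (g : T.Gap) : g.set ⊆ g.orbit := subset_iUnion g.seq 0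

theorem Gap.set_disjoint (g : T.Gap) : Disjoint g.set (closure T.singularOrbits) :=
  disjoint_left.2 g.2.notMem

theorem Gap.orbit_disjoint (g : T.Gap) : Disjoint g.orbit (closure T.singularOrbits) :=
  disjoint_iUnion_left.2 fun n => ((T.gapPerm ^ n) g).set_disjoint

theorem Gap.set_subset_Ioo (g : T.Gap) : g.set ⊆ Ioo 0 T.total :=
  (g.subset_letter .top).trans (T.interval_subset _ _)

theorem Gap.orbit_subset_Ioo (g : T.Gap) : g.orbit ⊆ Ioo 0 T.total :=
  iUnion_subset fun n => ((T.gapPerm ^ n) g).set_subset_Ioo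

theorem Gap.orbit_eq_or_disjoint (g g' : T.Gap) :
    g.orbit = g'.orbit ∨ Disjoint g.orbit g'.orbit := by
  by_cases h : Disjoint g.orbit g'.orbit
  · exact Or.inr h
  · left
    obtain ⟨x, hx, hx'⟩ := not_disjoint_iff.1 h
    obtain ⟨m, hm⟩ := mem_iUnion.1 hx
    obtain ⟨n, hn⟩ := mem_iUnion.1 hx'
    have key : ∀ (g g' : T.Gap) (m n : ℤ), (T.gapPerm ^ m) g = (T.gapPerm ^ n) g' →
        g.orbit ⊆ g'.orbit := by
      intro g g' m n h
      refine iUnion_subset fun k => ?_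
      have : g.seq k = g'.seq (k - m + n) := by
        unfold seq
        rw [zpow_add, Equiv.Perm.mul_apply, ← h, ← Equiv.Perm.mul_apply, ← zpow_add,
          sub_add_cancel]
      rw [this]
      exact subset_iUnion g'.seq _
    have := Gap.eq_of_mem hm hn
    exact (key g g' m n this).antisymm (key g' g n m this.symm)

theorem Gap.maps_mem_orbit_iff (g : T.Gap) {x : ℝ} :
    (∃ y ∈ g.orbit, T.Maps x y) ↔ x ∈ g.orbit := by
  constructor
  · rintro ⟨y, hy, α, hα, rfl⟩
    obtain ⟨n, hn⟩ := mem_iUnion.1 hy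
    rw [← sub_add_cancel n 1, seq_succ] at hn
    obtain ⟨z, hz, hzx⟩ := hn
    rw [branch_eq_br] at hzx
    have hz' := ((T.gapPerm ^ (n - 1)) g).subset_letter .top hz
    have h1 := T.br_top_mem hz'
    rw [hzx] at h1
    have h2 := T.eq_of_mem_interval h1 (T.br_top_mem hα)
    rw [h2] at hzx
    rw [← (T.br_strictMono .top α).injective hzx]
    exact mem_iUnion.2 ⟨_, hz⟩
  · intro hx
    obtain ⟨n, hn⟩ := mem_iUnion.1 hx
    refine ⟨_, mem_iUnion.2 ⟨n + 1, ?_⟩, _, ((T.gapPerm ^ n) g).subset_letter .top hn, rfl⟩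
    rw [seq_succ]
    exact mem_image_of_mem _ hn

theorem Gap.orbit_isInvariantModZero (g : T.Gap) : T.IsInvariantModZero g.orbit := by
  refine ⟨g.isOpen_orbit.measurableSet, ?_⟩
  have : {x | ∃ y ∈ g.orbit, T.Maps x y} = g.orbit := Set.ext fun x => g.maps_mem_orbit_iff
  rw [this]
  rfl

theorem exists_gap_of_notMem [Nonempty A] {x : ℝ} (hx : x ∈ Icc 0 T.total)
    (hxK : x ∉ closure T.singularOrbits) : ∃ g : T.Gap, x ∈ g.set := by
  obtain ⟨α, hα⟩ := T.exists_left_eq_zero .top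
  obtain ⟨p, q, hg, hx⟩ := exists_isGap isClosed_closure
    (hα ▸ T.stable_closure.left_mem .top α) T.stable_closure.total_mem hx hxK
  exact ⟨⟨(p, q), hg⟩, hx⟩

end AffineIEM

end Gap

/-! ### Distribution functions of invariant sets. -/

section Cdf

/-- The measure of `P ∩ [0, x]`. -/
def cdf (P : Set ℝ) (x : ℝ) : ℝ := volume.real (P ∩ Icc 0 x)

theorem volume_inter_Icc_ne_top (P : Set ℝ) (x y : ℝ) : volume (P ∩ Icc x y) ≠ ⊤ :=
  measure_ne_top_of_subset inter_subset_right measure_Icc_lt_top.ne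

theorem measureReal_inter_Ioo_eq_Ioc (P : Set ℝ) (x y : ℝ) :
    volume.real (P ∩ Ioo x y) = volume.real (P ∩ Ioc x y) :=
  measureReal_congr ((ae_eq_refl P).inter Ioo_ae_eq_Ioc)

theorem cdf_sub {P : Set ℝ} (hP : MeasurableSet P) {x y : ℝ} (h0 : 0 ≤ x) (hxy : x ≤ y) :
    cdf P y - cdf P x = volume.real (P ∩ Ioo x y) := by
  have h : P ∩ Icc 0 y = (P ∩ Icc 0 x) ∪ (P ∩ Ioc x y) := by
    rw [← inter_union_distrib_left, Icc_union_Ioc_eq_Icc h0 hxy]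
  have hd : Disjoint (P ∩ Icc 0 x) (P ∩ Ioc x y) :=
    Disjoint.mono inter_subset_right inter_subset_right
      (disjoint_left.2 fun z hz hz' => not_lt.2 hz.2 hz'.1)
  have hfin : volume (P ∩ Ioc x y) ≠ ⊤ :=
    measure_ne_top_of_subset inter_subset_right measure_Ioc_lt_top.ne
  rw [cdf, cdf, h, measureReal_union hd (hP.inter measurableSet_Ioc)
    (volume_inter_Icc_ne_top _ _ _) hfin, measureReal_inter_Ioo_eq_Ioc]
  ring

theorem cdf_zero (P : Set ℝ) : cdf P 0 = 0 := by
  simp only [cdf, Icc_self]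
  exact measureReal_eq_zero_iff (measure_ne_top_of_subset inter_subset_right (by simp)) |>.2
    (measure_mono_null inter_subset_right (by simp))

theorem cdf_mono (P : Set ℝ) : Monotone (cdf P) := fun _ _ hxy =>
  measureReal_mono (inter_subset_inter_right _ (Icc_subset_Icc_right hxy))
    (volume_inter_Icc_ne_top _ _ _)

theorem cdf_sub_le {P : Set ℝ} (hP : MeasurableSet P) {x y : ℝ} (h0 : 0 ≤ x) (hxy : x ≤ y) :
    cdf P y - cdf P x ≤ y - x := by
  rw [cdf_sub hP h0 hxy]
  calc volume.real (P ∩ Ioo x y) ≤ volume.real (Ioo x y) :=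
        measureReal_mono inter_subset_right measure_Ioo_lt_top.ne
    _ = y - x := by rw [Real.volume_real_Ioo_of_le hxy]

theorem continuousOn_cdf {P : Set ℝ} (hP : MeasurableSet P) : ContinuousOn (cdf P) (Ici 0) := by
  have : LipschitzOnWith 1 (cdf P) (Ici 0) := by
    refine LipschitzOnWith.of_dist_le_mul fun x hx y hy => ?_
    rw [NNReal.coe_one, one_mul, Real.dist_eq, Real.dist_eq]
    rcases le_total x y with h | h
    · rw [abs_sub_comm, abs_sub_comm x y, abs_of_nonneg (sub_nonneg.2 (cdf_mono P h)),
        abs_of_nonneg (sub_nonneg.2 h)]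
      exact cdf_sub_le hP hx h
    · rw [abs_of_nonneg (sub_nonneg.2 (cdf_mono P h)), abs_of_nonneg (sub_nonneg.2 h)]
      exact cdf_sub_le hP hy h
  exact this.continuousOn

namespace AffineIEM

variable {A : Type*} [Fintype A] {T : AffineIEM A}

theorem volume_preimage_br (r : Side) (α : A) (E : Set ℝ) :
    volume (T.br r α ⁻¹' E) = ENNReal.ofReal (T.slope r α)⁻¹ * volume E := by
  have h : T.br r α ⁻¹' E = (fun x => T.slope r α * x) ⁻¹'
      ((fun y => y + (T.left r.other α - T.slope r α * T.left r α)) ⁻¹' E) := by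
    ext x
    simp only [mem_preimage, br_def]
    rw [show T.left r.other α + T.slope r α * (x - T.left r α) =
      T.slope r α * x + (T.left r.other α - T.slope r α * T.left r α) by ring]
  rw [h, Real.volume_preimage_mul_left (T.slope_pos r α).ne', measure_preimage_add_right,
    abs_of_pos (inv_pos.2 (T.slope_pos r α))]

/-- Within one interval, pulling `P` back by the branch is pulling it back by `T`, which returns `P`
up to a null set; the affine change of variables produces the slope. -/
theorem IsInvariantModZero.measure_Ioo {P : Set ℝ} (h : T.IsInvariantModZero P) {α : A} {x y : ℝ}
    (hsub : Ioo x y ⊆ T.interval .top α) :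
    volume.real (P ∩ Ioo (T.br .top α x) (T.br .top α y)) =
      T.slope .top α * volume.real (P ∩ Ioo x y) := by
  have h1 : T.br .top α ⁻¹' (P ∩ Ioo (T.br .top α x) (T.br .top α y)) =
      {z | ∃ t ∈ P, T.Maps z t} ∩ Ioo x y := by
    ext z
    simp only [mem_preimage, mem_inter_iff, mem_Ioo, (T.br_strictMono .top α).lt_iff_lt]
    refine and_congr_left fun hz => ⟨fun hP => ⟨_, hP, α, hsub hz, rfl⟩, ?_⟩
    rintro ⟨t, ht, β, hβ, rfl⟩
    obtain rfl := T.eq_of_mem_interval (hsub hz) hβ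
    exact ht
  have h2 : volume ({z | ∃ t ∈ P, T.Maps z t} ∩ Ioo x y) = volume (P ∩ Ioo x y) :=
    measure_congr (h.2.inter (ae_eq_refl _))
  have h3 := T.volume_preimage_br .top α (P ∩ Ioo (T.br .top α x) (T.br .top α y))
  rw [h1, h2] at h3
  rw [measureReal_def, measureReal_def, h3, ENNReal.toReal_mul,
    ENNReal.toReal_ofReal (inv_nonneg.2 (T.slope_pos _ _).le), ← mul_assoc,
    mul_inv_cancel₀ (T.slope_pos _ _).ne', one_mul]

theorem IsInvariantModZero.isSlopeFun {P : Set ℝ} (h : T.IsInvariantModZero P) :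
    T.IsSlopeFun (cdf P) := by
  have key : ∀ α, ∀ x ∈ T.cl .top α, ∀ y ∈ T.cl .top α, x ≤ y →
      cdf P (T.br .top α y) - cdf P (T.br .top α x) = T.slope .top α * (cdf P y - cdf P x) := by
    intro α x hx y hy hxy
    rw [cdf_sub h.1 ((T.cl_subset _ _ hx).1) hxy, cdf_sub h.1 ((T.cl_subset _ _ (T.br_mem_cl hx)).1)
      ((T.br_strictMono _ _).monotone hxy)]
    exact h.measure_Ioo (Ioo_subset_Ioo hx.1 hy.2)
  intro α x hx y hy
  rcases le_total x y with hxy | hxy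
  · exact key α x hx y hy hxy
  · have := key α y hy x hx hxy
    linarith

theorem mass_cdf {P : Set ℝ} (hP : MeasurableSet P) (r : Side) (α : A) :
    T.mass (cdf P) r α = volume.real (P ∩ T.interval r α) :=
  cdf_sub hP (T.left_nonneg r α) (by linarith [T.len_pos r α])

theorem IsInvariantModZero.inter {P Q : Set ℝ} (hP : T.IsInvariantModZero P)
    (hQ : T.IsInvariantModZero Q) : T.IsInvariantModZero (P ∩ Q) := by
  refine ⟨hP.1.inter hQ.1, ?_⟩
  have : {x | ∃ y ∈ P ∩ Q, T.Maps x y} =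
      {x | ∃ y ∈ P, T.Maps x y} ∩ {x | ∃ y ∈ Q, T.Maps x y} := by
    ext x
    constructor
    · rintro ⟨y, hy, h⟩
      exact ⟨⟨y, hy.1, h⟩, ⟨y, hy.2, h⟩⟩
    · rintro ⟨⟨y, hy, α, hα, rfl⟩, ⟨z, hz, β, hβ, rfl⟩⟩
      obtain rfl := T.eq_of_mem_interval hα hβ
      exact ⟨_, ⟨hy, hz⟩, α, hα, rfl⟩
  rw [this]
  exact hP.2.inter hQ.2

theorem ae_exists_mem_interval (T : AffineIEM A) (r : Side) :
    ∀ᵐ x, x ∈ Ioo 0 T.total → ∃ α, x ∈ T.interval r α := by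
  have h : volume (range (T.left r)) = 0 := (finite_range _).measure_zero _
  filter_upwards [compl_mem_ae_iff.2 h] with x hx h0
  exact T.exists_mem_interval r h0 fun α hc => hx ⟨α, hc.symm⟩

theorem IsInvariantModZero.diff {P Q : Set ℝ} (hP : T.IsInvariantModZero P)
    (hQ : T.IsInvariantModZero Q) : T.IsInvariantModZero (P \ Q) := by
  refine ⟨hP.1.diff hQ.1, ?_⟩
  have : {x | ∃ y ∈ P \ Q, T.Maps x y} =
      {x | ∃ y ∈ P, T.Maps x y} \ {x | ∃ y ∈ Q, T.Maps x y} := by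
    ext x
    constructor
    · rintro ⟨y, hy, α, hα, rfl⟩
      refine ⟨⟨_, hy.1, α, hα, rfl⟩, ?_⟩
      rintro ⟨z, hz, β, hβ, rfl⟩
      obtain rfl := T.eq_of_mem_interval hα hβ
      exact hy.2 hz
    · rintro ⟨⟨y, hy, h⟩, hn⟩
      exact ⟨y, ⟨hy, fun hc => hn ⟨y, hc, h⟩⟩, h⟩
  rw [this]
  exact hP.2.diff hQ.2

theorem cdf_total {P : Set ℝ} (hP : P ⊆ Icc 0 T.total) : cdf P T.total = volume.real P := by
  rw [cdf, inter_eq_left.2 hP]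

/-- All iterates in both directions are defined on these intervals, so no orbit through them stops
at a singularity. -/
theorem IsWanderingSeq.disjoint_singularOrbits {J : ℤ → Set ℝ} (hJ : T.IsWanderingSeq J)
    (n : ℤ) : Disjoint (J n) T.singularOrbits := by
  have hbot : ∀ n, ∀ x ∈ J n, ∃ α, x ∈ T.interval .bot α ∧ T.br .bot α x ∈ J (n - 1) := by
    intro n x hx
    obtain ⟨α, hα, him⟩ := hJ.2.1 (n - 1)
    rw [sub_add_cancel] at him
    rw [him] at hx
    obtain ⟨y, hy, rfl⟩ := hx
    refine ⟨α, T.br_top_mem (hα hy), ?_⟩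
    have := T.br_other_br .top α y
    rw [Side.other_top] at this
    rw [branch_eq_br, this]
    exact hy
  rw [disjoint_left]
  rintro x hx ((hxZ | ⟨u, hu, hc⟩) | ⟨u, hu, hc⟩)
  · obtain ⟨α, hα, -⟩ := hJ.2.1 n
    have := T.interval_subset _ _ (hα hx)
    rcases hxZ with rfl | hxZ
    · exact lt_irrefl _ this.1
    · rw [mem_singleton_iff.1 hxZ] at this
      exact lt_irrefl _ this.2
  · have : ∃ m, u ∈ J m := by
      clear hu
      induction hc using Relation.ReflTransGen.head_induction_on with
      | refl => exact ⟨n, hx⟩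
      | head hzy _ ih =>
        obtain ⟨m, hm⟩ := ih
        obtain ⟨α, hα, hmem⟩ := hbot m _ hm
        obtain ⟨β, hβ, rfl⟩ := hzy
        rw [branch_eq_br] at hα hmem
        obtain rfl := T.eq_of_mem_interval hα (T.br_top_mem hβ)
        rw [← Side.other_top, br_other_br] at hmem
        exact ⟨_, hmem⟩
    obtain ⟨m, hm⟩ := this
    obtain ⟨α, hα, -⟩ := hbot m u hm
    exact hu.2 (mem_iUnion.2 ⟨α, hα⟩)
  · have : ∃ m, u ∈ J m := by
      clear hu
      induction hc with
      | refl => exact ⟨n, hx⟩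
      | tail _ hzy ih =>
        obtain ⟨m, hm⟩ := ih
        obtain ⟨β, hβ, rfl⟩ := hzy
        obtain ⟨α, hα, him⟩ := hJ.2.1 m
        obtain rfl := T.eq_of_mem_interval (hα hm) hβ
        exact ⟨m + 1, him ▸ mem_image_of_mem _ hm⟩
    obtain ⟨m, hm⟩ := this
    obtain ⟨α, hα, -⟩ := hJ.2.1 m
    exact hu.2 (mem_iUnion.2 ⟨α, hα hm⟩)

theorem IsWanderingSeq.eq_seq {J : ℤ → Set ℝ} (hJ : T.IsWanderingSeq J) {g : T.Gap}
    (h0 : J 0 = g.set) (n : ℤ) : J n = g.seq n := by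
  induction n using Int.induction_on with
  | zero => exact h0
  | succ n ih =>
    obtain ⟨α, hα, him⟩ := hJ.2.1 n
    rw [ih] at hα him
    rw [him, g.seq_succ, Gap.letter_eq (g := (T.gapPerm ^ (n : ℤ)) g) hα]
    rfl
  | pred n ih =>
    obtain ⟨α, hα, him⟩ := hJ.2.1 (-n - 1)
    rw [sub_add_cancel, ih] at him
    have hs := g.seq_succ (-n - 1)
    rw [sub_add_cancel] at hs
    rw [hs] at him
    obtain ⟨x, hx⟩ := ((T.gapPerm ^ (-n - 1 : ℤ)) g).nonempty
    have hx2 : T.br .top (((T.gapPerm ^ (-n - 1 : ℤ)) g).letter .top) x ∈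
        T.branch α '' J (-n - 1) := him ▸ mem_image_of_mem _ hx
    obtain ⟨y, hy, hyx⟩ := hx2
    have hl : ((T.gapPerm ^ (-n - 1 : ℤ)) g).letter .top = α := by
      refine T.eq_of_mem_interval
        (T.br_top_mem (((T.gapPerm ^ (-n - 1 : ℤ)) g).subset_letter .top hx)) ?_
      rw [← hyx]
      exact T.br_top_mem (hα hy)
    rw [hl] at him
    exact ((T.br_strictMono .top α).injective.image_injective him).symm

/-- The vector of the normalized measures of the intersections of `P` with the top intervals. -/
def lengthsOf (T : AffineIEM A) (P : Set ℝ) (α : A) : ℝ :=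
  volume.real (P ∩ T.interval .top α) / volume.real P

theorem volume_real_pos {P : Set ℝ} (hsub : P ⊆ Icc 0 T.total) (h0 : volume P ≠ 0) :
    0 < volume.real P :=
  ENNReal.toReal_pos h0 (measure_ne_top_of_subset hsub measure_Icc_lt_top.ne)

end AffineIEM

end Cdf

/-! ### Wandering intervals are gaps; invariant sets give points of the simplex. -/

section Invariant

variable {A : Type*} [Fintype A] [Nontrivial A] {γ : RauzyPath A} {w : A → ℝ}
  {T : AffineIEM A} {S : ℕ → AffineIEM A}

open AffineIEM

theorem IsLevels.stable (h : IsLevels γ w T S) {Z : Set ℝ} (hZ : T.Stable Z) (n : ℕ) :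
    (S n).Stable Z := by
  induction n with
  | zero => rwa [h.zero]
  | succ n ih => exact ih.of_step (h.step n)

/-- The part of the domain removed at step `n` is the interval of the loser on its side, where the
orbit has positive measure by `mass_pos`. The ends of this interval lie in the closure of the
singular orbits, so a gap that meets it is contained in it. -/
theorem IsLevels.exists_gapPerm_zpow_subset (h : IsLevels γ w T S) (hγ : γ.InfComplete) (g : T.Gap)
    (n : ℕ) : ∃ k : ℤ, g.seq k ⊆ Ioo (S (n + 1)).total (S n).total := by
  have hst := T.stable_closure
  have hinv := g.orbit_isInvariantModZero
  have hsub : g.orbit ⊆ Icc 0 T.total := g.orbit_subset_Ioo.trans Ioo_subset_Icc_self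
  have hpos : cdf g.orbit 0 < cdf g.orbit T.total := by
    rw [cdf_zero, cdf_total hsub, measureReal_def]
    refine ENNReal.toReal_pos ?_ (measure_ne_top_of_subset hsub measure_Icc_lt_top.ne)
    exact (g.isOpen_orbit.measure_pos _ (g.nonempty.mono g.set_subset_orbit)).ne'
  have hmass := h.mass_pos hγ hinv.isSlopeFun ((cdf_mono _).monotoneOn _) hpos n
  have hmass' : ∀ r α, 0 < (S n).mass (cdf g.orbit) r α := by
    intro r α
    cases r
    · exact hmass α
    · rw [(h.isSlopeFun hinv.isSlopeFun n).mass_bot]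
      exact mul_pos ((S n).slope_pos _ _) (hmass α)
  have h1 := hmass' (γ.type n).other (γ.loser n)
  rw [mass_cdf hinv.1, ← h.last_loser, interval, right_last] at h1
  have h2 : (S (n + 1)).total =
      (S n).left (γ.type n).other ((S n).comb.last (γ.type n).other) := by
    rw [(h.step n).total_eq, ← right_last (S n) (γ.type n).other]; ring
  rw [← h2] at h1
  obtain ⟨x, hx, hx'⟩ : (g.orbit ∩ Ioo (S (n + 1)).total (S n).total).Nonempty := by
    rw [nonempty_iff_ne_empty]
    intro hc
    rw [hc] at h1
    simp at h1
  obtain ⟨k, hk⟩ := mem_iUnion.1 hx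
  refine ⟨k, Ioo_subset_Ioo ?_ ?_⟩ <;> by_contra! hc
  · exact ((T.gapPerm ^ k) g).2.notMem _ ⟨hc, hx'.1.trans hk.2⟩ (h.stable hst _).total_mem
  · exact ((T.gapPerm ^ k) g).2.notMem _ ⟨hk.1.trans hx'.2, hc⟩ (h.stable hst _).total_mem

/-- The orbit enters infinitely many disjoint intervals, so it consists of infinitely many gaps and
is not periodic. -/
theorem IsLevels.gapPerm_zpow_injective (h : IsLevels γ w T S) (hγ : γ.InfComplete) (g : T.Gap) :
    Function.Injective fun n : ℤ => (T.gapPerm ^ n) g := by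
  have hinf : (range fun n : ℤ => (T.gapPerm ^ n) g).Infinite := by
    choose k hk using h.exists_gapPerm_zpow_subset hγ g
    refine infinite_of_injective_forall_mem (f := fun n => (T.gapPerm ^ k n) g) ?_
      fun n => ⟨k n, rfl⟩
    intro m n hmn
    replace hmn : (T.gapPerm ^ k m) g = (T.gapPerm ^ k n) g := hmn
    obtain ⟨x, hx⟩ := ((T.gapPerm ^ k m) g).nonempty
    have hm := hk m hx
    rw [hmn] at hx
    have hn := hk n hx
    have ha := h.total_strictAnti.antitone
    rcases lt_trichotomy m n with hlt | heq | hlt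
    · have := ha (Nat.succ_le_of_lt hlt)
      exact absurd (hm.1.trans hn.2) (not_lt.2 this)
    · exact heq
    · have := ha (Nat.succ_le_of_lt hlt)
      exact absurd (hn.1.trans hm.2) (not_lt.2 this)
  have key : ∀ k : ℤ, 0 < k → (T.gapPerm ^ k) g ≠ g := by
    intro k hk hc
    apply hinf
    refine ((finite_Ico (0 : ℤ) k).image fun n => (T.gapPerm ^ n) g).subset ?_
    rintro _ ⟨n, rfl⟩
    refine ⟨n % k, ⟨Int.emod_nonneg n hk.ne', Int.emod_lt_of_pos n hk⟩, ?_⟩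
    have h1 : ((T.gapPerm ^ k) ^ (n / k)) g = g :=
      Equiv.Perm.zpow_apply_eq_self_of_apply_eq_self hc _
    change (T.gapPerm ^ (n % k)) g = (T.gapPerm ^ n) g
    conv_rhs => rw [← Int.emod_add_mul_ediv n k, zpow_add, zpow_mul, Equiv.Perm.mul_apply, h1]
  have key2 : ∀ m n : ℤ, m < n → (T.gapPerm ^ m) g ≠ (T.gapPerm ^ n) g := by
    intro m n hmn hc
    apply key (n - m) (sub_pos.2 hmn)
    rw [sub_eq_neg_add, zpow_add, Equiv.Perm.mul_apply, ← hc, ← Equiv.Perm.mul_apply, ← zpow_add,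
      neg_add_cancel, zpow_zero]
    rfl
  intro m n hmn
  by_contra hne
  rcases lt_or_gt_of_ne hne with h' | h'
  · exact key2 m n h' hmn
  · exact key2 n m h' hmn.symm

theorem IsLevels.isWanderingSeq (h : IsLevels γ w T S) (hγ : γ.InfComplete) (g : T.Gap) :
    T.IsWanderingSeq g.seq := by
  refine ⟨⟨_, _, g.2.lt, rfl⟩, fun n => ⟨_, ((T.gapPerm ^ n) g).subset_letter .top, g.seq_succ n⟩,
    fun m n hmn => ?_⟩
  refine disjoint_left.2 fun x hx hx' => ?_
  exact hmn (h.gapPerm_zpow_injective hγ g (Gap.eq_of_mem hx hx'))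

theorem AffineIEM.IsWandering.exists_subset_gap {U : Set ℝ} (hU : T.IsWandering U) :
    ∃ g : T.Gap, U ⊆ g.set := by
  obtain ⟨J, hJ, rfl⟩ := hU
  obtain ⟨a, b, hab, h0⟩ := hJ.1
  have hopen : IsOpen (J 0) := h0 ▸ isOpen_Ioo
  have hd : Disjoint (J 0) (closure T.singularOrbits) :=
    (hJ.disjoint_singularOrbits 0).closure_right hopen
  have hm : (a + b) / 2 ∈ J 0 := by rw [h0]; exact ⟨by linarith, by linarith⟩
  obtain ⟨α, hα, -⟩ := hJ.2.1 0
  obtain ⟨g, hg⟩ := exists_gap_of_notMem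
    (Ioo_subset_Icc_self (T.interval_subset _ _ (hα hm))) (disjoint_left.1 hd hm)
  refine ⟨g, ?_⟩
  rw [h0] at hm hd ⊢
  refine Ioo_subset_Ioo ?_ ?_ <;> by_contra! hc
  · exact disjoint_left.1 hd ⟨hc, hg.1.trans hm.2⟩ g.2.left_mem
  · exact disjoint_left.1 hd ⟨hm.1.trans hg.2, hc⟩ g.2.right_mem

theorem IsLevels.maximal_gap (h : IsLevels γ w T S) (hγ : γ.InfComplete) (g : T.Gap) :
    Maximal T.IsWandering g.set := by
  refine ⟨⟨g.seq, h.isWanderingSeq hγ g, rfl⟩, fun V hV hsub => ?_⟩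
  obtain ⟨g', hg'⟩ := hV.exists_subset_gap
  obtain ⟨x, hx⟩ := g.nonempty
  rwa [Gap.eq_of_mem hx (hg' (hsub hx))]

/-- Gaps are wandering and every wandering interval is inside a gap, so the gaps are the maximal
ones. -/
theorem IsLevels.isWanderingOrbit_iff (h : IsLevels γ w T S) (hγ : γ.InfComplete) {P : Set ℝ} :
    T.IsWanderingOrbit P ↔ ∃ g : T.Gap, P = g.orbit := by
  constructor
  · rintro ⟨J, hJ, hmax, rfl⟩
    obtain ⟨g, hg⟩ := hmax.prop.exists_subset_gap
    have h0 : J 0 = g.set := hmax.eq_of_subset (h.maximal_gap hγ g).prop hg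
    exact ⟨g, iUnion_congr fun n => hJ.eq_seq h0 n⟩
  · rintro ⟨g, rfl⟩
    exact ⟨g.seq, h.isWanderingSeq hγ g, h.maximal_gap hγ g, rfl⟩

/-- Up to normalization the vector consists of the increments of `cdf P`, whose images under `chain`
are again increments, hence positive. -/
theorem lengthsOf_mem (hγ : γ.InfComplete) (hT : T ∈ AffOne γ w) {P : Set ℝ}
    (hP : T.IsInvariantModZero P) (hsub : P ⊆ Icc 0 T.total) (h0 : volume P ≠ 0) :
    T.lengthsOf P ∈ AffOneLengths γ w := by
  obtain ⟨S, hS⟩ := exists_isLevels hT.1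
  have hpos := volume_real_pos hsub h0
  have hg := hP.isSlopeFun
  have heq : T.lengthsOf P = (volume.real P)⁻¹ • T.mass (cdf P) .top := by
    funext α
    simp only [lengthsOf, Pi.smul_apply, smul_eq_mul, mass_cdf hP.1]
    rw [div_eq_inv_mul]
  have hsum := T.sum_mass (cdf P) .top
  rw [cdf_zero, cdf_total hsub, sub_zero] at hsum
  rw [mem_AffOneLengths_iff hS.winner_ne, heq]
  refine ⟨fun n α => ?_, ?_, ?_⟩
  · rw [map_smul, ← hS.mass_eq_chain hg]
    refine mul_pos (inv_pos.2 hpos) (hS.mass_pos hγ hg ((cdf_mono P).monotoneOn _) ?_ n α)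
    rwa [cdf_zero, cdf_total hsub]
  · simp only [Pi.smul_apply, smul_eq_mul, mul_assoc, ← Finset.mul_sum]
    have hb := T.sum_mass (cdf P) .bot
    rw [cdf_zero, cdf_total hsub, sub_zero, ← hsum, ← sub_eq_zero, ← Finset.sum_sub_distrib] at hb
    rw [mul_eq_zero]
    right
    rw [← hb]
    refine Finset.sum_congr rfl fun α _ => ?_
    rw [hg.mass_bot, slope_top_eq_exp_iff.2 (hT.1.2 α)]
    ring
  · simp only [Pi.smul_apply, smul_eq_mul, ← Finset.mul_sum, hsum]
    exact inv_mul_cancel₀ hpos.ne'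

end Invariant

/-! ### Differentiation along a set. -/

section Density

theorem ae_accPt_of_mem (K : Set ℝ) : ∀ᵐ x, x ∈ K → AccPt x (Filter.principal K) := by
  have hc : {x ∈ K | nhdsWithin x (K ∩ Ioi x) = ⊥}.Countable :=
    countable_setOfPred_isolated_right_within
  filter_upwards [compl_mem_ae_iff.2 (hc.measure_zero volume)] with x hx hxK
  have h1 : nhdsWithin x (K ∩ Ioi x) ≠ ⊥ := fun h => hx ⟨hxK, h⟩
  rw [accPt_principal_iff_nhdsWithin]
  exact Filter.NeBot.mono ⟨h1⟩ (nhdsWithin_mono x fun y hy => ⟨hy.1, hy.2.ne'⟩)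

/-- Almost everywhere the primitive has derivative `f x`. Along `K` it is zero, so at an
accumulation point of `K` this derivative is zero, and almost every point of `K` is one. -/
theorem ae_eq_zero_of_integral_eq_zero {f : ℝ → ℝ} (hf : LocallyIntegrable f volume) {K : Set ℝ}
    {a : ℝ} (h : ∀ x ∈ K, ∫ t in a..x, f t = 0) : ∀ᵐ x, x ∈ K → f x = 0 := by
  filter_upwards [ae_accPt_of_mem K, LocallyIntegrable.ae_hasDerivAt_integral hf]
    with x hacc hder hxK
  have h1 : HasDerivWithinAt (fun x => ∫ t in a..x, f t) (f x) K x := (hder a).hasDerivWithinAt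
  have h2 : HasDerivWithinAt (fun x => ∫ t in a..x, f t) 0 K x :=
    (hasDerivWithinAt_const x K (0 : ℝ)).congr h (h x hxK)
  exact (hacc hxK).uniqueDiffWithinAt.eq_deriv K h1 h2

theorem integral_indicator_one_eq_cdf {P : Set ℝ} (hP : MeasurableSet P) {x : ℝ} (hx : 0 ≤ x) :
    ∫ t in (0 : ℝ)..x, P.indicator (fun _ => (1 : ℝ)) t = cdf P x := by
  rw [intervalIntegral.integral_of_le hx, integral_indicator hP, setIntegral_const, smul_eq_mul,
    mul_one, measureReal_restrict_apply hP, ← measureReal_inter_Ioo_eq_Ioc,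
    ← cdf_sub hP le_rfl hx, cdf_zero, sub_zero]

end Density

namespace AffineIEM

/-! ### Linear independence of the vectors of disjoint pieces, and existence of atoms. -/

section Pieces

variable {A : Type*} [Fintype A] {T : AffineIEM A}

/-- Zero increments make `g` vanish at all endpoints, on both sides. The slope rule, measured from a
left endpoint, then carries zeros along orbits, and continuity reaches the closure. -/
theorem IsSlopeFun.eq_zero_of_mass_eq_zero {g : ℝ → ℝ} (hg : T.IsSlopeFun g)
    (hcont : ContinuousOn g (Icc 0 T.total)) (h0 : g 0 = 0) (hm : ∀ α, T.mass g .top α = 0) :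
    ∀ x ∈ closure T.singularOrbits, g x = 0 := by
  have hm' : ∀ r α, T.mass g r α = 0 := by
    intro r α
    cases r
    · exact hm α
    · rw [hg.mass_bot, hm, mul_zero]
  have hleft : ∀ r α, g (T.left r α) = 0 := by
    intro r α
    have : ∑ β with T.comb.pos r β < T.comb.pos r α, T.mass g r β = g (T.left r α) - g 0 :=
      T.sum_increments_left r g α
    rw [Finset.sum_eq_zero fun β _ => hm' r β, h0] at this
    linarith
  have htot : g T.total = 0 := by
    have := T.sum_mass g .top
    rw [Finset.sum_eq_zero fun β _ => hm' .top β, h0] at this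
    linarith
  have hmaps : ∀ x y, T.Maps x y → (g x = 0 ↔ g y = 0) := by
    rintro x y ⟨α, hα, rfl⟩
    have := hg α _ (T.left_mem_cl _ _) x (T.interval_subset_cl _ _ hα)
    rw [br_left, Side.other_top, hleft, hleft, sub_zero, sub_zero] at this
    rw [branch_eq_br, this, mul_eq_zero, or_iff_right (T.slope_pos _ _).ne']
  have hchain : ∀ x y, Relation.ReflTransGen T.Maps x y → (g x = 0 ↔ g y = 0) := by
    intro x y h
    induction h with
    | refl => rfl
    | tail _ h ih => rw [ih, hmaps _ _ h]
  have hsing : ∀ r, ∀ u ∈ T.singularities r, g u = 0 := by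
    intro r u hu
    obtain ⟨-, α, rfl⟩ := T.mem_singularities_iff.1 hu
    exact hleft r α
  have hcl : IsClosed (Icc 0 T.total ∩ g ⁻¹' {0}) :=
    hcont.preimage_isClosed_of_isClosed isClosed_Icc isClosed_singleton
  have hsub : T.singularOrbits ⊆ Icc 0 T.total ∩ g ⁻¹' {0} := by
    intro x hx
    refine ⟨T.singularOrbits_subset hx, ?_⟩
    rcases hx with (hx | ⟨u, hu, hc⟩) | ⟨u, hu, hc⟩
    · rcases hx with rfl | rfl
      · exact h0
      · exact htot
    · exact (hchain _ _ hc).1 (hsing _ u hu)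
    · exact (hchain _ _ hc).2 (hsing _ u hu)
  exact fun x hx => (closure_minimal hsub hcl hx).2

/-- An invariant set of positive measure which is the orbit of a gap, or is contained in the closure
of the singular orbits. -/
structure IsPiece (T : AffineIEM A) (P : Set ℝ) : Prop where
  inv : T.IsInvariantModZero P
  subset : P ⊆ Icc 0 T.total
  ne_zero : volume P ≠ 0
  kind : (∃ g : T.Gap, P = g.orbit) ∨ P ⊆ closure T.singularOrbits

theorem IsPiece.pos {P : Set ℝ} (h : T.IsPiece P) : 0 < volume.real P :=
  volume_real_pos h.subset h.ne_zero

theorem isPiece_orbit (g : T.Gap) : T.IsPiece g.orbit :=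
  ⟨g.orbit_isInvariantModZero, g.orbit_subset_Ioo.trans Ioo_subset_Icc_self,
    (g.isOpen_orbit.measure_pos _ (g.nonempty.mono g.set_subset_orbit)).ne', Or.inl ⟨g, rfl⟩⟩

theorem isPiece_of_subset {P : Set ℝ} (h : T.IsInvariantModZero P)
    (hsub : P ⊆ closure T.singularOrbits) (h0 : volume P ≠ 0) : T.IsPiece P :=
  ⟨h, hsub.trans T.closure_singularOrbits_subset, h0, Or.inr hsub⟩

/-- A linear relation becomes a combination `g` of distribution functions with zero increments over
the top intervals, so `g` vanishes on the closure of the singular orbits. If piece `i` is the orbit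
of a gap, the increment of `g` over that gap involves only `i`. Otherwise `g` is the primitive of a
combination of indicators, which must vanish almost everywhere on the closure, in particular on `P
i`. -/
theorem linearIndependent_lengthsOf {ι : Type*} {P : ι → Set ℝ} (hP : ∀ i, T.IsPiece (P i))
    (hd : ∀ i j, i ≠ j → volume (P i ∩ P j) = 0) :
    LinearIndependent ℝ fun i => T.lengthsOf (P i) := by
  classical
  rw [linearIndependent_iff']
  intro s c hc i hi
  set d : ι → ℝ := fun j => c j / volume.real (P j) with hdef
  suffices hdi : d i = 0 by
    exact (div_eq_zero_iff.1 hdi).resolve_right (hP i).pos.ne'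
  set g : ℝ → ℝ := fun x => ∑ j ∈ s, d j * cdf (P j) x with hgdef
  have hgsub : ∀ x y, g y - g x = ∑ j ∈ s, d j * (cdf (P j) y - cdf (P j) x) := by
    intro x y
    simp only [hgdef, mul_sub, Finset.sum_sub_distrib]
  have hg : T.IsSlopeFun g := by
    intro α x hx y hy
    rw [hgsub, hgsub, Finset.mul_sum]
    refine Finset.sum_congr rfl fun j _ => ?_
    rw [(hP j).inv.isSlopeFun α x hx y hy]
    ring
  have hg0 : g 0 = 0 := by simp [hgdef, cdf_zero]
  have hcont : ContinuousOn g (Icc 0 T.total) :=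
    continuousOn_finsetSum _ fun j _ =>
      continuousOn_const.mul ((continuousOn_cdf (hP j).inv.1).mono Icc_subset_Ici_self)
  have hm : ∀ α, T.mass g .top α = 0 := by
    intro α
    have := congrFun hc α
    rw [Finset.sum_apply] at this
    rw [mass, hgsub, ← Pi.zero_apply (M := fun _ : A => ℝ) α, ← this]
    refine Finset.sum_congr rfl fun j _ => ?_
    have h1 := mass_cdf (T := T) (hP j).inv.1 .top α
    unfold mass at h1
    rw [h1, Pi.smul_apply, smul_eq_mul, lengthsOf, hdef]
    ring
  have hzero := hg.eq_zero_of_mass_eq_zero hcont hg0 hm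
  have hKsub := T.closure_singularOrbits_subset
  rcases (hP i).kind with ⟨G, hG⟩ | hK
  · have h1 : g G.1.2 - g G.1.1 = 0 := by
      rw [hzero _ G.2.right_mem, hzero _ G.2.left_mem, sub_zero]
    rw [hgsub, Finset.sum_eq_single_of_mem i hi] at h1
    · refine (mul_eq_zero.1 h1).resolve_right ?_
      have hset : G.orbit ∩ Ioo G.1.1 G.1.2 = Ioo G.1.1 G.1.2 :=
        inter_eq_right.2 G.set_subset_orbit
      rw [cdf_sub (hP i).inv.1 (hKsub G.2.left_mem).1 G.2.lt.le, hG, hset,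
        Real.volume_real_Ioo_of_le G.2.lt.le]
      exact (sub_pos.2 G.2.lt).ne'
    · intro j _ hj
      rw [cdf_sub (hP j).inv.1 (hKsub G.2.left_mem).1 G.2.lt.le, measureReal_def,
        measure_mono_null _ (hd j i hj), ENNReal.toReal_zero, mul_zero]
      rw [hG]
      exact inter_subset_inter_right _ G.set_subset_orbit
  · set f : ℝ → ℝ := fun x => ∑ j ∈ s, d j * (P j).indicator (fun _ => (1 : ℝ)) x with hfdef
    have hloc : ∀ j, LocallyIntegrable ((P j).indicator fun _ => (1 : ℝ)) volume := fun j =>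
      (locallyIntegrable_const (1 : ℝ)).indicator (hP j).inv.1
    have hint : ∀ j a b, IntervalIntegrable ((P j).indicator fun _ => (1 : ℝ)) volume a b :=
      fun j a b => intervalIntegrable_iff.2
        (((hloc j).integrableOn_isCompact isCompact_uIcc).mono_set uIoc_subset_uIcc)
    have hf : LocallyIntegrable f volume := by
      refine locallyIntegrable_finsetSum s fun j _ => ?_
      exact (hloc j).smul (d j)
    have hfi : ∀ x ∈ closure T.singularOrbits, ∫ t in (0 : ℝ)..x, f t = 0 := by
      intro x hx
      refine Eq.trans ?_ (hzero x hx)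
      rw [intervalIntegral.integral_finsetSum fun j _ => (hint j 0 x).const_mul (d j)]
      refine Finset.sum_congr rfl fun j _ => ?_
      rw [intervalIntegral.integral_const_mul,
        integral_indicator_one_eq_cdf (hP j).inv.1 (hKsub hx).1]
    have hae : ∀ᵐ x, x ∈ P i → d i = 0 := by
      have hdis : ∀ᵐ x, ∀ j ∈ s, j ≠ i → x ∉ P i ∩ P j := by
        rw [Filter.eventually_all_finset]
        intro j _
        by_cases hj : j = i
        · exact Filter.Eventually.of_forall fun x h => absurd hj h
        · filter_upwards [compl_mem_ae_iff.2 (hd i j (Ne.symm hj))] with x hx _ using hx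
      filter_upwards [ae_eq_zero_of_integral_eq_zero hf hfi, hdis] with x hx hx' hxi
      have := hx (hK hxi)
      rw [hfdef] at this
      simp only at this
      rwa [Finset.sum_eq_single_of_mem i hi, indicator_of_mem hxi, mul_one] at this
      intro j hj hji
      rw [indicator_of_notMem fun hxj => hx' j hj hji ⟨hxi, hxj⟩, mul_zero]
    by_contra hne
    apply (hP i).ne_zero
    rw [measure_eq_zero_iff_ae_notMem]
    filter_upwards [hae] with x hx hxi using hne (hx hxi)

/-- Without atoms `R` could be shrunk forever. The successive differences would be infinitely many
disjoint pieces, against linear independence in a finite-dimensional space. -/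
theorem exists_isInvariantAtom {R : Set ℝ} (hR : T.IsInvariantModZero R)
    (hsub : R ⊆ closure T.singularOrbits) (h0 : volume R ≠ 0) :
    ∃ P ⊆ R, T.IsInvariantAtom P := by
  by_contra! hc
  let X := {P : Set ℝ // P ⊆ R ∧ T.IsInvariantModZero P ∧ volume P ≠ 0}
  have hsplit : ∀ P : X, ∃ Q : X, Q.1 ⊆ P.1 ∧ volume (P.1 \ Q.1) ≠ 0 := by
    rintro ⟨P, hPR, hP, hP0⟩
    have := hc P hPR
    unfold IsInvariantAtom at this
    push Not at this
    obtain ⟨Q, hQP, hQ, h1, h2⟩ := this (hPR.trans hsub) hP hP0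
    exact ⟨⟨Q, hQP.trans hPR, hQ, h1⟩, hQP, h2⟩
  choose f hf1 hf2 using hsplit
  let Q : ℕ → X := fun n => Nat.rec ⟨R, Subset.rfl, hR, h0⟩ (fun _ P => f P) n
  have hQs : ∀ n, Q (n + 1) = f (Q n) := fun n => rfl
  have hanti : Antitone fun n => (Q n).1 :=
    antitone_nat_of_succ_le fun n => by rw [hQs]; exact hf1 _
  have hpiece : ∀ n, T.IsPiece ((Q n).1 \ (Q (n + 1)).1) := by
    intro n
    refine isPiece_of_subset ((Q n).2.2.1.diff (Q (n + 1)).2.2.1)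
      (sdiff_subset.trans ((Q n).2.1.trans hsub)) ?_
    rw [hQs]
    exact hf2 _
  have hdis : ∀ m n, m < n →
      ((Q m).1 \ (Q (m + 1)).1) ∩ ((Q n).1 \ (Q (n + 1)).1) = ∅ := by
    intro m n hmn
    refine eq_empty_of_forall_notMem fun x hx => hx.1.2 ?_
    exact hanti (Nat.succ_le_of_lt hmn) hx.2.1
  have hli := linearIndependent_lengthsOf hpiece (fun m n hmn => by
    rcases lt_or_gt_of_ne hmn with h | h
    · rw [hdis m n h, measure_empty]
    · rw [inter_comm, hdis n m h, measure_empty])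
  exact not_finite_iff_infinite.2 inferInstance (hli.finite_of_isNoetherian)

end Pieces

/-! ### Partial semiconjugacies and their lifts through a step. -/

section PartialConj

variable {A : Type*} [Fintype A]

/-- The increments of `h` on the subintervals of `[0, L]` are nonnegative, and at most `C` times the
length. -/
def MonoLip (L C : ℝ) (h : ℝ → ℝ) : Prop :=
  ∀ x y, 0 ≤ x → x ≤ y → y ≤ L → 0 ≤ h y - h x ∧ h y - h x ≤ C * (y - x)

theorem MonoLip.lipschitzOnWith {L C : ℝ} {h : ℝ → ℝ} (hh : MonoLip L C h) :
    LipschitzOnWith (Real.toNNReal C) h (Icc 0 L) := by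
  have key : ∀ x ∈ Icc 0 L, ∀ y ∈ Icc 0 L, x ≤ y →
      |h y - h x| ≤ Real.toNNReal C * |y - x| := by
    intro x hx y hy hxy
    obtain ⟨h1, h2⟩ := hh x y hx.1 hxy hy.2
    rw [abs_of_nonneg h1, abs_of_nonneg (sub_nonneg.2 hxy)]
    exact h2.trans (mul_le_mul_of_nonneg_right (Real.le_coe_toNNReal C) (sub_nonneg.2 hxy))
  refine LipschitzOnWith.of_dist_le_mul fun x hx y hy => ?_
  rw [Real.dist_eq, Real.dist_eq]
  rcases le_total x y with hxy | hxy
  · rw [abs_sub_comm, abs_sub_comm x]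
    exact key x hx y hy hxy
  · exact key y hy x hx hxy

theorem MonoLip.continuousOn {L C : ℝ} {h : ℝ → ℝ} (hh : MonoLip L C h) :
    ContinuousOn h (Icc 0 L) := hh.lipschitzOnWith.continuousOn

theorem monoLip_trans {C x y z : ℝ} {h : ℝ → ℝ} (h1 : 0 ≤ h y - h x ∧ h y - h x ≤ C * (y - x))
    (h2 : 0 ≤ h z - h y ∧ h z - h y ≤ C * (z - y)) :
    0 ≤ h z - h x ∧ h z - h x ≤ C * (z - x) := by
  constructor
  · linarith
  · nlinarith

/-- `h` respects the top partitions of `T` and `U`, and conjugates `T` to `U` at the points whose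
image by `T` is in `G`. -/
structure PartialConj (T U : AffineIEM A) (C : ℝ) (G : Set ℝ) (h : ℝ → ℝ) : Prop where
  monoLip : MonoLip T.total C h
  zero : h 0 = 0
  total : h T.total = U.total
  left : ∀ α, h (T.left .top α) = U.left .top α
  conj : ∀ α, ∀ x ∈ T.cl .top α, T.br .top α x ∈ G → h (T.br .top α x) = U.br .top α (h x)

theorem PartialConj.right {T U : AffineIEM A} {C : ℝ} {G : Set ℝ} {h : ℝ → ℝ}
    (hc : PartialConj T U C G h) (hTU : T.comb = U.comb) (α : A) :
    h (T.left .top α + T.len .top α) = U.left .top α + U.len .top α := by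
  rw [T.right_eq_cut, U.right_eq_cut, ← hTU]
  by_cases hα : (T.comb.pos .top α : ℕ) + 1 < Fintype.card A
  · have h1 := hc.left ((T.comb.pos .top).symm ⟨_, hα⟩)
    rw [left_eq_cut, left_eq_cut, ← hTU, Equiv.apply_symm_apply] at h1
    exact h1
  · have : (T.comb.pos .top α : ℕ) + 1 = Fintype.card A := by
      have := (T.comb.pos .top α).2
      omega
    rw [this, cut_card, cut_card]
    exact hc.total

/-- The map affine on each top interval works; the conjugacy condition is void, as no image lies
beyond `T.total`. -/
theorem exists_partialConj {T U : AffineIEM A} (hTU : T.comb = U.comb) {C : ℝ}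
    (hC : ∀ α, U.len .top α ≤ C * T.len .top α) :
    ∃ h, PartialConj T U C (Ioi T.total) h := by
  set ρ : A → ℝ := fun α => U.len .top α / T.len .top α with hρ
  have hρ0 : ∀ α, 0 ≤ ρ α := fun α => (div_pos (U.len_pos _ _) (T.len_pos _ _)).le
  have hρC : ∀ α, ρ α ≤ C := fun α => (div_le_iff₀ (T.len_pos _ _)).2 (hC α)
  have hρlen : ∀ α, ρ α * T.len .top α = U.len .top α := fun α =>
    div_mul_cancel₀ _ (T.len_pos _ _).ne'
  -- The length of the part of the interval of `α` to the left of `x`.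
  set c : A → ℝ → ℝ := fun α x => min x (T.left .top α + T.len .top α) - min x (T.left .top α)
    with hcdef
  have hcsum : ∀ x, 0 ≤ x → x ≤ T.total → ∑ α, c α x = x := by
    intro x h0 h1
    have := T.sum_increments .top fun y => min x y
    rw [min_eq_left h1, min_eq_right h0, sub_zero] at this
    exact this
  have hcmono : ∀ α x y, x ≤ y → 0 ≤ c α y - c α x := by
    intro α x y hxy
    have := T.len_pos .top α
    simp only [hcdef, min_def]
    split_ifs <;> linarith
  refine ⟨fun x => ∑ α, ρ α * c α x, ?_, ?_, ?_, ?_, ?_⟩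
  · intro x y h0 hxy h1
    have hsub : ∑ α, ρ α * c α y - ∑ α, ρ α * c α x = ∑ α, ρ α * (c α y - c α x) := by
      simp only [mul_sub, Finset.sum_sub_distrib]
    rw [hsub]
    constructor
    · exact Finset.sum_nonneg fun α _ => mul_nonneg (hρ0 α) (hcmono α x y hxy)
    · calc ∑ α, ρ α * (c α y - c α x) ≤ ∑ α, C * (c α y - c α x) :=
            Finset.sum_le_sum fun α _ =>
              mul_le_mul_of_nonneg_right (hρC α) (hcmono α x y hxy)
        _ = C * (y - x) := by
            rw [← Finset.mul_sum, Finset.sum_sub_distrib, hcsum y (h0.trans hxy) h1,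
              hcsum x h0 (hxy.trans h1)]
  · refine Finset.sum_eq_zero fun α _ => ?_
    have h1 := T.left_nonneg .top α
    have h2 := T.len_pos .top α
    simp only [hcdef]
    rw [min_eq_left h1, min_eq_left (by linarith), sub_self, mul_zero]
  · refine Finset.sum_congr rfl fun α _ => ?_
    have h1 := T.right_le_total .top α
    have h2 := T.len_pos .top α
    simp only [hcdef]
    rw [min_eq_right h1, min_eq_right (by linarith), add_sub_cancel_left, hρlen]
  · intro α
    have hUl : U.left .top α =
        ∑ β, if T.comb.pos .top β < T.comb.pos .top α then U.len .top β else 0 := by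
      rw [left, ← hTU, Finset.sum_filter]
    rw [hUl]
    refine Finset.sum_congr rfl fun β _ => ?_
    simp only [hcdef]
    split_ifs with hβ
    · have h1 := T.right_le_left hβ
      have h2 := T.len_pos .top β
      rw [min_eq_right h1, min_eq_right (by linarith), add_sub_cancel_left, hρlen]
    · rw [← T.left_lt_left_iff, not_lt] at hβ
      rw [min_eq_left hβ, min_eq_left (by linarith [T.len_pos .top β]), sub_self, mul_zero]
  · intro α x hx hG
    exact absurd (T.cl_subset _ _ (T.br_mem_cl hx)).2 (not_le.2 hG)

/-- Keep `h` on the smaller domain and transport it to the removed end by the branch `β`. The slopes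
of `T` and `U` agree, so the constant `C` is unchanged, and the lift can be repeated without loss.
-/
theorem PartialConj.lift {T T' U U' : AffineIEM A} {b β β' : A}
    (hT : Induces T T' .top b β β') (hU : Induces U U' .top b β β') (hTU' : T'.comb = U'.comb)
    (hslope : ∀ α, T.slope .top α = U.slope .top α)
    (hleft : ∀ α, (T'.left .top α = T.left .top α ∧ U'.left .top α = U.left .top α) ∨
      (T.left .top α = T'.total ∧ U.left .top α = U'.total))
    {C : ℝ} {G : Set ℝ} {h : ℝ → ℝ} (hc : PartialConj T' U' C G h) :
    ∃ k, PartialConj T U C G k := by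
  classical
  set F : ℝ → ℝ := fun x => U.br .top β (h (T.br .bot β x)) with hF
  have hbb : ∀ x, T.br .bot β (T.br .top β x) = x := T.br_other_br .top β
  have hbb' : ∀ x, T.br .top β (T.br .bot β x) = x := T.br_other_br .bot β
  have hFL' : F T'.total = U'.total := by
    rw [hF]
    simp only
    rw [← hT.br_left_loser, hbb, hc.left, hU.br_left_loser]
  have hFL : F T.total = U.total := by
    rw [hF]
    simp only
    rw [← hT.br_right_loser, hbb, hc.right hTU', hU.br_right_loser]
  set k : ℝ → ℝ := fun x => if x ≤ T'.total then h x else F x with hk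
  have hk1 : ∀ x, x ≤ T'.total → k x = h x := fun x hx => if_pos hx
  have hk2 : ∀ x, T'.total ≤ x → k x = F x := by
    intro x hx
    rcases hx.eq_or_lt with rfl | hx
    · rw [hk1 _ le_rfl, hc.total, hFL']
    · exact if_neg (not_le.2 hx)
  have htotpos : 0 ≤ T'.total := Finset.sum_nonneg fun α _ => (T'.len_pos _ α).le
  have hback : ∀ x ∈ Icc T'.total T.total, T.br .bot β x ∈ T'.cl .top b := fun x hx =>
    hT.br_other_mem_cl hx
  refine ⟨k, ?_, ?_, ?_, ?_, ?_⟩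
  · have hlow : ∀ x y, 0 ≤ x → x ≤ y → y ≤ T'.total →
        0 ≤ k y - k x ∧ k y - k x ≤ C * (y - x) := by
      intro x y h0 hxy hy
      rw [hk1 y hy, hk1 x (hxy.trans hy)]
      exact hc.monoLip x y h0 hxy hy
    have hhigh : ∀ x y, T'.total ≤ x → x ≤ y → y ≤ T.total →
        0 ≤ k y - k x ∧ k y - k x ≤ C * (y - x) := by
      intro x y hx hxy hy
      rw [hk2 y (hx.trans hxy), hk2 x hx]
      have mx := T'.cl_subset _ _ (hback x ⟨hx, hxy.trans hy⟩)
      have my := T'.cl_subset _ _ (hback y ⟨hx.trans hxy, hy⟩)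
      obtain ⟨h1, h2⟩ := hc.monoLip _ _ mx.1 ((T.br_strictMono .bot β).monotone hxy) my.2
      have hs := U.slope_pos .top β
      rw [hF]
      simp only
      rw [U.br_sub_br]
      refine ⟨mul_nonneg hs.le h1, ?_⟩
      have h3 := mul_le_mul_of_nonneg_left h2 hs.le
      rw [T.br_sub_br, ← hslope] at h3
      have h4 : T.slope .top β * (C * (T.slope .bot β * (y - x))) = C * (y - x) := by
        have := T.slope_other_mul_slope .top β
        rw [Side.other_top] at this
        linear_combination (C * (y - x)) * this
      rw [h4] at h3
      rw [← hslope]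
      exact h3
    intro x y h0 hxy hy
    rcases le_total y T'.total with h1 | h1
    · exact hlow x y h0 hxy h1
    · rcases le_total x T'.total with h2 | h2
      · exact monoLip_trans (hlow x _ h0 h2 le_rfl) (hhigh _ y le_rfl h1 hy)
      · exact hhigh x y h2 hxy hy
  · rw [hk1 0 htotpos, hc.zero]
  · rw [hk2 _ hT.total_lt.le, hFL]
  · intro α
    rcases hleft α with ⟨h1, h2⟩ | ⟨h1, h2⟩
    · rw [← h1, ← h2, hk1 _ (T'.cl_subset _ _ (T'.left_mem_cl .top α)).2, hc.left]
    · rw [h1, h2, hk1 _ le_rfl, hc.total]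
  · intro α x hx hG
    -- On the unchanged branches the condition is inherited; on the first branch of the loser's
    -- return it is the definition of `F`; on the second it is the conjugacy of the induced maps
    -- with the first branch cancelled.
    rcases hT.cover α x hx with ⟨hα, hx'⟩ | ⟨rfl, hx'⟩ | ⟨rfl, hx'⟩
    · have hb := T'.cl_subset _ _ (T'.br_mem_cl hx')
      rw [hT.br_ne α hα] at hb
      rw [hk1 _ hb.2, hk1 x (T'.cl_subset _ _ hx').2, ← hT.br_ne α hα, ← hU.br_ne α hα]
      exact hc.conj α x hx' (by rwa [hT.br_ne α hα])
    · rw [hk2 _ (hT.br_mem_Icc hx').1, hk1 x (T'.cl_subset _ _ hx').2, hF]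
      simp only
      rw [hbb]
    · have hy := hback x hx'
      have h1 : T'.br .top b (T.br .bot β x) = T.br .top α x := by rw [hT.br_loser, hbb']
      have h2 := (T'.cl_subset _ _ (T'.br_mem_cl hy)).2
      rw [h1] at h2
      have h3 := hc.conj b _ hy (by rwa [h1])
      rw [h1, hU.br_loser] at h3
      rw [hk1 _ h2, h3, hk2 x hx'.1]

/-- Pointwise limits are taken along one ultrafilter. Every condition is closed, and as `G`
increases, the conjugacy at a given point holds from some index on. -/
theorem PartialConj.exists_limit {T U : AffineIEM A} {C : ℝ} {G : ℕ → Set ℝ} {h : ℕ → ℝ → ℝ}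
    (hc : ∀ n, PartialConj T U C (G n) (h n)) (hG : Monotone G) :
    ∃ k, PartialConj T U C (⋃ n, G n) k := by
  have htot : 0 ≤ T.total := Finset.sum_nonneg fun α _ => (T.len_pos _ α).le
  have hex : ∀ x, ∃ y, x ∈ Icc 0 T.total →
      Filter.Tendsto (fun n => h n x) (Filter.hyperfilter ℕ : Filter ℕ) (nhds y) := by
    intro x
    by_cases hx : x ∈ Icc 0 T.total
    · have hmem : ∀ n, h n x ∈ Icc 0 U.total := by
        intro n
        have h1 := ((hc n).monoLip 0 x le_rfl hx.1 hx.2).1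
        have h2 := ((hc n).monoLip x _ hx.1 hx.2 le_rfl).1
        rw [(hc n).zero] at h1
        rw [(hc n).total] at h2
        exact ⟨by linarith, by linarith⟩
      obtain ⟨y, -, hy⟩ := (isCompact_Icc (a := (0 : ℝ)) (b := U.total)).ultrafilter_le_nhds'
        ((Filter.hyperfilter ℕ).map fun n => h n x)
        (Filter.mem_map.2 (Filter.Eventually.of_forall hmem))
      exact ⟨y, fun _ => hy⟩
    · exact ⟨0, fun h => absurd h hx⟩
  choose k hk using hex
  refine ⟨k, ?_, ?_, ?_, ?_, ?_⟩
  · intro x y h0 hxy hy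
    have ht := (hk y ⟨h0.trans hxy, hy⟩).sub (hk x ⟨h0, hxy.trans hy⟩)
    exact ⟨ge_of_tendsto ht (Filter.Eventually.of_forall fun n =>
        ((hc n).monoLip x y h0 hxy hy).1),
      le_of_tendsto ht (Filter.Eventually.of_forall fun n => ((hc n).monoLip x y h0 hxy hy).2)⟩
  · refine tendsto_nhds_unique (hk 0 ⟨le_rfl, htot⟩) ?_
    simp only [(hc _).zero]
    exact tendsto_const_nhds
  · refine tendsto_nhds_unique (hk _ ⟨htot, le_rfl⟩) ?_
    simp only [(hc _).total]
    exact tendsto_const_nhds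
  · intro α
    refine tendsto_nhds_unique (hk _ (T.cl_subset _ _ (T.left_mem_cl _ _))) ?_
    simp only [(hc _).left]
    exact tendsto_const_nhds
  · intro α x hx hxG
    obtain ⟨N, hN⟩ := mem_iUnion.1 hxG
    have h1 := hk _ (T.cl_subset _ _ (T.br_mem_cl hx))
    have h2 := ((U.continuous_br .top α).tendsto _).comp (hk x (T.cl_subset _ _ hx))
    refine tendsto_nhds_unique_of_eventuallyEq h1 h2 ?_
    have hev : ∀ᶠ n in (Filter.hyperfilter ℕ : Filter ℕ), N ≤ n :=
      Nat.hyperfilter_le_atTop (Filter.eventually_ge_atTop N)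
    filter_upwards [hev] with n hn
    exact (hc n).conj α x hx (hG hn hN)

theorem left_eq_zero_iff_of_comb_eq {T U : AffineIEM A} (hTU : T.comb = U.comb) (r : Side) (α : A) :
    T.left r α = 0 → U.left r α = 0 := by
  intro h
  rw [left, hTU, Finset.sum_eq_zero_iff_of_nonneg fun β _ => (T.len_pos _ _).le] at h
  rw [left]
  refine Finset.sum_eq_zero fun β hβ => ?_
  exact absurd (h β hβ) (T.len_pos _ _).ne'

end PartialConj

end AffineIEM

/-! ### The limit semiconjugacy on the closure of the singular orbits. -/

section Limit

variable {A : Type*} [Fintype A] [Nontrivial A] {γ : RauzyPath A} {w : A → ℝ}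
  {T U : AffineIEM A} {S V : ℕ → AffineIEM A}

open AffineIEM

/-- Lift the affine map of level `m + k` through `k` steps; conjugacy can then fail only where the
image lies in the domain of level `m + k`. -/
theorem IsLevels.exists_partialConj (hS : IsLevels γ w T S) (hV : IsLevels γ w U V) {C : ℝ}
    (hC : ∀ n α, (V n).len .top α ≤ C * (S n).len .top α) (k m : ℕ) :
    ∃ h, PartialConj (S m) (V m) C (Ioi (S (m + k)).total) h := by
  have hcomb : ∀ n, (S n).comb = (V n).comb := fun n => (hS.comb n).trans (hV.comb n).symm
  induction k generalizing m with
  | zero => exact AffineIEM.exists_partialConj (hcomb m) (hC m)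
  | succ k ih =>
    obtain ⟨h, hh⟩ := ih (m + 1)
    rw [show m + 1 + k = m + (k + 1) by omega] at hh
    have hs := hS.step m
    have hv := hV.step m
    have hslope : ∀ α, (S m).slope .top α = (V m).slope .top α := fun α => by
      rw [hS.slope, hV.slope]
    cases ht : γ.type m
    · rw [ht] at hs hv
      have h1 := hs.induces_same
      have h2 := hv.induces_same
      rw [← hcomb m] at h2
      exact hh.lift h1 h2 (hcomb _) hslope fun α => Or.inl ⟨hs.left_same α, hv.left_same α⟩
    · rw [ht] at hs hv
      have h1 := hs.induces_other
      have h2 := hv.induces_other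
      have h3 := fun α => hv.left_other (α := α)
      have h4 := hv.br_loser_total
      rw [br_left] at h4
      rw [← hcomb m] at h2 h3 h4
      refine hh.lift h1 h2 (hcomb _) hslope fun α => ?_
      -- For the bottom type the loser is last on top, and its left endpoint is the cut point.
      by_cases hα : α = (S m).comb.last .top
      · right
        rw [hα]
        have h5 := hs.br_loser_total
        rw [br_left] at h5
        exact ⟨h5, h4⟩
      · left
        exact ⟨hs.left_other hα, h3 α hα⟩

theorem IsLevels.exists_limitConj (hS : IsLevels γ w T S) (hV : IsLevels γ w U V) {C : ℝ}
    (hC : ∀ n α, (V n).len .top α ≤ C * (S n).len .top α) :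
    ∃ h, PartialConj T U C (⋃ n, Ioi (S n).total) h := by
  have h := fun n => hS.exists_partialConj hV hC n 0
  simp only [hS.zero, hV.zero, zero_add] at h
  choose h hh using h
  exact PartialConj.exists_limit hh fun m n hmn =>
    Ioi_subset_Ioi (hS.total_strictAnti.antitone hmn)

/-- The images left out by `hh` are the points above none of the totals. By `notMem_singularOrbits`
the only such point in the singular orbits is `0`, where left endpoints correspond; continuity
extends the relation to the closure. -/
theorem IsLevels.conj_of_mem_closure (hS : IsLevels γ w T S) (hγ : γ.InfComplete)
    (hTU : T.comb = U.comb) {C : ℝ} {h : ℝ → ℝ}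
    (hh : PartialConj T U C (⋃ n, Ioi (S n).total) h) {α : A} {x : ℝ} (hx : x ∈ T.cl .top α)
    (hxK : x ∈ closure T.singularOrbits) : h (T.br .top α x) = U.br .top α (h x) := by
  have hZ : ∀ x ∈ T.cl .top α ∩ T.singularOrbits, h (T.br .top α x) = U.br .top α (h x) := by
    rintro x ⟨hx, hxZ⟩
    have hyZ := T.stable_singularOrbits.br_mem_of_mem_cl hx hxZ
    have hycl := T.br_mem_cl hx
    by_cases hy : T.br .top α x ∈ ⋃ n, Ioi (S n).total
    · exact hh.conj α x hx hy
    · rcases (T.cl_subset _ _ hycl).1.eq_or_lt with h0 | h0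
      · have hl : T.left .bot α = 0 :=
          le_antisymm (h0 ▸ hycl.1) (T.left_nonneg _ _)
        have hx0 : x = T.left .top α := by
          apply (T.br_strictMono .top α).injective
          rw [← h0, br_left, Side.other_top, hl]
        rw [hx0, hh.left, br_left, br_left, Side.other_top, hl, hh.zero,
          left_eq_zero_iff_of_comb_eq hTU .bot α hl]
      · exfalso
        simp only [mem_iUnion, mem_Ioi, not_exists, not_lt] at hy
        refine hS.notMem_singularOrbits hγ h0 (fun n => ?_) hyZ
        exact (hy (n + 1)).trans_lt (hS.total_strictAnti n.lt_succ_self)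
  have hcont := hh.monoLip.continuousOn
  have hcont1 : ContinuousOn (fun x => h (T.br .top α x)) (T.cl .top α) :=
    hcont.comp (T.continuous_br _ _).continuousOn fun y hy => T.cl_subset _ _ (T.br_mem_cl hy)
  have hcont2 : ContinuousOn (fun x => U.br .top α (h x)) (T.cl .top α) :=
    (U.continuous_br _ _).comp_continuousOn (hcont.mono (T.cl_subset _ _))
  have hclosed : IsClosed (T.cl .top α ∩
      (fun x => h (T.br .top α x) - U.br .top α (h x)) ⁻¹' {0}) :=
    (hcont1.sub hcont2).preimage_isClosed_of_isClosed isClosed_Icc isClosed_singleton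
  have hsub : T.cl .top α ∩ T.singularOrbits ⊆ T.cl .top α ∩
      (fun x => h (T.br .top α x) - U.br .top α (h x)) ⁻¹' {0} :=
    fun y hy => ⟨hy.1, sub_eq_zero.2 (hZ y hy)⟩
  have hmem := closure_minimal hsub hclosed
    (T.stable_singularOrbits.mem_closure_inter_cl hx hxK)
  exact sub_eq_zero.1 hmem.2

end Limit

/-! ### Affine interpolation in the gaps. -/

section Linearize

open Classical in
/-- The function which coincides with `H` outside the gaps of `K`, and is affine on the gaps. -/
def linearize (K : Set ℝ) (H : ℝ → ℝ) (x : ℝ) : ℝ :=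
  if h : ∃ g : ℝ × ℝ, IsGap K g.1 g.2 ∧ x ∈ Ioo g.1 g.2 then
    H h.choose.1 + (H h.choose.2 - H h.choose.1) / (h.choose.2 - h.choose.1) * (x - h.choose.1)
  else H x

variable {K : Set ℝ} {H : ℝ → ℝ}

theorem linearize_of_mem {x : ℝ} (hx : x ∈ K) : linearize K H x = H x :=
  dif_neg fun ⟨_, hg, hxg⟩ => hg.notMem x hxg hx

theorem linearize_of_isGap {p q x : ℝ} (hg : IsGap K p q) (hx : x ∈ Icc p q) :
    linearize K H x = H p + (H q - H p) / (q - p) * (x - p) := by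
  rcases hx.1.eq_or_lt with rfl | h1
  · rw [linearize_of_mem hg.left_mem]
    ring
  rcases hx.2.eq_or_lt with rfl | h2
  · rw [linearize_of_mem hg.right_mem, div_mul_cancel₀ _ (sub_pos.2 h1).ne']
    ring
  have h : ∃ g : ℝ × ℝ, IsGap K g.1 g.2 ∧ x ∈ Ioo g.1 g.2 := ⟨(p, q), hg, h1, h2⟩
  obtain ⟨e1, e2⟩ := h.choose_spec.1.eq_of_mem hg h.choose_spec.2 ⟨h1, h2⟩
  rw [linearize, dif_pos h, e1, e2]

theorem deriv_linearize {p q x : ℝ} (hg : IsGap K p q) (hx : x ∈ Ioo p q) :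
    deriv (linearize K H) x = (H q - H p) / (q - p) := by
  have h1 : linearize K H =ᶠ[nhds x] fun x => H p + (H q - H p) / (q - p) * (x - p) := by
    filter_upwards [isOpen_Ioo.mem_nhds hx] with y hy
    exact linearize_of_isGap hg (Ioo_subset_Icc_self hy)
  rw [h1.deriv_eq]
  simp

theorem monoLip_linearize (hK : IsClosed K) {L C : ℝ} (h0 : 0 ∈ K) (hL : L ∈ K)
    (hsub : K ⊆ Icc 0 L) (hH : AffineIEM.MonoLip L C H) :
    AffineIEM.MonoLip L C (linearize K H) := by
  have hgap : ∀ p q, IsGap K p q → ∀ x y, p ≤ x → x ≤ y → y ≤ q →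
      0 ≤ linearize K H y - linearize K H x ∧
        linearize K H y - linearize K H x ≤ C * (y - x) := by
    intro p q hg x y hx hxy hy
    rw [linearize_of_isGap hg ⟨hx, hxy.trans hy⟩, linearize_of_isGap hg ⟨hx.trans hxy, hy⟩]
    obtain ⟨h1, h2⟩ := hH p q (hsub hg.left_mem).1 hg.lt.le (hsub hg.right_mem).2
    have hpq := sub_pos.2 hg.lt
    have h3 : 0 ≤ (H q - H p) / (q - p) := div_nonneg h1 hpq.le
    have h4 : (H q - H p) / (q - p) ≤ C := (div_le_iff₀ hpq).2 h2
    have h5 := mul_nonneg h3 (sub_nonneg.2 hxy)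
    have h6 := mul_le_mul_of_nonneg_right h4 (sub_nonneg.2 hxy)
    constructor <;> nlinarith
  have hmem : ∀ x ∈ K, ∀ y, x ≤ y → y ≤ L → 0 ≤ linearize K H y - linearize K H x ∧
        linearize K H y - linearize K H x ≤ C * (y - x) := by
    intro x hx y hxy hy
    have hKK : ∀ y ∈ K, x ≤ y → 0 ≤ linearize K H y - linearize K H x ∧
        linearize K H y - linearize K H x ≤ C * (y - x) := by
      intro y hyK hxy
      rw [linearize_of_mem hx, linearize_of_mem hyK]
      exact hH x y (hsub hx).1 hxy (hsub hyK).2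
    by_cases hyK : y ∈ K
    · exact hKK y hyK hxy
    · obtain ⟨p, q, hg, hyg⟩ := exists_isGap hK h0 hL ⟨(hsub hx).1.trans hxy, hy⟩ hyK
      have hxp : x ≤ p := not_lt.1 fun h => hg.notMem x ⟨h, hxy.trans_lt hyg.2⟩ hx
      exact AffineIEM.monoLip_trans (hKK p hg.left_mem hxp)
        (hgap p q hg p y le_rfl hyg.1.le hyg.2.le)
  intro x y hx hxy hy
  by_cases hxK : x ∈ K
  · exact hmem x hxK y hxy hy
  · obtain ⟨p, q, hg, hxg⟩ := exists_isGap hK h0 hL ⟨hx, hxy.trans hy⟩ hxK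
    rcases le_total y q with hyq | hyq
    · exact hgap p q hg x y hxg.1.le hxy hyq
    · exact AffineIEM.monoLip_trans (hgap p q hg x q hxg.1.le hxg.2.le le_rfl)
        (hmem q hg.right_mem y hyq hy)

end Linearize

/-! ### A Lipschitz semiconjugacy on the whole interval. -/

section LinearConj

variable {A : Type*} [Fintype A] [Nontrivial A] {γ : RauzyPath A} {w : A → ℝ}
  {T U : AffineIEM A} {S V : ℕ → AffineIEM A}

open AffineIEM

theorem AffineIEM.zero_mem_closure (T : AffineIEM A) : 0 ∈ closure T.singularOrbits := by
  obtain ⟨α, hα⟩ := T.exists_left_eq_zero .top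
  exact hα ▸ T.stable_closure.left_mem .top α

/-- The limit is controlled only at the ends of the gaps. Branches send gaps to gaps, with the same
slope for `T` and `U`, so interpolating the end values affinely restores the conjugacy and makes the
derivative constant on each gap. -/
theorem IsLevels.exists_linearConj (hS : IsLevels γ w T S) (hV : IsLevels γ w U V)
    (hγ : γ.InfComplete) {C : ℝ} (hC : ∀ n α, (V n).len .top α ≤ C * (S n).len .top α) :
    ∃ h, PartialConj T U C univ h ∧
      ∀ G : T.Gap, ∃ c, ∀ x ∈ G.set, deriv h x = c := by
  obtain ⟨H, hH⟩ := hS.exists_limitConj hV hC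
  have hTU : T.comb = U.comb := by rw [← hS.zero, ← hV.zero, hS.comb, hV.comb]
  have hslope : ∀ α, T.slope .top α = U.slope .top α := fun α => by
    rw [← hS.zero, ← hV.zero, hS.slope, hV.slope]
  have hst := T.stable_closure
  set K := closure T.singularOrbits with hK
  have h0 := T.zero_mem_closure
  have hmono := monoLip_linearize isClosed_closure h0 hst.total_mem
    T.closure_singularOrbits_subset hH.monoLip
  refine ⟨linearize K H, ⟨hmono, ?_, ?_, ?_, ?_⟩, ?_⟩
  · rw [linearize_of_mem h0, hH.zero]
  · rw [linearize_of_mem hst.total_mem, hH.total]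
  · intro α
    rw [linearize_of_mem (hst.left_mem _ _), hH.left]
  · intro α x hx _
    by_cases hxK : x ∈ K
    · rw [linearize_of_mem hxK, linearize_of_mem (hst.br_mem_of_mem_cl hx hxK)]
      exact hS.conj_of_mem_closure hγ hTU hH hx hxK
    · obtain ⟨p, q, hg, hxg⟩ := exists_isGap isClosed_closure h0 hst.total_mem
        (T.cl_subset _ _ hx) hxK
      obtain ⟨β, hβ⟩ := hst.exists_gap_subset T.closure_singularOrbits_subset hg .top
      have hxI : x ∈ T.interval .top α := by
        rcases T.eq_left_or_eq_right_or_mem hx with h | h | h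
        · exact absurd (h ▸ hst.left_mem .top α) hxK
        · exact absurd (h ▸ hst.right_mem .top α) hxK
        · exact h
      obtain rfl := T.eq_of_mem_interval (hβ hxg) hxI
      have hcl := Icc_subset_cl hg.lt hβ
      have hp := hS.conj_of_mem_closure hγ hTU hH (hcl ⟨le_rfl, hg.lt.le⟩) hg.left_mem
      have hq := hS.conj_of_mem_closure hγ hTU hH (hcl ⟨hg.lt.le, le_rfl⟩) hg.right_mem
      rw [linearize_of_isGap hg (Ioo_subset_Icc_self hxg),
        linearize_of_isGap (hst.isGap_br hg hβ) ⟨(T.br_strictMono _ _).monotone hxg.1.le,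
          (T.br_strictMono _ _).monotone hxg.2.le⟩, hp, hq, U.br_sub_br, T.br_sub_br, T.br_sub_br,
        ← hslope, mul_div_mul_left _ _ (T.slope_pos _ _).ne']
      have h1 := U.br_sub_br .top β (H p) (H p + (H q - H p) / (q - p) * (x - p))
      rw [← hslope, add_sub_cancel_left] at h1
      linear_combination -h1
  · intro G
    exact ⟨_, fun x hx => deriv_linearize G.2 hx⟩

end LinearConj

namespace AffineIEM

/-! ### The invariant derivative and the resulting decomposition of lengths. -/

section Derivative

variable {A : Type*} [Fintype A] {T U : AffineIEM A} {C : ℝ} {h : ℝ → ℝ}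

/-- The equal slopes cancel in the chain rule. For affine changes of variable the rule also holds
for the default value of `deriv`, so the invariance is exact at every point where `T` is defined. -/
theorem PartialConj.deriv_eq_of_maps (hh : PartialConj T U C univ h)
    (hslope : ∀ α, T.slope .top α = U.slope .top α) {x y : ℝ} (hxy : T.Maps x y) :
    deriv h y = deriv h x := by
  obtain ⟨α, hx, rfl⟩ := hxy
  rw [branch_eq_br]
  have hev : (fun z => h (T.br .top α z)) =ᶠ[nhds x] fun z => U.br .top α (h z) := by
    filter_upwards [isOpen_Ioo.mem_nhds hx] with z hz
    exact hh.conj α z (Ioo_subset_Icc_self hz) (mem_univ _)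
  have h1 := hev.deriv_eq
  have hT : ∀ z, T.br .top α z =
      T.slope .top α * z + (T.left .bot α - T.slope .top α * T.left .top α) := by
    intro z
    rw [br_def]
    simp only [Side.other_top]
    ring
  have hU : ∀ z, U.br .top α z =
      U.slope .top α * z + (U.left .bot α - U.slope .top α * U.left .top α) := by
    intro z
    rw [br_def]
    simp only [Side.other_top]
    ring
  simp only [hT, hU] at h1 ⊢
  rw [deriv_comp_mul_left (T.slope .top α)
    (fun z => h (z + (T.left .bot α - T.slope .top α * T.left .top α))), deriv_comp_add_const,
    deriv_add_const, deriv_const_mul_field, smul_eq_mul, ← hslope] at h1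
  exact mul_left_cancel₀ (T.slope_pos _ _).ne' h1

theorem MonoLip.deriv_nonneg {L : ℝ} (hh : MonoLip L C h) {x : ℝ} (hx : x ∈ Ioo 0 L) :
    0 ≤ deriv h x := by
  have hmono : MonotoneOn h (Icc 0 L) := fun x hx y hy hxy =>
    sub_nonneg.1 (hh x y hx.1 hxy hy.2).1
  rw [← derivWithin_of_mem_nhds (Icc_mem_nhds hx.1 hx.2)]
  exact hmono.derivWithin_nonneg

theorem IsInvariantModZero.inter_preimage {P : Set ℝ} (hP : T.IsInvariantModZero P) {φ : ℝ → ℝ}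
    (hφ : Measurable φ) (hinv : ∀ x y, T.Maps x y → φ y = φ x) {W : Set ℝ}
    (hW : MeasurableSet W) : T.IsInvariantModZero (P ∩ φ ⁻¹' W) := by
  refine ⟨hP.1.inter (hφ hW), ?_⟩
  have : {x | ∃ y ∈ P ∩ φ ⁻¹' W, T.Maps x y} = {x | ∃ y ∈ P, T.Maps x y} ∩ φ ⁻¹' W := by
    ext x
    constructor
    · rintro ⟨y, ⟨hy, hyW⟩, hxy⟩
      exact ⟨⟨y, hy, hxy⟩, by rwa [mem_preimage, ← hinv x y hxy]⟩
    · rintro ⟨⟨y, hy, hxy⟩, hxW⟩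
      exact ⟨y, ⟨hy, by rwa [mem_preimage, hinv x y hxy]⟩, hxy⟩
  rw [this]
  exact hP.2.inter (ae_eq_refl _)

/-- The preimage of any measurable set meets the atom in an invariant subset, so in a null or a full
one; countably many such sets separate the values. -/
theorem IsInvariantAtom.exists_ae_eq_const {P : Set ℝ} (hP : T.IsInvariantAtom P) {φ : ℝ → ℝ}
    (hφ : Measurable φ) (hinv : ∀ x y, T.Maps x y → φ y = φ x) :
    ∃ c, ∀ᵐ x, x ∈ P → φ x = c := by
  have hPm := hP.2.1.1
  obtain ⟨c, hc⟩ := Filter.exists_eventuallyEq_const_of_forall_separating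
    (l := ae (volume.restrict P)) (f := φ) MeasurableSet fun W hW => by
      rw [ae_restrict_iff' hPm, ae_restrict_iff' hPm]
      rcases hP.2.2.2 _ inter_subset_left (hP.2.1.inter_preimage hφ hinv hW) with h | h
      · right
        filter_upwards [compl_mem_ae_iff.2 h] with x hx hxP hxW using hx ⟨hxP, hxW⟩
      · left
        filter_upwards [compl_mem_ae_iff.2 h] with x hx hxP
        by_contra hxW
        exact hx ⟨hxP, fun h => hxW h.2⟩
  exact ⟨c, (ae_restrict_iff' hPm).1 hc⟩

theorem Gap.eq_const_on_orbit (G : T.Gap) {φ : ℝ → ℝ} {c : ℝ}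
    (hinv : ∀ x y, T.Maps x y → φ y = φ x) (hc : ∀ x ∈ G.set, φ x = c) :
    ∀ x ∈ G.orbit, φ x = c := by
  have hstep : ∀ n, (∀ x ∈ G.seq n, φ x = c) ↔ ∀ x ∈ G.seq (n + 1), φ x = c := by
    intro n
    have hsub : G.seq n ⊆ T.interval .top (((T.gapPerm ^ n) G).letter .top) :=
      Gap.subset_letter _ _
    have hm : ∀ x ∈ G.seq n, φ (T.br .top (((T.gapPerm ^ n) G).letter .top) x) = φ x :=
      fun x hx => hinv _ _ ⟨_, hsub hx, rfl⟩
    rw [G.seq_succ, forall_mem_image]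
    exact ⟨fun h x hx => (hm x hx).trans (h x hx), fun h x hx => (hm x hx).symm.trans (h hx)⟩
  have hall : ∀ n, ∀ x ∈ G.seq n, φ x = c := by
    intro n
    induction n using Int.induction_on with
    | zero => exact hc
    | succ n ih => exact (hstep _).1 ih
    | pred n ih =>
      rw [hstep]
      rwa [sub_add_cancel]
  intro x hx
  obtain ⟨n, hn⟩ := mem_iUnion.1 hx
  exact hall n x hn

/-- A Lipschitz function is the integral of its derivative, here a nonnegative combination of
indicators of the pieces. The coefficient is the value of the derivative times the measure of the
piece, as `lengthsOf` is normalized. -/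
theorem PartialConj.exists_len_eq_sum (hh : PartialConj T U C univ h) (hTU : T.comb = U.comb)
    {ι : Type*} [Fintype ι] {P : ι → Set ℝ} (hP : ∀ i, T.IsPiece (P i))
    (hd : ∀ i j, i ≠ j → volume (P i ∩ P j) = 0)
    (hcov : ∀ᵐ x, x ∈ Ioo 0 T.total → ∃ i, x ∈ P i)
    (hconst : ∀ i, ∃ c, ∀ᵐ x, x ∈ P i → deriv h x = c) :
    ∃ a : ι → ℝ, (∀ i, 0 ≤ a i) ∧ U.len .top = ∑ i, a i • T.lengthsOf (P i) := by
  classical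
  choose c hc using hconst
  have hc0 : ∀ i, 0 ≤ c i := by
    intro i
    by_contra hci
    apply (hP i).ne_zero
    have hIoo : ∀ᵐ x, x ∈ P i → x ∈ Ioo 0 T.total := by
      have := (Ioo_ae_eq_Icc (μ := volume) (a := (0 : ℝ)) (b := T.total)).mem_iff
      filter_upwards [this] with x hx hxP using hx.2 ((hP i).subset hxP)
    rw [measure_eq_zero_iff_ae_notMem]
    filter_upwards [hc i, hIoo] with x hx hx' hxP
    exact hci (hx hxP ▸ hh.monoLip.deriv_nonneg (hx' hxP))
  refine ⟨fun i => c i * volume.real (P i), fun i => mul_nonneg (hc0 i) (hP i).pos.le, ?_⟩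
  have hdis : ∀ᵐ x, ∀ i j, i ≠ j → x ∉ P i ∩ P j := by
    rw [ae_all_iff]
    intro i
    rw [ae_all_iff]
    intro j
    by_cases hij : i = j
    · exact Filter.Eventually.of_forall fun x h => absurd hij h
    · filter_upwards [compl_mem_ae_iff.2 (hd i j hij)] with x hx _ using hx
  have hφ : ∀ᵐ x, x ∈ Ioo 0 T.total →
      deriv h x = ∑ i, c i * (P i).indicator (fun _ => (1 : ℝ)) x := by
    filter_upwards [hcov, hdis, ae_all_iff.2 hc] with x h1 h2 h3 hx
    obtain ⟨i, hi⟩ := h1 hx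
    rw [Finset.sum_eq_single_of_mem i (Finset.mem_univ i), indicator_of_mem hi, mul_one, h3 i hi]
    intro j _ hji
    rw [indicator_of_notMem fun hj => h2 j i hji ⟨hj, hi⟩, mul_zero]
  funext α
  have hle : T.left .top α ≤ T.left .top α + T.len .top α := by linarith [T.len_pos .top α]
  have hl0 := T.left_nonneg .top α
  have hcl : uIcc (T.left .top α) (T.left .top α + T.len .top α) ⊆ Icc 0 T.total := by
    rw [uIcc_of_le hle]
    exact T.cl_subset .top α
  have h1 :=
    (hh.monoLip.lipschitzOnWith.mono hcl).absolutelyContinuousOnInterval.integral_deriv_eq_sub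
  rw [hh.right hTU, hh.left, add_sub_cancel_left] at h1
  have hint : ∀ i a b, IntervalIntegrable ((P i).indicator fun _ => (1 : ℝ)) volume a b :=
    fun i a b => intervalIntegrable_iff.2
      ((((locallyIntegrable_const (1 : ℝ)).indicator (hP i).inv.1).integrableOn_isCompact
        isCompact_uIcc).mono_set uIoc_subset_uIcc)
  have h2 : ∫ x in T.left .top α..T.left .top α + T.len .top α, deriv h x =
      ∫ x in T.left .top α..T.left .top α + T.len .top α,
        ∑ i, c i * (P i).indicator (fun _ => (1 : ℝ)) x := by
    refine intervalIntegral.integral_congr_ae_restrict ?_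
    rw [uIoc_of_le hle, ← restrict_Ioo_eq_restrict_Ioc]
    refine (ae_restrict_iff' measurableSet_Ioo).2 ?_
    filter_upwards [hφ] with x hx hxI
    exact hx (T.interval_subset .top α hxI)
  rw [← h1, h2, intervalIntegral.integral_finsetSum fun i _ => (hint i _ _).const_mul (c i),
    Finset.sum_apply]
  refine Finset.sum_congr rfl fun i _ => ?_
  rw [intervalIntegral.integral_const_mul,
    ← intervalIntegral.integral_interval_sub_left (hint i 0 _) (hint i 0 _),
    integral_indicator_one_eq_cdf (hP i).inv.1 hl0,
    integral_indicator_one_eq_cdf (hP i).inv.1 (hl0.trans hle)]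
  have h3 := mass_cdf (T := T) (hP i).inv.1 .top α
  unfold mass at h3
  rw [h3, Pi.smul_apply, smul_eq_mul, lengthsOf, mul_assoc,
    mul_div_cancel₀ _ (hP i).pos.ne']

end Derivative

end AffineIEM

/-- The line through `x` and `y` lies in the affine span, so near `x` it stays in `s` on the far
side of `y` too. -/
theorem exists_smul_sub_mem_of_mem_intrinsicInterior {E : Type*} [NormedAddCommGroup E]
    [NormedSpace ℝ E] {s : Set E} {x y : E} (hx : x ∈ intrinsicInterior ℝ s) (hy : y ∈ s) :
    ∃ ε : ℝ, 0 < ε ∧ x + ε • (x - y) ∈ s := by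
  obtain ⟨z, hz, rfl⟩ := mem_intrinsicInterior.1 hx
  set f : ℝ → affineSpan ℝ s := fun t =>
    ⟨AffineMap.lineMap (z : E) y t, AffineMap.lineMap_mem t z.2 (subset_affineSpan ℝ s hy)⟩
  have hf : Continuous f := by
    refine Continuous.subtype_mk ?_ _
    exact AffineMap.lineMap_continuous
  have h0 : f 0 = z := Subtype.ext (AffineMap.lineMap_apply_zero _ _)
  have hev : ∀ᶠ t in nhds (0 : ℝ), f t ∈ interior ((↑) ⁻¹' s : Set (affineSpan ℝ s)) :=
    hf.continuousAt.eventually_mem (h0 ▸ isOpen_interior.mem_nhds hz)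
  obtain ⟨δ, hδ, hball⟩ := Metric.eventually_nhds_iff.1 hev
  have hmem := interior_subset (hball (y := -(δ / 2)) (by
    rw [Real.dist_eq, sub_zero, abs_neg, abs_of_pos (half_pos hδ)]
    exact half_lt_self hδ))
  refine ⟨δ / 2, half_pos hδ, ?_⟩
  have h1 : (z : E) + (δ / 2) • ((z : E) - y) = AffineMap.lineMap (z : E) y (-(δ / 2)) := by
    rw [AffineMap.lineMap_apply_module']
    module
  rw [h1]
  exact hmem

namespace AffineIEM

/-! ### The collapsing maps as semiconjugacies, and the measure of their images. -/

section Collapse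

theorem monoLip_collapse {P : Set ℝ} (hP : MeasurableSet P) (L : ℝ) :
    MonoLip L (volume.real P)⁻¹ (collapse P) := by
  intro x y h0 hxy _
  have h1 : collapse P y - collapse P x = (volume.real P)⁻¹ * (cdf P y - cdf P x) := by
    unfold collapse cdf
    ring
  have h2 : 0 ≤ (volume.real P)⁻¹ := inv_nonneg.2 measureReal_nonneg
  rw [h1]
  exact ⟨mul_nonneg h2 (sub_nonneg.2 (cdf_mono P hxy)),
    mul_le_mul_of_nonneg_left (cdf_sub_le hP h0 hxy) h2⟩

theorem volume_image_eq_zero_of_lipschitzOnWith {f : ℝ → ℝ} {s : Set ℝ} {C : NNReal}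
    (hf : LipschitzOnWith C f s) (hs : volume s = 0) : volume (f '' s) = 0 := by
  have := hf.hausdorffMeasure_image_le zero_le_one
  rw [hausdorffMeasure_real, hs, mul_zero] at this
  exact nonpos_iff_eq_zero.1 this

/-- By Lebesgue differentiation the derivative is zero at almost every point of `Q`. Such points
have a null image, and so has the exceptional null set, because the map is Lipschitz. -/
theorem volume_collapse_image_eq_zero {P Q : Set ℝ} (hP : MeasurableSet P) {L : ℝ}
    (hQ : Q ⊆ Icc 0 L) (h : volume (P ∩ Q) = 0) : volume (collapse P '' Q) = 0 := by
  have hae : ∀ᵐ x, x ∈ Q → HasDerivAt (collapse P) 0 x := by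
    have h0 : ∀ᵐ x : ℝ, x ≠ 0 := by simp [ae_iff]
    filter_upwards [LocallyIntegrable.ae_hasDerivAt_integral
      ((locallyIntegrable_const (1 : ℝ)).indicator hP), compl_mem_ae_iff.2 h, h0]
      with x hder hx hx0 hxQ
    have hpos : 0 < x := lt_of_le_of_ne (hQ hxQ).1 (Ne.symm hx0)
    have h1 := (hder 0).div_const (volume.real P)
    rw [indicator_of_notMem fun hxP => hx ⟨hxP, hxQ⟩, zero_div] at h1
    refine h1.congr_of_eventuallyEq ?_
    filter_upwards [Ioi_mem_nhds hpos] with y hy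
    rw [integral_indicator_one_eq_cdf hP (le_of_lt hy)]
    rfl
  set N := {x | ¬ (x ∈ Q → HasDerivAt (collapse P) 0 x)}
  have hN0 : volume N = 0 := hae
  have h1 : volume (collapse P '' N) = 0 :=
    volume_image_eq_zero_of_lipschitzOnWith
      ((monoLip_collapse hP L).lipschitzOnWith.mono fun x hx => hQ (Classical.not_imp.1 hx).1) hN0
  have h2 : volume (collapse P '' (Q \ N)) = 0 := by
    refine addHaar_image_eq_zero_of_det_fderivWithin_eq_zero volume 
      (f' := fun _ => ContinuousLinearMap.toSpanSingleton ℝ 0) ?_ ?_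
    · intro x hx
      exact (not_not.1 hx.2 hx.1).hasFDerivAt.hasFDerivWithinAt
    · intro x _
      simp [ContinuousLinearMap.det]
  refine measure_mono_null ?_ (measure_union_null h1 h2)
  rw [← image_union]
  refine image_mono fun x hx => ?_
  by_cases hxN : x ∈ N
  · exact Or.inl hxN
  · exact Or.inr ⟨hx, hxN⟩

variable {A : Type*} [Fintype A] {T U : AffineIEM A} {P : Set ℝ}

theorem collapse_zero (P : Set ℝ) : collapse P 0 = 0 := by
  change cdf P 0 / _ = 0
  rw [cdf_zero, zero_div]

theorem collapse_total (hsub : P ⊆ Icc 0 T.total) (h0 : volume P ≠ 0) : collapse P T.total = 1 := by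
  change cdf P T.total / _ = 1
  rw [cdf_total hsub, div_self (volume_real_pos hsub h0).ne']

theorem collapse_image (hP : MeasurableSet P) (hsub : P ⊆ Icc 0 T.total) (h0 : volume P ≠ 0) :
    collapse P '' Icc 0 T.total = Icc 0 1 := by
  have hm := monoLip_collapse hP T.total
  have htot : 0 ≤ T.total := Finset.sum_nonneg fun α _ => (T.len_pos _ α).le
  apply Subset.antisymm
  · rintro _ ⟨x, hx, rfl⟩
    have h1 := (hm 0 x le_rfl hx.1 hx.2).1
    have h2 := (hm x _ hx.1 hx.2 le_rfl).1
    rw [collapse_zero] at h1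
    rw [collapse_total hsub h0] at h2
    exact ⟨by linarith, by linarith⟩
  · have := intermediate_value_Icc htot hm.continuousOn
    rwa [collapse_zero, collapse_total hsub h0] at this

/-- The complement of `P` has a null image, so the image of `P` fills almost all of `[0, 1]`. -/
theorem volume_collapse_image_self (hP : MeasurableSet P) (hsub : P ⊆ Icc 0 T.total)
    (h0 : volume P ≠ 0) : volume (collapse P '' P) = 1 := by
  have himg := collapse_image hP hsub h0
  have hle : volume (collapse P '' P) ≤ 1 := by
    have := measure_mono (μ := volume) (image_mono (f := collapse P) hsub)
    rwa [himg, Real.volume_Icc, sub_zero, ENNReal.ofReal_one] at this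
  refine le_antisymm hle ?_
  have hnull : volume (collapse P '' (Icc 0 T.total \ P)) = 0 :=
    volume_collapse_image_eq_zero hP sdiff_subset (by simp)
  calc (1 : ENNReal) = volume (collapse P '' Icc 0 T.total) := by
        rw [himg, Real.volume_Icc, sub_zero, ENNReal.ofReal_one]
    _ ≤ volume (collapse P '' P ∪ collapse P '' (Icc 0 T.total \ P)) := by
        rw [← image_union, union_sdiff_self]
        exact measure_mono (image_mono subset_union_right)
    _ ≤ volume (collapse P '' P) := by
        refine (measure_union_le _ _).trans ?_
        rw [hnull, add_zero]

theorem IsInvariantModZero.isSlopeFun_collapse (hP : T.IsInvariantModZero P) :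
    T.IsSlopeFun (collapse P) := by
  intro α x hx y hy
  have := hP.isSlopeFun α x hx y hy
  change cdf P _ / _ - cdf P _ / _ = _ * (cdf P _ / _ - cdf P _ / _)
  rw [← sub_div, this, mul_div_assoc, sub_div]

theorem mass_collapse (hP : MeasurableSet P) (α : A) :
    T.mass (collapse P) .top α = T.lengthsOf P α := by
  rw [lengthsOf, ← mass_cdf hP]
  change cdf P _ / _ - cdf P _ / _ = (cdf P _ - cdf P _) / _
  rw [sub_div]

/-- The increments of `collapse P` over the intervals of `T` are the lengths of `U` on both sides,
so endpoints correspond; the slope rule measured from a left endpoint is then the conjugacy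
relation. -/
theorem IsInvariantModZero.isSemiconj (hP : T.IsInvariantModZero P) (hsub : P ⊆ Icc 0 T.total)
    (h0 : volume P ≠ 0) (hTU : T.comb = U.comb) (hlen : U.len .top = T.lengthsOf P)
    (hslope : ∀ α, T.slope .top α = U.slope .top α) : T.IsSemiconj U (collapse P) := by
  have hm := monoLip_collapse hP.1 T.total
  have hs := hP.isSlopeFun_collapse
  have hmass : ∀ r α, T.mass (collapse P) r α = U.len r α := by
    intro r α
    have htop : T.mass (collapse P) .top α = U.len .top α := by rw [mass_collapse hP.1, hlen]
    cases r
    · exact htop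
    · rw [hs.mass_bot, htop, hslope]
      exact U.slope_mul_len .top α
  have hleft : ∀ r α, collapse P (T.left r α) = U.left r α := by
    intro r α
    have h1 := T.sum_increments_left r (collapse P) α
    rw [collapse_zero, sub_zero] at h1
    rw [← h1, left, hTU]
    exact Finset.sum_congr rfl fun β _ => hmass r β
  have htot : U.total = 1 := by
    rw [← collapse_total hsub h0, ← sub_zero (collapse P T.total), ← collapse_zero P,
      ← T.sum_mass _ .top]
    exact Finset.sum_congr rfl fun β _ => (hmass .top β).symm
  have hmono : MonotoneOn (collapse P) (Icc 0 T.total) := fun x hx y hy hxy =>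
    sub_nonneg.1 (hm x y hx.1 hxy hy.2).1
  refine ⟨hTU, hm.continuousOn, hmono, ?_, ?_⟩
  · rw [htot, collapse_image hP.1 hsub h0]
  · intro α x hx
    have hxcl := T.interval_subset_cl _ _ hx
    refine ⟨?_, ?_⟩
    · have hr : collapse P (T.left .top α + T.len .top α) = U.left .top α + U.len .top α := by
        rw [← hleft, ← hmass .top α, mass, add_sub_cancel]
      rw [interval, closure_Ioo (by linarith [U.len_pos .top α]), ← hr, ← hleft]
      exact ⟨hmono (T.cl_subset _ _ (T.left_mem_cl _ _)) (T.cl_subset _ _ hxcl) hxcl.1,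
        hmono (T.cl_subset _ _ hxcl) (T.cl_subset _ _ (T.right_mem_cl _ _)) hxcl.2⟩
    · have h1 := hs α _ (T.left_mem_cl _ _) x hxcl
      rw [br_left, Side.other_top, hleft, hleft, hslope] at h1
      rw [branch_eq_br, branch_eq_br, U.br_def, Side.other_top, ← h1, add_sub_cancel]

end Collapse

end AffineIEM

/-! ### Convex hulls of linearly independent families. -/

section Simplex

variable {ι E : Type*} [Fintype ι] [AddCommGroup E] [Module ℝ E] {v : ι → E}

theorem convexHull_range_eq_image_stdSimplex (v : ι → E) :
    convexHull ℝ (range v) = Fintype.linearCombination ℝ v '' stdSimplex ℝ ι := by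
  classical
  rw [← convexHull_basis_eq_stdSimplex, LinearMap.image_convexHull, ← range_comp]
  congr 2
  funext i
  simp [Fintype.linearCombination_apply]

/-- Linear independence makes the parametrization by the standard simplex injective, which reduces
the claim to the vertices of that simplex. -/
theorem LinearIndependent.extremePoints_convexHull_range (hv : LinearIndependent ℝ v) :
    (convexHull ℝ (range v)).extremePoints ℝ = range v := by
  classical
  refine Subset.antisymm extremePoints_convexHull_subset ?_
  rintro _ ⟨i, rfl⟩
  refine mem_extremePoints_iff_left.2 ⟨subset_convexHull ℝ _ (mem_range_self i), ?_⟩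
  rw [convexHull_range_eq_image_stdSimplex]
  rintro _ ⟨a, ha, rfl⟩ _ ⟨b, hb, rfl⟩ ⟨s, t, hs, ht, -, hst⟩
  rw [← map_smul, ← map_smul, ← map_add] at hst
  have hi : v i = Fintype.linearCombination ℝ v (Pi.single i 1) := by simp
  rw [hi] at hst ⊢
  have hinj := hv.fintypeLinearCombination_injective hst
  have ha0 : ∀ j, j ≠ i → a j = 0 := by
    intro j hj
    have := congrFun hinj j
    rw [Pi.single_eq_of_ne hj] at this
    simp only [Pi.add_apply, Pi.smul_apply, smul_eq_mul] at this
    nlinarith [ha.1 j, hb.1 j, mul_nonneg hs.le (ha.1 j), mul_nonneg ht.le (hb.1 j)]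
  congr 1
  funext j
  by_cases hj : j = i
  · subst hj
    have := ha.2
    rw [Finset.sum_eq_single_of_mem j (Finset.mem_univ j) fun k _ hk => ha0 k hk] at this
    rw [this, Pi.single_eq_same]
  · rw [ha0 j hj, Pi.single_eq_of_ne hj]

theorem LinearIndependent.exists_simplex [Nonempty ι] (hv : LinearIndependent ℝ v) :
    ∃ (n : ℕ) (s : Affine.Simplex ℝ E n), range s.points = range v := by
  obtain ⟨n, hn⟩ := Nat.exists_eq_succ_of_ne_zero (Fintype.card_ne_zero (α := ι))
  let e : Fin (n + 1) ≃ ι := (finCongr hn.symm).trans (Fintype.equivFin ι).symm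
  refine ⟨n, ⟨v ∘ e, ?_⟩, e.surjective.range_comp v⟩
  exact (hv.comp e e.injective).affineIndependent

end Simplex

namespace AffineIEM

/-! ### Independence of the choice of representatives. -/

section Representatives

variable {A : Type*} [Fintype A] {T : AffineIEM A}

/-- A representative of each wandering orbit and of each class of atoms. -/
def rep : T.WanderingOrbit ⊕ T.AtomClass → Set ℝ
  | .inl O => O.1
  | .inr c => (Quotient.out c).1

theorem represents_rep (i : T.WanderingOrbit ⊕ T.AtomClass) : T.Represents i (rep i) := by
  cases i with
  | inl O => rfl
  | inr c => exact ⟨(Quotient.out c).2, Quotient.out_eq c⟩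

theorem Represents.ae_eq {i : T.WanderingOrbit ⊕ T.AtomClass} {P Q : Set ℝ}
    (hP : T.Represents i P) (hQ : T.Represents i Q) : P =ᵐ[volume] Q := by
  cases i with
  | inl O =>
    have h : P = Q := Eq.trans hP (Eq.symm hQ)
    rw [h]
    exact ae_eq_refl _
  | inr c =>
    obtain ⟨h1, e1⟩ := hP
    obtain ⟨h2, e2⟩ := hQ
    exact Quotient.exact (e1.trans e2.symm)

theorem lengthsOf_congr {P Q : Set ℝ} (h : P =ᵐ[volume] Q) : T.lengthsOf P = T.lengthsOf Q := by
  funext α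
  rw [lengthsOf, lengthsOf, measureReal_congr h,
    measureReal_congr (h.inter (ae_eq_refl (T.interval .top α)))]

theorem IsInvariantAtom.isPiece {P : Set ℝ} (h : T.IsInvariantAtom P) : T.IsPiece P :=
  isPiece_of_subset h.2.1 h.1 h.2.2.1

theorem IsInvariantAtom.ae_eq_of_inter {P Q : Set ℝ} (hP : T.IsInvariantAtom P)
    (hQ : T.IsInvariantAtom Q) (h : volume (P ∩ Q) ≠ 0) : P =ᵐ[volume] Q := by
  have hinv := hP.2.1.inter hQ.2.1
  have h1 := (hP.2.2.2 _ inter_subset_left hinv).resolve_left h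
  have h2 := (hQ.2.2.2 _ inter_subset_right hinv).resolve_left h
  rw [sdiff_self_inter] at h1
  rw [sdiff_inter_self_eq_sdiff] at h2
  exact (ae_le_set.2 h1).antisymm (ae_le_set.2 h2)

/-- The closure is stable under branches in both directions; only the finitely many points where `T`
is undefined must be discarded. -/
theorem isInvariantModZero_closure (T : AffineIEM A) :
    T.IsInvariantModZero (closure T.singularOrbits) := by
  refine ⟨isClosed_closure.measurableSet, ?_⟩
  have hIoo := (Ioo_ae_eq_Icc (μ := volume) (a := (0 : ℝ)) (b := T.total)).mem_iff
  filter_upwards [hIoo, T.ae_exists_mem_interval .top] with x hx hex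
  refine propext ⟨?_, fun hxK => ?_⟩
  · rintro ⟨_, hy, α, hα, rfl⟩
    have := T.stable_closure.br_mem .bot α _ (T.br_top_mem hα) hy
    have hxx : T.br .bot α (T.br .top α x) = x := T.br_other_br .top α x
    exact hxx ▸ this
  · obtain ⟨α, hα⟩ := hex (hx.2 (T.closure_singularOrbits_subset hxK))
    exact ⟨_, T.stable_closure.br_mem .top α x hα hxK, α, hα, rfl⟩

end Representatives

end AffineIEM

/-! ### Orbits and atoms span the whole set of lengths. -/

section Decomposition

variable {A : Type*} [Fintype A] [Nontrivial A] {γ : RauzyPath A} {w : A → ℝ}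
  {T U : AffineIEM A} {S : ℕ → AffineIEM A}

open AffineIEM

theorem IsLevels.isPiece (h : IsLevels γ w T S) (hγ : γ.InfComplete)
    {i : T.WanderingOrbit ⊕ T.AtomClass} {P : Set ℝ} (hP : T.Represents i P) : T.IsPiece P := by
  cases i with
  | inl O =>
    obtain ⟨g, hg⟩ := (h.isWanderingOrbit_iff hγ).1 O.2
    have hPg : P = g.orbit := Eq.trans hP hg
    rw [hPg]
    exact isPiece_orbit g
  | inr c =>
    obtain ⟨h1, -⟩ := hP
    exact h1.isPiece

theorem IsLevels.volume_inter_eq_zero (h : IsLevels γ w T S) (hγ : γ.InfComplete)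
    {i j : T.WanderingOrbit ⊕ T.AtomClass} (hij : i ≠ j) {P Q : Set ℝ} (hP : T.Represents i P)
    (hQ : T.Represents j Q) : volume (P ∩ Q) = 0 := by
  have horb : ∀ (O : T.WanderingOrbit) (P Q : Set ℝ), T.Represents (.inl O) P →
      T.IsInvariantAtom Q → volume (P ∩ Q) = 0 := by
    intro O P Q hP hQ
    obtain ⟨g, hg⟩ := (h.isWanderingOrbit_iff hγ).1 O.2
    have hPg : P = g.orbit := Eq.trans hP hg
    rw [hPg, (g.orbit_disjoint.mono_right hQ.1).inter_eq, measure_empty]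
  cases i with
  | inl O =>
    cases j with
    | inl O' =>
      obtain ⟨g, hg⟩ := (h.isWanderingOrbit_iff hγ).1 O.2
      obtain ⟨g', hg'⟩ := (h.isWanderingOrbit_iff hγ).1 O'.2
      have hPg : P = g.orbit := Eq.trans hP hg
      have hQg : Q = g'.orbit := Eq.trans hQ hg'
      rw [hPg, hQg]
      rcases g.orbit_eq_or_disjoint g' with he | hd
      · exact absurd (congrArg Sum.inl (Subtype.ext (hg.trans (he.trans hg'.symm)))) hij
      · rw [hd.inter_eq, measure_empty]
    | inr c =>
      obtain ⟨h1, -⟩ := hQ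
      exact horb O P Q hP h1
  | inr c =>
    obtain ⟨h1, e1⟩ := hP
    cases j with
    | inl O =>
      rw [inter_comm]
      exact horb O Q P hQ h1
    | inr c' =>
      obtain ⟨h2, e2⟩ := hQ
      by_contra hne
      apply hij
      rw [← e1, ← e2]
      exact congrArg Sum.inr (Quotient.sound (h1.ae_eq_of_inter h2 hne))

theorem IsLevels.linearIndependent_lengthsOf_rep (h : IsLevels γ w T S) (hγ : γ.InfComplete) :
    LinearIndependent ℝ fun i : T.WanderingOrbit ⊕ T.AtomClass => T.lengthsOf (rep i) :=
  linearIndependent_lengthsOf (fun i => h.isPiece hγ (represents_rep i)) fun i j hij =>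
    h.volume_inter_eq_zero hγ hij (represents_rep i) (represents_rep j)

/-- Off the closure of the singular orbits the gaps cover everything. By linear independence there
are finitely many representatives, so removing them from the closure leaves an invariant set. If it
had positive measure it would contain an atom, disjoint from its own representative. -/
theorem IsLevels.ae_exists_mem_rep (h : IsLevels γ w T S) (hγ : γ.InfComplete) :
    ∀ᵐ x, x ∈ Ioo 0 T.total → ∃ i : T.WanderingOrbit ⊕ T.AtomClass, x ∈ rep i := by
  have hfin : Finite (T.WanderingOrbit ⊕ T.AtomClass) :=
    (h.linearIndependent_lengthsOf_rep hγ).finite_of_isNoetherian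
  have hgap : ∀ x ∈ Ioo 0 T.total, x ∉ closure T.singularOrbits →
      ∃ i : T.WanderingOrbit ⊕ T.AtomClass, x ∈ rep i := by
    intro x hx hxK
    obtain ⟨g, hg⟩ := exists_gap_of_notMem (Ioo_subset_Icc_self hx) hxK
    exact ⟨.inl ⟨g.orbit, (h.isWanderingOrbit_iff hγ).2 ⟨g, rfl⟩⟩, g.set_subset_orbit hg⟩
  have hrest : ∀ s : Finset (T.WanderingOrbit ⊕ T.AtomClass), T.IsInvariantModZero
      {x | x ∈ closure T.singularOrbits ∧ ∀ i ∈ s, x ∉ rep i} := by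
    classical
    intro s
    induction s using Finset.induction_on with
    | empty =>
      simp only [Finset.notMem_empty, false_imp_iff, implies_true, and_true]
      exact T.isInvariantModZero_closure
    | insert i s _ ih =>
      have := ih.diff (h.isPiece hγ (represents_rep i)).inv
      convert this using 1
      ext x
      simp only [Finset.mem_insert, forall_eq_or_imp, mem_ofPred, mem_sdiff]
      tauto
  have := Fintype.ofFinite (T.WanderingOrbit ⊕ T.AtomClass)
  have hnull : volume {x | x ∈ closure T.singularOrbits ∧
      ∀ i ∈ (Finset.univ : Finset (T.WanderingOrbit ⊕ T.AtomClass)), x ∉ rep i} = 0 := by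
    by_contra hne
    obtain ⟨P, hPR, hP⟩ := exists_isInvariantAtom (hrest Finset.univ) (fun x hx => hx.1) hne
    have hrep := (represents_rep (.inr (Quotient.mk T.atomSetoid ⟨P, hP⟩))).ae_eq
      (show T.Represents (.inr (Quotient.mk T.atomSetoid ⟨P, hP⟩)) P from ⟨hP, rfl⟩)
    apply hP.2.2.1
    rw [measure_eq_zero_iff_ae_notMem]
    filter_upwards [hrep.mem_iff] with x hx hxP
    exact (hPR hxP).2 _ (Finset.mem_univ _) (hx.2 hxP)
  filter_upwards [compl_mem_ae_iff.2 hnull] with x hx hx'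
  by_contra! hc
  by_cases hxK : x ∈ closure T.singularOrbits
  · exact hx ⟨hxK, fun i _ => hc i⟩
  · obtain ⟨i, hi⟩ := hgap x hx' hxK
    exact hc i hi

theorem slope_eq_of_mem_Aff (hT : T ∈ Aff γ w) (hU : U ∈ Aff γ w) (α : A) :
    T.slope .top α = U.slope .top α :=
  (slope_top_eq_exp_iff.2 (hT.2 α)).trans (slope_top_eq_exp_iff.2 (hU.2 α)).symm

/-- A point `x + ε • (x - y)` of the set has positive coordinates at all levels, which bounds `y` by
`(1 + ε) / ε` times `x` uniformly in `n`. -/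
theorem exists_chain_le_of_mem_intrinsicInterior (hne : ∀ n, γ.winner n ≠ γ.loser n)
    {x y : A → ℝ} (hx : x ∈ intrinsicInterior ℝ (AffOneLengths γ w))
    (hy : y ∈ AffOneLengths γ w) :
    ∃ C : ℝ, ∀ n α, γ.chain w n y α ≤ C * γ.chain w n x α := by
  obtain ⟨ε, hε, h⟩ := exists_smul_sub_mem_of_mem_intrinsicInterior hx hy
  refine ⟨(1 + ε) / ε, fun n α => ?_⟩
  have h1 := ((mem_AffOneLengths_iff hne).1 h).1 n α
  rw [map_add, map_smul, map_sub] at h1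
  simp only [Pi.add_apply, Pi.smul_apply, Pi.sub_apply, smul_eq_mul] at h1
  rw [div_mul_eq_mul_div, le_div_iff₀ hε]
  linarith

variable [Fintype (T.WanderingOrbit ⊕ T.AtomClass)]

theorem exists_len_eq_sum_of_mem_intrinsicInterior (hγ : γ.InfComplete) (hT : T ∈ AffOne γ w)
    (hint : T.len .top ∈ intrinsicInterior ℝ (AffOneLengths γ w)) (hU : U ∈ AffOne γ w) :
    ∃ a : T.WanderingOrbit ⊕ T.AtomClass → ℝ, (∀ i, 0 ≤ a i) ∧
      U.len .top = ∑ i, a i • T.lengthsOf (rep i) := by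
  obtain ⟨S, hS⟩ := exists_isLevels hT.1
  obtain ⟨V, hV⟩ := exists_isLevels hU.1
  obtain ⟨C, hC⟩ := exists_chain_le_of_mem_intrinsicInterior hS.winner_ne hint
    ⟨U, hU, rfl⟩
  obtain ⟨h, hh, hgap⟩ := hS.exists_linearConj hV hγ (C := C) fun n α => by
    rw [hS.len_top, hV.len_top]
    exact hC n α
  have hinv : ∀ x y, T.Maps x y → deriv h y = deriv h x := fun x y =>
    hh.deriv_eq_of_maps (slope_eq_of_mem_Aff hT.1 hU.1)
  refine hh.exists_len_eq_sum ((comb_of_mem_Aff hT.1).trans (comb_of_mem_Aff hU.1).symm)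
    (fun i => hS.isPiece hγ (represents_rep i)) (fun i j hij =>
      hS.volume_inter_eq_zero hγ hij (represents_rep i) (represents_rep j))
    (hS.ae_exists_mem_rep hγ) fun i => ?_
  cases i with
  | inl O =>
    obtain ⟨g, hg⟩ := (hS.isWanderingOrbit_iff hγ).1 O.2
    obtain ⟨c, hc⟩ := hgap g
    refine ⟨c, Filter.Eventually.of_forall fun x hx => g.eq_const_on_orbit hinv hc x ?_⟩
    rw [← hg]
    exact hx
  | inr c => exact (Quotient.out c).2.exists_ae_eq_const (measurable_deriv h) hinv

theorem AffOneLengths_eq_convexHull (hγ : γ.InfComplete) (hT : T ∈ AffOne γ w)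
    (hint : T.len .top ∈ intrinsicInterior ℝ (AffOneLengths γ w)) :
    AffOneLengths γ w =
      convexHull ℝ (range fun i : T.WanderingOrbit ⊕ T.AtomClass => T.lengthsOf (rep i)) := by
  obtain ⟨S, hS⟩ := exists_isLevels hT.1
  have hmem : ∀ i : T.WanderingOrbit ⊕ T.AtomClass, T.lengthsOf (rep i) ∈ AffOneLengths γ w :=
    fun i => by
      have hp := hS.isPiece hγ (represents_rep i)
      exact lengthsOf_mem hγ hT hp.inv hp.subset hp.ne_zero
  have hsum : ∀ x ∈ AffOneLengths γ w, ∑ α, x α = 1 := fun x hx =>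
    ((mem_AffOneLengths_iff hS.winner_ne).1 hx).2.2
  refine Subset.antisymm ?_
    (convexHull_min (range_subset_iff.2 hmem) (convex_AffOneLengths hS.winner_ne))
  rintro _ ⟨U, hU, rfl⟩
  obtain ⟨a, ha, h⟩ := exists_len_eq_sum_of_mem_intrinsicInterior hγ hT hint hU
  rw [convexHull_range_eq_image_stdSimplex]
  refine ⟨a, ⟨ha, ?_⟩, h.symm⟩
  -- All the vectors involved have coordinate sum one, which forces the coefficients to sum to one.
  have h1 := hsum _ ⟨U, hU, rfl⟩
  simp only [h, Finset.sum_apply, Pi.smul_apply, smul_eq_mul] at h1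
  rw [Finset.sum_comm] at h1
  simpa only [← Finset.mul_sum, hsum _ (hmem _), mul_one] using h1

end Decomposition

end

/-! ### Assembly. -/

theorem proposition2 {A : Type*} [Fintype A] [Nontrivial A]
    (γ : RauzyPath A) (hγ : γ.InfComplete) (w : A → ℝ) (hw : w ≠ 0)
    (hstar : ∃ Tstar ∈ AffOne γ 0, ∑ α, Tstar.len .top α * w α = 0) :
    (∃ (n : ℕ) (s : Affine.Simplex ℝ (A → ℝ) n),
      AffOneLengths γ w = convexHull ℝ (Set.range s.points)) ∧
    (intrinsicInterior ℝ (AffOneLengths γ w)).Nonempty ∧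
    ∀ T₀ ∈ AffOne γ w, T₀.len .top ∈ intrinsicInterior ℝ (AffOneLengths γ w) →
      ∃ e : (T₀.WanderingOrbit ⊕ T₀.AtomClass) ≃ AffOneVertices γ w,
        ∀ i P, T₀.Represents i P →
          (∀ α, (e i).1.len .top α =
            volume.real (P ∩ T₀.interval .top α) / volume.real P) ∧
          T₀.IsSemiconj (e i).1 (AffineIEM.collapse P) ∧
          volume (AffineIEM.collapse P '' P) = 1 ∧
          ∀ j, j ≠ i → ∀ Q, T₀.Represents j Q → volume (AffineIEM.collapse P '' Q) = 0 := by
  have hne := AffOneLengths_nonempty hγ hstar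
  have hint : (intrinsicInterior ℝ (AffOneLengths γ w)).Nonempty := by
    obtain ⟨_, T, hT, -⟩ := id hne
    obtain ⟨S, hS⟩ := exists_isLevels hT.1
    exact hne.intrinsicInterior (convex_AffOneLengths hS.winner_ne)
  refine ⟨?_, hint, ?_⟩
  · obtain ⟨x, hx⟩ := hint
    obtain ⟨T, hT, rfl⟩ := intrinsicInterior_subset hx
    obtain ⟨S, hS⟩ := exists_isLevels hT.1
    have hli := hS.linearIndependent_lengthsOf_rep hγ
    have := hli.finite_of_isNoetherian
    have := Fintype.ofFinite (T.WanderingOrbit ⊕ T.AtomClass)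
    have hhull := AffOneLengths_eq_convexHull hγ hT hx
    have hI : Nonempty (T.WanderingOrbit ⊕ T.AtomClass) := by
      rw [hhull, convexHull_nonempty_iff] at hne
      exact range_nonempty_iff_nonempty.1 hne
    obtain ⟨n, s, hs⟩ := hli.exists_simplex
    exact ⟨n, s, hs ▸ hhull⟩
  · intro T hT hx
    obtain ⟨S, hS⟩ := exists_isLevels hT.1
    have hli := hS.linearIndependent_lengthsOf_rep hγ
    have := hli.finite_of_isNoetherian
    have := Fintype.ofFinite (T.WanderingOrbit ⊕ T.AtomClass)
    have hext : (AffOneLengths γ w).extremePoints ℝ =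
        range fun i : T.WanderingOrbit ⊕ T.AtomClass => T.lengthsOf (AffineIEM.rep i) := by
      rw [AffOneLengths_eq_convexHull hγ hT hx, hli.extremePoints_convexHull_range]
    have hex : ∀ i : T.WanderingOrbit ⊕ T.AtomClass, ∃ U : AffOneVertices γ w,
        U.1.len .top = T.lengthsOf (AffineIEM.rep i) := by
      intro i
      have hi : T.lengthsOf (AffineIEM.rep i) ∈ (AffOneLengths γ w).extremePoints ℝ :=
        hext ▸ mem_range_self i
      obtain ⟨U, hU, hUi⟩ := extremePoints_subset hi
      have hUi' : U.len .top = T.lengthsOf (AffineIEM.rep i) := hUi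
      exact ⟨⟨U, hU, hUi' ▸ hi⟩, hUi'⟩
    choose f hf using hex
    have hbij : Function.Bijective f := by
      constructor
      · intro i j hij
        apply hli.injective
        change T.lengthsOf _ = T.lengthsOf _
        rw [← hf, ← hf, hij]
      · rintro ⟨U, hU, hUe⟩
        rw [hext] at hUe
        obtain ⟨i, hi⟩ := hUe
        exact ⟨i, Subtype.ext (eq_of_len_top_eq (f i).2.1.1 hU.1 ((hf i).trans hi))⟩
    refine ⟨Equiv.ofBijective f hbij, fun i P hP => ?_⟩
    have hp := hS.isPiece hγ hP
    -- The vertex was built from the chosen representative; `P` differs from it by a null set, which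
    -- the lengths do not see.
    have hlen : (f i).1.len .top = T.lengthsOf P :=
      (hf i).trans (AffineIEM.lengthsOf_congr ((AffineIEM.represents_rep i).ae_eq hP))
    refine ⟨fun α => congrFun hlen α, ?_,
      AffineIEM.volume_collapse_image_self hp.inv.1 hp.subset hp.ne_zero, fun j hji Q hQ => ?_⟩
    · exact hp.inv.isSemiconj hp.subset hp.ne_zero
        ((comb_of_mem_Aff hT.1).trans (comb_of_mem_Aff (f i).2.1.1).symm) hlen
        (slope_eq_of_mem_Aff hT.1 (f i).2.1.1)
    · exact AffineIEM.volume_collapse_image_eq_zero hp.inv.1 (hS.isPiece hγ hQ).subset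
        (hS.volume_inter_eq_zero hγ hji.symm hP hQ)
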